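/- **Approximation algorithm for the partition function at high temperatures.** Let $H=\sum_{X} H_X$ be a Hamiltonian on a lattice $\Lambda\subset\mathbb Z^D$ of $n$ sites, with a $d$-dimensional qudit on each site, where the sum is over distinct non-empty sets $X\subseteq\Lambda$ and $H_X$ is a Hermitian operator acting on the qudits in $X$ only. Assume that $H$ is geometrically local: $|X|\le\kappa$ and $\operatorname{diam}(X)\le R$ (in the graph distance of $\mathbb Z^D$) for each term; that $\|H_X\|\le h$ in operator norm; and that $H$ has growth constant $g$: for every site $x\in\Lambda$ the terms that involve $x$ have total strength $\sum_{X\ni x}\|H_X\|\le gh$. Let $Z_\beta(\Lambda)=\operatorname{Tr}\,e^{-\beta H}$ and $\beta_0=1/(5e\,g\,h\,\kappa)$. For all constants $D,d\ge 1,\kappa\ge 1,R,g>0,h>0$ (with $D,d,\kappa,R$ integers) there are a deterministic algorithm and a constant $C$ with the following property. For every $n\ge 2$, every such $H$, every $\beta\in\mathbb C$ with $|\beta|\le\beta_0$ and every $\varepsilon\in(0,1)$, where the matrix entries of the $H_X$ in the product basis and $\beta$ have rational real and imaginary parts and $\varepsilon$ is rational, the algorithm, given the list of the local terms, $\beta$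 and $\varepsilon$, halts with an output $\tilde Z$ (a complex number with rational real and imaginary parts) such that $$|\tilde Z-Z_\beta(\Lambda)|\le\varepsilon\,|Z_\beta(\Lambda)|$$ after at most $$\bigl(\ell\cdot n^{\log(n/\varepsilon)}\bigr)^{C}$$ steps of a random access machine with logarithmic (bit) cost, where $\ell$ is the largest bit length of an integer in the input. In particular the running time is quasi-polynomial, $n^{O(\log(n/\varepsilon))}$, when the numbers of the input have polynomially many bits in $n$. -/

import Mathlib

/-! ### A random access machine with logarithmic (bit) cost -/

namespace RAM

/-- The memory: every address (an integer) holds an integer. -/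
abbrev Mem := ℤ → ℤ

/-- The number of binary digits of `|z|`. -/
def bits (z : ℤ) : ℕ := Nat.size z.natAbs

/-- The arithmetic operations; `quo` is integer division (rounding down for a positive divisor). -/
inductive ArithOp
  | add | sub | mul | quo

/-- The value of an arithmetic operation. -/
def ArithOp.apply : ArithOp → ℤ → ℤ → ℤ
  | .add, x, y => x + y
  | .sub, x, y => x - y
  | .mul, x, y => x * y
  | .quo, x, y => x / y

/-- Arithmetic expressions; `load e` is the content of the cell whose address is the value of `e`. -/
inductive Expn
  | const (z : ℤ)
  | load (e : Expn)
  | op (o : ArithOp) (e f : Expn)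

/-- The value of an expression. -/
def Expn.eval (μ : Mem) : Expn → ℤ
  | .const z => z
  | .load e => μ (e.eval μ)
  | .op o e f => o.apply (e.eval μ) (f.eval μ)

/-- The number of bit operations charged for evaluating an expression. An access to memory pays for
the bits of the address and of the content, an arithmetic operation pays the product of the lengths
of its operands (the cost of schoolbook multiplication and division). -/
def Expn.cost (μ : Mem) : Expn → ℕ
  | .const z => 1 + bits z
  | .load e => e.cost μ + (1 + bits (e.eval μ) + bits (μ (e.eval μ)))
  | .op _ e f => e.cost μ + f.cost μ + (1 + bits (e.eval μ)) * (1 + bits (f.eval μ))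

/-- Programs: `store a e` writes the value of `e` into the cell whose address is the value of `a`;
conditionals and loops test whether the value of an expression is positive. -/
inductive Prog
  | store (a e : Expn)
  | seq (p q : Prog)
  | cond (c : Expn) (p q : Prog)
  | loop (c : Expn) (p : Prog)

/-- `Runs p μ ν t`: started in memory `μ`, the program `p` halts in memory `ν` after `t` steps. -/
inductive Runs : Prog → Mem → Mem → ℕ → Prop
  | store (a e : Expn) (μ : Mem) :
      Runs (.store a e) μ (Function.update μ (a.eval μ) (e.eval μ))
        (a.cost μ + e.cost μ + (1 + bits (a.eval μ) + bits (e.eval μ)))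
  | seq {p q : Prog} {μ ν ξ : Mem} {s t : ℕ} (hp : Runs p μ ν s) (hq : Runs q ν ξ t) :
      Runs (.seq p q) μ ξ (s + t)
  | cond_pos {c : Expn} {p q : Prog} {μ ν : Mem} {t : ℕ} (hc : 0 < c.eval μ)
      (hp : Runs p μ ν t) : Runs (.cond c p q) μ ν (c.cost μ + 1 + t)
  | cond_neg {c : Expn} {p q : Prog} {μ ν : Mem} {t : ℕ} (hc : ¬ 0 < c.eval μ)
      (hq : Runs q μ ν t) : Runs (.cond c p q) μ ν (c.cost μ + 1 + t)
  | loop_pos {c : Expn} {p : Prog} {μ ν ξ : Mem} {s t : ℕ} (hc : 0 < c.eval μ)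
      (hp : Runs p μ ν s) (hl : Runs (.loop c p) ν ξ t) :
      Runs (.loop c p) μ ξ (c.cost μ + 1 + s + t)
  | loop_neg {c : Expn} {p : Prog} {μ : Mem} (hc : ¬ 0 < c.eval μ) :
      Runs (.loop c p) μ μ (c.cost μ + 1)

/-- The initial memory: the input is written in the cells `0, 1, 2, …`, all other cells hold `0`. -/
def initMem (w : List ℤ) : Mem := fun a => if 0 ≤ a then w.getD a.toNat 0 else 0

/-- The largest bit length of a number of the input. -/
def maxBits (w : List ℤ) : ℕ := (w.map bits).foldr max 0

/-- The complex number that a halting program puts out: `(a + b * i) / c`, where `a, b, c` are the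
contents of the cells `0, 1, 2`. -/
noncomputable def output (ν : Mem) : ℂ := ((ν 0 : ℂ) + (ν 1 : ℂ) * Complex.I) / (ν 2 : ℂ)

end RAM

/-! ### Geometrically-local Hamiltonians on a finite part of `ℤ ^ D` -/

/-- A finite description of a local term `H_X` of a Hamiltonian on `n` sites that carry qudits of
dimension `d`: the distinct sites `site 0, …, site (size - 1)` of `X` and a matrix in the product
basis of these sites, whose entries have rational real and imaginary parts. -/
structure LocalTerm (n d : ℕ) where
  size : ℕ
  site : Fin size ↪ Fin n
  re : Matrix (Fin size → Fin d) (Fin size → Fin d) ℚ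
  im : Matrix (Fin size → Fin d) (Fin size → Fin d) ℚ

namespace LocalTerm

variable {n d : ℕ}

/-- The set `X` of sites. -/
def supp (T : LocalTerm n d) : Finset (Fin n) := Finset.univ.map T.site

/-- The local term as a complex matrix on the qudits in `X`. -/
noncomputable def mat (T : LocalTerm n d) :
    Matrix (Fin T.size → Fin d) (Fin T.size → Fin d) ℂ :=
  Matrix.of fun s t => (T.re s t : ℂ) + (T.im s t : ℂ) * Complex.I

/-- The operator norm of the local term, for the Euclidean (Hilbert space) norm. -/
noncomputable def opNorm (T : LocalTerm n d) : ℝ := ‖Matrix.toEuclideanCLM (𝕜 := ℂ) T.mat‖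

/-- The local term as an operator on all `n` qudits: `T.mat` on the sites in `X`, tensored with the
identity on the other sites. -/
noncomputable def onLattice (T : LocalTerm n d) : Matrix (Fin n → Fin d) (Fin n → Fin d) ℂ :=
  Matrix.of fun s t =>
    if ∀ v ∉ T.supp, s v = t v then T.mat (fun i => s (T.site i)) (fun i => t (T.site i)) else 0

end LocalTerm

/-- A Hamiltonian `H = ∑_X H_X` on a lattice of `n` sites in `ℤ ^ D`, given by the list of its local
terms; `pos` places the sites in `ℤ ^ D`. -/
structure LatticeHamiltonian (D d n : ℕ) where
  pos : Fin n ↪ (Fin D → ℤ)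
  terms : List (LocalTerm n d)
  isHermitian : ∀ T ∈ terms, T.mat.IsHermitian
  nonempty : ∀ T ∈ terms, T.supp.Nonempty
  distinct : terms.Pairwise fun S T => S.supp ≠ T.supp

namespace LatticeHamiltonian

variable {D d n : ℕ}

/-- The graph distance of two points of `ℤ ^ D`. -/
def latticeDist (x y : Fin D → ℤ) : ℕ := ∑ i, (x i - y i).natAbs

/-- The operator `H = ∑_X H_X` on the Hilbert space of all sites. -/
noncomputable def toMatrix (H : LatticeHamiltonian D d n) :
    Matrix (Fin n → Fin d) (Fin n → Fin d) ℂ :=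
  (H.terms.map LocalTerm.onLattice).sum

/-- The partition function `Z_β = Tr exp (-β H)` at complex inverse temperature. -/
noncomputable def partitionFunction (H : LatticeHamiltonian D d n) (β : ℂ) : ℂ :=
  Matrix.trace (NormedSpace.exp (-β • H.toMatrix))

/-- `H` is `(κ, R)`-local: every local term acts on at most `κ` sites, of diameter at most `R`. -/
def IsGeomLocal (H : LatticeHamiltonian D d n) (κ R : ℕ) : Prop :=
  ∀ T ∈ H.terms, T.supp.card ≤ κ ∧
    ∀ x ∈ T.supp, ∀ y ∈ T.supp, latticeDist (H.pos x) (H.pos y) ≤ R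

/-- Every local term has operator norm at most `h`. -/
def NormBound (H : LatticeHamiltonian D d n) (h : ℝ) : Prop := ∀ T ∈ H.terms, T.opNorm ≤ h

/-- `H` has growth constant `g` (with respect to the bound `h` on the norms of the local terms): the
interactions that involve a given site have total strength at most `g * h`. -/
def HasGrowthConstant (H : LatticeHamiltonian D d n) (g h : ℝ) : Prop :=
  ∀ x : Fin n, ((H.terms.filter fun T => x ∈ T.supp).map LocalTerm.opNorm).sum ≤ g * h

end LatticeHamiltonian

/-- The radius `β₀ = 1 / (5 e g h κ)` of the high-temperature zero-free disk. -/
noncomputable def betaZero (g h : ℝ) (κ : ℕ) : ℝ := 1 / (5 * Real.exp 1 * g * h * κ)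

/-! ### The input of an algorithm for the partition function -/

/-- The complex number with the given rational real and imaginary parts. -/
noncomputable def gaussToComplex (z : ℚ × ℚ) : ℂ := (z.1 : ℂ) + (z.2 : ℂ) * Complex.I

/-- A rational number is written as numerator and (positive) denominator in lowest terms. -/
def encodeRat (q : ℚ) : List ℤ := [q.num, (q.den : ℤ)]

/-- A local term is written as its number of sites, the list of its sites, and the matrix entries,
row by row; the `d ^ size` basis states are numbered by reading them in base `d`, where the state
of `site 0` is the least significant digit. -/
def encodeTerm {n d : ℕ} (T : LocalTerm n d) : List ℤ :=
  (T.size : ℤ) :: (List.ofFn fun i => ((T.site i : ℕ) : ℤ)) ++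
    (List.ofFn fun a : Fin (d ^ T.size) => (List.ofFn fun b : Fin (d ^ T.size) =>
      encodeRat (T.re (finFunctionFinEquiv.symm a) (finFunctionFinEquiv.symm b)) ++
      encodeRat (T.im (finFunctionFinEquiv.symm a) (finFunctionFinEquiv.symm b))).flatten).flatten

/-- The input `(H, β, ε)`: the number of sites, the number of local terms, the inverse temperature,
the accuracy, and the local terms. -/
def encodeInput {D d n : ℕ} (H : LatticeHamiltonian D d n) (β : ℚ × ℚ) (ε : ℚ) : List ℤ :=
  [(n : ℤ), (H.terms.length : ℤ)] ++ encodeRat β.1 ++ encodeRat β.2 ++ encodeRat ε ++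
    H.terms.flatMap encodeTerm

/-! The proof has an analytic half (log Z is well approximated by a short Taylor polynomial) and an
algorithmic half (the exact coefficients are cheap enough to compute).

Analysis. For `|z| ≤ 1.1 * β₀` no partial normalized partition function `Z(A) = Tr exp(-z ∑_{i ∈ A}
H_i) / d ^ n` vanishes (`partialZ_ne_zero`). The argument removes the terms at one site after the
other. It carries along a bound on alternating sums `∑_{C ⊆ B} ± Z(A ∪ C)` relative to `Z(A)`, with
a price `exp t` for every site in which `A` and `B` may overlap (`altSumBound_and_ne_zero`). Two
inputs feed the induction: `Z` is multiplicative over disjoint supports (`partialZ_union`), and the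
alternating sum with `A = ∅` is at most `∏ (exp(|z| ‖H_i‖) - 1)` (`norm_altSum_exp_le`), because
only products in which every member of `B` occurs survive the cancellation. On a zero-free disk Z
has a holomorphic logarithm, whose real part is `O(n)`. Borel-Carathéodory and Cauchy's estimate
make its Taylor terms at `|z| ≤ β₀` decay like `4 n (20/21) ^ j` (`exists_logZ_coeff`). Hence
`O(log(n/ε))` coefficients give log Z up to `ε/4`, and exponentiating by a truncated series of `O(n
+ log(n/ε))` terms gives relative error `ε` (`norm_sum_sub_exp_le`, `norm_outNum_div_sub_le`).

Algorithm. The Taylor coefficients of Z are traces `Tr H ^ N`, and Newton's recurrence turns them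
into those of log Z. Each local term is a weighted sum of matrix units, so `Tr H ^ N` is a sum over
words of length `N` in `n ^ O(1)` letters. The trace of a product of matrix units factorizes over
the sites and is found by following the state of each site separately (`toComplex_moment`). For `N =
O(L)`, where `L` is the bit length of `⌊n/ε⌋`, there are `n ^ O(L)` words (`letters_pow_le`). All
numbers are Gaussian integers over common denominators, so the computation is exact.

Running time. Everything is bounded by powers of `X = maxBits * n ^ L`, and `X_le` compares `X` with
the required bound. The predicate `Comp` says that a function is computed by a program in time
polynomial in `X`, with values of polynomial length, for every admissible choice of registers. It is
closed under arithmetic, branching, bounded loops and tabulation, so the program is obtained by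
following the formulas (`exists_prog`). -/

namespace RAM

/-! ### Bit lengths -/

theorem bits_le {z : ℤ} {k : ℕ} : bits z ≤ k ↔ z.natAbs < 2 ^ k := Nat.size_le

theorem natAbs_lt_two_pow_bits (z : ℤ) : z.natAbs < 2 ^ bits z := bits_le.1 le_rfl

theorem bits_le_of_natAbs_le {x y : ℤ} (h : x.natAbs ≤ y.natAbs) : bits x ≤ bits y :=
  Nat.size_le_size h

theorem bits_le_natAbs (z : ℤ) : bits z ≤ z.natAbs := bits_le.2 Nat.lt_two_pow_self

@[simp] theorem bits_zero : bits 0 = 0 := rfl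

@[simp] theorem bits_natCast (n : ℕ) : bits (n : ℤ) = Nat.size n := rfl

theorem bits_natCast_le (n : ℕ) : bits (n : ℤ) ≤ n := bits_le_natAbs n

theorem bits_add_le (x y : ℤ) : bits (x + y) ≤ max (bits x) (bits y) + 1 := by
  rw [bits_le, pow_succ]
  have hx := natAbs_lt_two_pow_bits x
  have hy := natAbs_lt_two_pow_bits y
  have h1 : 2 ^ bits x ≤ 2 ^ max (bits x) (bits y) := Nat.pow_le_pow_right (by norm_num) (le_max_left _ _)
  have h2 : 2 ^ bits y ≤ 2 ^ max (bits x) (bits y) := Nat.pow_le_pow_right (by norm_num) (le_max_right _ _)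
  have := Int.natAbs_add_le x y
  omega

theorem bits_neg (x : ℤ) : bits (-x) = bits x := by simp [bits]

theorem bits_sub_le (x y : ℤ) : bits (x - y) ≤ max (bits x) (bits y) + 1 := by
  simpa [sub_eq_add_neg, bits_neg] using bits_add_le x (-y)

theorem bits_mul_le (x y : ℤ) : bits (x * y) ≤ bits x + bits y := by
  rw [bits_le, pow_add, Int.natAbs_mul]
  have hx := natAbs_lt_two_pow_bits x
  have hy := natAbs_lt_two_pow_bits y
  gcongr

theorem bits_ediv_le (x y : ℤ) : bits (x / y) ≤ bits x :=
  bits_le_of_natAbs_le (Int.natAbs_ediv_le_natAbs x y)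

/-- Uses only `card < 2 ^ card`. The logarithm of the cardinality is not needed, since the numbers
of summands in the loops are themselves polynomially bounded. -/
theorem bits_sum_le {ι : Type*} (s : Finset ι) (f : ι → ℤ) (b : ℕ) (h : ∀ i ∈ s, bits (f i) ≤ b) :
    bits (∑ i ∈ s, f i) ≤ s.card + b := by
  rw [bits_le]
  calc (∑ i ∈ s, f i).natAbs ≤ ∑ i ∈ s, (f i).natAbs := Int.natAbs_sum_le _ _
    _ ≤ ∑ _i ∈ s, 2 ^ b := Finset.sum_le_sum fun i hi => (bits_le.1 (h i hi)).le
    _ = s.card * 2 ^ b := by simp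
    _ < 2 ^ s.card * 2 ^ b := by gcongr; exact Nat.lt_two_pow_self
    _ = _ := (pow_add _ _ _).symm

theorem bits_prod_le {ι : Type*} (s : Finset ι) (f : ι → ℤ) (b : ℕ) (h : ∀ i ∈ s, bits (f i) ≤ b) :
    bits (∏ i ∈ s, f i) ≤ s.card * b + 1 := by
  rw [bits_le]
  calc (∏ i ∈ s, f i).natAbs = ∏ i ∈ s, (f i).natAbs := map_prod Int.natAbsHom _ _
    _ ≤ ∏ _i ∈ s, 2 ^ b := Finset.prod_le_prod (by simp) fun i hi => (bits_le.1 (h i hi)).le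
    _ = 2 ^ (s.card * b) := by simp [pow_mul']
    _ < _ := Nat.pow_lt_pow_right (by norm_num) (by simp)

/-! ### Registers -/

/-- The memory cell that serves as register `r`. -/
def reg (r : ℕ) : ℤ := -(2 * (r : ℤ) + 2)

theorem reg_injective : Function.Injective reg := fun a b h => by
  simp only [reg] at h; omega

@[simp] theorem reg_inj {a b : ℕ} : reg a = reg b ↔ a = b := reg_injective.eq_iff

/-- The memory cells that are not registers. -/
def IsData (x : ℤ) : Prop := 0 ≤ x ∨ x % 2 = 1

theorem IsData.ne_reg {x : ℤ} (h : IsData x) (i : ℕ) : x ≠ reg i := by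
  simp only [IsData, reg] at *; omega

/-- The memories agree outside of the registers with numbers `≥ r`. -/
def Frame (r : ℕ) (μ ν : Mem) : Prop := ∀ x, (∀ i, r ≤ i → x ≠ reg i) → ν x = μ x

theorem Frame.refl (r : ℕ) (μ : Mem) : Frame r μ μ := fun _ _ => rfl

theorem Frame.trans {r : ℕ} {μ ν ξ : Mem} (h : Frame r μ ν) (h' : Frame r ν ξ) : Frame r μ ξ :=
  fun x hx => (h' x hx).trans (h x hx)

theorem Frame.mono {r s : ℕ} {μ ν : Mem} (hrs : r ≤ s) (h : Frame s μ ν) : Frame r μ ν :=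
  fun x hx => h x fun i hi => hx i (hrs.trans hi)

theorem Frame.update {r s : ℕ} {μ ν : Mem} (h : Frame r μ ν) (hrs : r ≤ s) (z : ℤ) :
    Frame r μ (Function.update ν (reg s) z) := fun x hx => by
  rw [Function.update_of_ne (hx s hrs), h x hx]

theorem Frame.reg_eq {r s : ℕ} {μ ν : Mem} (h : Frame r μ ν) (hs : s < r) :
    ν (reg s) = μ (reg s) := h _ fun i hi e => by rw [reg_inj] at e; omega

theorem Frame.data_eq {r : ℕ} {μ ν : Mem} (h : Frame r μ ν) {x : ℤ} (hx : IsData x) :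
    ν x = μ x := h _ fun i _ => hx.ne_reg i

/-- The content of register `r`. -/
def get (r : ℕ) : Expn := .load (.const (reg r))

/-- Write the value of an expression into register `r`. -/
def put (r : ℕ) (e : Expn) : Prog := .store (.const (reg r)) e

@[simp] theorem get_eval (μ : Mem) (r : ℕ) : (get r).eval μ = μ (reg r) := rfl

theorem get_cost (μ : Mem) (r : ℕ) :
    (get r).cost μ = 2 + 2 * bits (reg r) + bits (μ (reg r)) := by
  simp only [get, Expn.cost, Expn.eval]; ring

theorem runs_put (r : ℕ) (e : Expn) (μ : Mem) :
    Runs (put r e) μ (Function.update μ (reg r) (e.eval μ))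
      (2 + 2 * bits (reg r) + e.cost μ + bits (e.eval μ)) := by
  rw [show 2 + 2 * bits (reg r) + e.cost μ + bits (e.eval μ) = (Expn.const (reg r)).cost μ +
    e.cost μ + (1 + bits ((Expn.const (reg r)).eval μ) + bits (e.eval μ)) by
      simp only [Expn.cost, Expn.eval]; omega]
  exact Runs.store (.const (reg r)) e μ

/-! ### Computations in a context -/

/-- A family of situations in which programs are run: `mem a` is the content of the data cells,
`var i a` for `i < k` are the contents of the `k` registers in use, and `size a` is the quantity in
which running times are polynomial. -/
structure Ctx (α : Type) where
  dom : α → Prop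
  size : α → ℕ
  mem : α → Mem
  k : ℕ
  var : ℕ → α → ℤ
  two_le : ∀ a, dom a → 2 ≤ size a
  mem_bits : ∃ c, ∀ a, dom a → ∀ x, bits (mem a x) ≤ size a ^ c
  var_bits : ∀ i < k, ∃ c, ∀ a, dom a → bits (var i a) ≤ size a ^ c

namespace Ctx

variable {α β : Type}

/-- `t` is bounded by a power of the size. -/
def PB (Γ : Ctx α) (t : α → ℕ) : Prop := ∃ c, ∀ a, Γ.dom a → t a ≤ Γ.size a ^ c

theorem one_le (Γ : Ctx α) {a : α} (h : Γ.dom a) : 1 ≤ Γ.size a :=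
  (by norm_num : 1 ≤ 2).trans (Γ.two_le a h)

theorem PB.mono {Γ : Ctx α} {s t : α → ℕ} (ht : Γ.PB t) (h : ∀ a, Γ.dom a → s a ≤ t a) :
    Γ.PB s := let ⟨c, hc⟩ := ht; ⟨c, fun a ha => (h a ha).trans (hc a ha)⟩

/-- `n < 2 ^ n ≤ size ^ n`. The field `two_le` of a context exists so that constants, and sums in
`PB.add`, are absorbed into a single power of the size. -/
theorem PB.const {Γ : Ctx α} (n : ℕ) : Γ.PB fun _ => n :=
  ⟨n, fun a ha => Nat.lt_two_pow_self.le.trans (Nat.pow_le_pow_left (Γ.two_le a ha) n)⟩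

theorem PB.mul {Γ : Ctx α} {s t : α → ℕ} (hs : Γ.PB s) (ht : Γ.PB t) :
    Γ.PB fun a => s a * t a := by
  obtain ⟨c, hc⟩ := hs
  obtain ⟨e, he⟩ := ht
  exact ⟨c + e, fun a ha => by rw [pow_add]; exact Nat.mul_le_mul (hc a ha) (he a ha)⟩

theorem PB.add {Γ : Ctx α} {s t : α → ℕ} (hs : Γ.PB s) (ht : Γ.PB t) :
    Γ.PB fun a => s a + t a := by
  obtain ⟨c, hc⟩ := hs
  obtain ⟨e, he⟩ := ht
  refine ⟨c + e + 1, fun a ha => ?_⟩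
  have h1 := Γ.one_le ha
  have h2 := Nat.pow_le_pow_right h1 (Nat.le_add_right c e)
  have h3 := Nat.pow_le_pow_right h1 (Nat.le_add_left e c)
  have h4 := Nat.mul_le_mul_left (Γ.size a ^ (c + e)) (Γ.two_le a ha)
  have := hc a ha
  have := he a ha
  rw [pow_succ]
  beta_reduce
  omega

theorem PB.max {Γ : Ctx α} {s t : α → ℕ} (hs : Γ.PB s) (ht : Γ.PB t) :
    Γ.PB fun a => max (s a) (t a) := (hs.add ht).mono fun a _ => by omega

theorem PB.pow {Γ : Ctx α} {s : α → ℕ} (hs : Γ.PB s) (n : ℕ) : Γ.PB fun a => s a ^ n := by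
  obtain ⟨c, hc⟩ := hs
  exact ⟨c * n, fun a ha => by rw [pow_mul]; exact Nat.pow_le_pow_left (hc a ha) n⟩

theorem PB.size {Γ : Ctx α} : Γ.PB Γ.size := ⟨1, fun a _ => by simp⟩

/-- The memory `μ` realizes the situation `a`, with variable `i` held in register `ρ i`. -/
def Holds (Γ : Ctx α) (ρ : ℕ → ℕ) (a : α) (μ : Mem) : Prop :=
  (∀ x, IsData x → μ x = Γ.mem a x) ∧ ∀ i < Γ.k, μ (reg (ρ i)) = Γ.var i a

theorem Holds.of_frame {Γ : Ctx α} {ρ : ℕ → ℕ} {a : α} {μ ν : Mem} {r : ℕ}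
    (h : Γ.Holds ρ a μ) (hρ : ∀ i < Γ.k, ρ i < r) (hf : Frame r μ ν) : Γ.Holds ρ a ν :=
  ⟨fun x hx => (hf.data_eq hx).trans (h.1 x hx),
    fun i hi => (hf.reg_eq (hρ i hi)).trans (h.2 i hi)⟩

end Ctx

variable {α β : Type}

/-- The program `p` computes `F` into register `r`, using only registers with numbers `≥ r`, in
polynomially bounded time. -/
def Ctx.Computes (Γ : Ctx α) (ρ : ℕ → ℕ) (r : ℕ) (p : Prog) (F : α → ℤ) : Prop :=
  ∃ T : α → ℕ, Γ.PB T ∧ ∀ a μ, Γ.dom a → Γ.Holds ρ a μ →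
    ∃ ν t, Runs p μ ν t ∧ t ≤ T a ∧ ν (reg r) = F a ∧ Frame r μ ν

/-- `F` is computable in polynomially bounded time, with values of polynomially bounded length. -/
def Comp (Γ : Ctx α) (F : α → ℤ) : Prop :=
  (Γ.PB fun a => bits (F a)) ∧
    ∀ (ρ : ℕ → ℕ) (r : ℕ), (∀ i < Γ.k, ρ i < r) → ∃ p, Γ.Computes ρ r p F

namespace Comp

theorem congr {Γ : Ctx α} {F G : α → ℤ} (h : Comp Γ F) (hFG : ∀ a, Γ.dom a → F a = G a) :
    Comp Γ G := by
  refine ⟨h.1.mono fun a ha => by rw [hFG a ha], fun ρ r hr => ?_⟩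
  obtain ⟨p, T, hT, hp⟩ := h.2 ρ r hr
  refine ⟨p, T, hT, fun a μ ha hμ => ?_⟩
  rw [← hFG a ha]
  exact hp a μ ha hμ

/-- A computation may be moved to a context with more variables. -/
theorem lift {Γ : Ctx α} {Δ : Ctx β} {F : α → ℤ} (h : Comp Γ F) (f : β → α)
    (hdom : ∀ b, Δ.dom b → Γ.dom (f b)) (hsize : ∀ b, Δ.dom b → Γ.size (f b) = Δ.size b)
    (hmem : ∀ b, Δ.dom b → Γ.mem (f b) = Δ.mem b) (hk : Γ.k ≤ Δ.k)
    (hvar : ∀ b, Δ.dom b → ∀ i < Γ.k, Γ.var i (f b) = Δ.var i b) :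
    Comp Δ fun b => F (f b) := by
  refine ⟨?_, fun ρ r hr => ?_⟩
  · obtain ⟨c, hc⟩ := h.1
    exact ⟨c, fun b hb => by rw [← hsize b hb]; exact hc _ (hdom b hb)⟩
  obtain ⟨p, T, ⟨c, hc⟩, hp⟩ := h.2 ρ r fun i hi => hr i (hi.trans_le hk)
  refine ⟨p, fun b => T (f b), ⟨c, fun b hb => by rw [← hsize b hb]; exact hc _ (hdom b hb)⟩,
    fun b μ hb hμ => hp (f b) μ (hdom b hb) ⟨fun x hx => ?_, fun i hi => ?_⟩⟩
  · rw [hμ.1 x hx, hmem b hb]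
  · rw [hμ.2 i (hi.trans_le hk), hvar b hb i hi]

theorem const {Γ : Ctx α} (z : ℤ) : Comp Γ fun _ => z := by
  refine ⟨.const _, fun ρ r hr => ⟨put r (.const z), _,
    .const (2 + 2 * bits (reg r) + (1 + bits z) + bits z), fun a μ ha hμ =>
    ⟨_, _, runs_put r (.const z) μ, le_rfl, ?_, (Frame.refl r μ).update le_rfl _⟩⟩⟩
  simp [Expn.eval]

theorem var {Γ : Ctx α} {i : ℕ} (hi : i < Γ.k) : Comp Γ (Γ.var i) := by
  refine ⟨Γ.var_bits i hi, fun ρ r hr => ⟨put r (get (ρ i)),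
    fun a => 2 + 2 * bits (reg r) + (2 + 2 * bits (reg (ρ i)) + bits (Γ.var i a)) +
      bits (Γ.var i a), ?_, fun a μ ha hμ =>
    ⟨_, _, runs_put r (get (ρ i)) μ, ?_, ?_, (Frame.refl r μ).update le_rfl _⟩⟩⟩
  · exact (((Ctx.PB.const _).add ((Ctx.PB.const _).add (Γ.var_bits i hi)))).add (Γ.var_bits i hi)
  · rw [get_cost, get_eval, hμ.2 i hi]
  · simp [hμ.2 i hi]

/-- Reading a data cell. -/
theorem read {Γ : Ctx α} {F : α → ℤ} (h : Comp Γ F) (hF : ∀ a, Γ.dom a → IsData (F a)) :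
    Comp Γ fun a => Γ.mem a (F a) := by
  obtain ⟨c, hc⟩ := Γ.mem_bits
  have hb : Γ.PB fun a => bits (Γ.mem a (F a)) := ⟨c, fun a ha => hc a ha _⟩
  refine ⟨hb, fun ρ r hr => ?_⟩
  obtain ⟨p, T, hT, hp⟩ := h.2 ρ r hr
  refine ⟨.seq p (put r (.load (get r))), fun a => T a + (2 + 2 * bits (reg r) +
    (2 + 2 * bits (reg r) + bits (F a) + (1 + bits (F a) + bits (Γ.mem a (F a)))) +
      bits (Γ.mem a (F a))), ?_, fun a μ ha hμ => ?_⟩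
  · exact hT.add (((Ctx.PB.const _).add (((Ctx.PB.const _).add h.1).add
      (((Ctx.PB.const _).add h.1).add hb))).add hb)
  obtain ⟨ν, t, hrun, ht, hv, hf⟩ := hp a μ ha hμ
  have hm : ν (F a) = Γ.mem a (F a) := by rw [hf.data_eq (hF a ha), hμ.1 _ (hF a ha)]
  refine ⟨_, _, .seq hrun (runs_put r _ ν), ?_, ?_, hf.update le_rfl _⟩
  · simp only [Expn.cost, Expn.eval, get_cost, get_eval, hv, hm]
    omega
  · simp [Expn.eval, hv, hm]

/-- The second operand is computed with scratch space from `r + 1` upward, so its frame condition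
keeps the first operand alive in register `r`. This is what the quantification over `ρ` and `r` in
`Comp` is for. -/
theorem op {Γ : Ctx α} {F G : α → ℤ} (o : ArithOp) (hF : Comp Γ F) (hG : Comp Γ G)
    (hb : Γ.PB fun a => bits (o.apply (F a) (G a))) : Comp Γ fun a => o.apply (F a) (G a) := by
  refine ⟨hb, fun ρ r hr => ?_⟩
  obtain ⟨p, T, hT, hp⟩ := hF.2 ρ r hr
  obtain ⟨q, U, hU, hq⟩ := hG.2 ρ (r + 1) fun i hi => (hr i hi).trans (Nat.lt_succ_self r)
  refine ⟨.seq p (.seq q (put r (.op o (get r) (get (r + 1))))), fun a => T a + (U a +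
    (2 + 2 * bits (reg r) + ((2 + 2 * bits (reg r) + bits (F a)) +
      (2 + 2 * bits (reg (r + 1)) + bits (G a)) + (1 + bits (F a)) * (1 + bits (G a))) +
      bits (o.apply (F a) (G a)))), ?_, fun a μ ha hμ => ?_⟩
  · exact hT.add (hU.add (((Ctx.PB.const _).add ((((Ctx.PB.const _).add hF.1).add
      ((Ctx.PB.const _).add hG.1)).add (((Ctx.PB.const _).add hF.1).mul
      ((Ctx.PB.const _).add hG.1)))).add hb))
  obtain ⟨ν, t, hrun, ht, hv, hf⟩ := hp a μ ha hμ
  obtain ⟨ξ, u, hrun', hu, hw, hf'⟩ := hq a ν ha (hμ.of_frame hr hf)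
  have hv' : ξ (reg r) = F a := by rw [hf'.reg_eq (Nat.lt_succ_self r), hv]
  refine ⟨_, _, .seq hrun (.seq hrun' (runs_put r _ ξ)), ?_, ?_,
    (hf.trans (hf'.mono (Nat.le_succ r))).update le_rfl _⟩
  · simp only [Expn.cost, Expn.eval, get_cost, get_eval, hv', hw]
    omega
  · simp [Expn.eval, hv', hw]

theorem add {Γ : Ctx α} {F G : α → ℤ} (hF : Comp Γ F) (hG : Comp Γ G) :
    Comp Γ fun a => F a + G a :=
  op .add hF hG (((hF.1.max hG.1).add (.const 1)).mono fun _ _ => bits_add_le _ _)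

theorem sub {Γ : Ctx α} {F G : α → ℤ} (hF : Comp Γ F) (hG : Comp Γ G) :
    Comp Γ fun a => F a - G a :=
  op .sub hF hG (((hF.1.max hG.1).add (.const 1)).mono fun _ _ => bits_sub_le _ _)

theorem mul {Γ : Ctx α} {F G : α → ℤ} (hF : Comp Γ F) (hG : Comp Γ G) :
    Comp Γ fun a => F a * G a :=
  op .mul hF hG ((hF.1.add hG.1).mono fun _ _ => bits_mul_le _ _)

theorem quo {Γ : Ctx α} {F G : α → ℤ} (hF : Comp Γ F) (hG : Comp Γ G) :
    Comp Γ fun a => F a / G a :=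
  op .quo hF hG (hF.1.mono fun _ _ => bits_ediv_le _ _)

theorem mod {Γ : Ctx α} {F G : α → ℤ} (hF : Comp Γ F) (hG : Comp Γ G) :
    Comp Γ fun a => F a % G a :=
  (hF.sub (hG.mul (hF.quo hG))).congr fun _ _ => (Int.emod_def _ _).symm

theorem neg {Γ : Ctx α} {F : α → ℤ} (hF : Comp Γ F) : Comp Γ fun a => -F a :=
  ((const 0).sub hF).congr fun _ _ => by ring

end Comp

/-- The context in which moreover `P` is known. -/
def Ctx.restrict (Γ : Ctx α) (P : α → Prop) : Ctx α where
  dom a := Γ.dom a ∧ P a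
  size := Γ.size
  mem := Γ.mem
  k := Γ.k
  var := Γ.var
  two_le a h := Γ.two_le a h.1
  mem_bits := let ⟨c, hc⟩ := Γ.mem_bits; ⟨c, fun a h => hc a h.1⟩
  var_bits i hi := let ⟨c, hc⟩ := Γ.var_bits i hi; ⟨c, fun a h => hc a h.1⟩

theorem Comp.restrict {Γ : Ctx α} {F : α → ℤ} (h : Comp Γ F) (P : α → Prop) :
    Comp (Γ.restrict P) F :=
  h.lift id (fun _ h => h.1) (fun _ _ => rfl) (fun _ _ => rfl) le_rfl fun _ _ _ _ => rfl

/-- Each branch needs to be computable, and to obey its bounds, only where its condition holds. The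
bounds are replaced by explicit powers of the size before they are added, because the time function
of a branch is uncontrolled elsewhere. -/
theorem Comp.ite {Γ : Ctx α} {C F G : α → ℤ} {P : α → Prop} [DecidablePred P] (hC : Comp Γ C)
    (hP : ∀ a, Γ.dom a → (P a ↔ 0 < C a)) (hF : Comp (Γ.restrict P) F)
    (hG : Comp (Γ.restrict fun a => ¬ P a) G) : Comp Γ fun a => if P a then F a else G a := by
  obtain ⟨c, hc⟩ := hF.1
  obtain ⟨e, he⟩ := hG.1
  refine ⟨?_, fun ρ r hr => ?_⟩
  · have h1 : Γ.PB fun a => Γ.size a ^ c + Γ.size a ^ e := (Ctx.PB.size.pow c).add (Ctx.PB.size.pow e)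
    refine h1.mono fun a ha => ?_
    by_cases h : P a
    · simp only [h, if_true]
      exact (hc a ⟨ha, h⟩).trans (Nat.le_add_right _ _)
    · simp only [h, if_false]
      exact (he a ⟨ha, h⟩).trans (Nat.le_add_left _ _)
  obtain ⟨p, T, hT, hp⟩ := hC.2 ρ r hr
  obtain ⟨p₁, T₁, ⟨c₁, hT₁⟩, hp₁⟩ := hF.2 ρ r hr
  obtain ⟨p₂, T₂, ⟨c₂, hT₂⟩, hp₂⟩ := hG.2 ρ r hr
  refine ⟨.seq p (.cond (get r) p₁ p₂), fun a => T a + ((2 + 2 * bits (reg r) + bits (C a)) + 1 +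
    (Γ.size a ^ c₁ + Γ.size a ^ c₂)), hT.add (((((Ctx.PB.const _).add hC.1)).add (.const 1)).add
    ((Ctx.PB.size.pow c₁).add (Ctx.PB.size.pow c₂))), fun a μ ha hμ => ?_⟩
  obtain ⟨ν, t, hrun, ht, hv, hf⟩ := hp a μ ha hμ
  by_cases h : P a
  · obtain ⟨ξ, u, hrun', hu, hw, hf'⟩ := hp₁ a ν ⟨ha, h⟩ (hμ.of_frame hr hf)
    have := hT₁ a ⟨ha, h⟩
    change T₁ a ≤ Γ.size a ^ c₁ at this
    refine ⟨ξ, _, .seq hrun (.cond_pos (c := get r) ?_ hrun'), ?_, ?_, hf.trans hf'⟩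
    · simpa [hv] using (hP a ha).1 h
    · rw [get_cost, hv]; beta_reduce; omega
    · simp [h, hw]
  · obtain ⟨ξ, u, hrun', hu, hw, hf'⟩ := hp₂ a ν ⟨ha, h⟩ (hμ.of_frame hr hf)
    have := hT₂ a ⟨ha, h⟩
    change T₂ a ≤ Γ.size a ^ c₂ at this
    refine ⟨ξ, _, .seq hrun (.cond_neg (c := get r) ?_ hrun'), ?_, ?_, hf.trans hf'⟩
    · simpa [hv] using (hP a ha).not.1 h
    · rw [get_cost, hv]; beta_reduce; omega
    · simp [h, hw]

end RAM

/-! ### Bounded loops: iterated sums, products, powers and bit lengths -/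

namespace RAM

variable {α β : Type}

/-- Induction on the number `j` of remaining rounds. A round pays for the guard, one step and the
body, at most `2 * B + 1`; the extra unit in `N + 1` is the failing test at the end. -/
theorem runs_loop {c : Expn} {p : Prog} (I : ℕ → Mem → Prop) (N B : ℕ)
    (hpos : ∀ i < N, ∀ μ, I i μ → 0 < c.eval μ ∧ c.cost μ ≤ B ∧
      ∃ ν t, Runs p μ ν t ∧ t ≤ B ∧ I (i + 1) ν)
    (hend : ∀ μ, I N μ → ¬ 0 < c.eval μ ∧ c.cost μ ≤ B) {μ : Mem} (hμ : I 0 μ) :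
    ∃ ν t, Runs (.loop c p) μ ν t ∧ t ≤ (2 * B + 1) * (N + 1) ∧ I N ν := by
  suffices h : ∀ j i, i + j = N → ∀ μ, I i μ →
      ∃ ν t, Runs (.loop c p) μ ν t ∧ t ≤ (2 * B + 1) * (j + 1) ∧ I N ν from
    h N 0 (zero_add N) μ hμ
  intro j
  induction j with
  | zero =>
    rintro i rfl μ hμ
    obtain ⟨h1, h2⟩ := hend μ hμ
    exact ⟨μ, _, .loop_neg h1, by omega, hμ⟩
  | succ j ih =>
    intro i hi μ hμ
    obtain ⟨h1, h2, ν, t, hrun, ht, hν⟩ := hpos i (by omega) μ hμ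
    obtain ⟨ξ, s, hrun', hs, hξ⟩ := ih (i + 1) (by omega) ν hν
    refine ⟨ξ, _, .loop_pos h1 hrun hrun', ?_, hξ⟩
    rw [mul_add] at hs ⊢
    rw [mul_add, mul_one]
    omega

/-- The context with an additional natural number `i < N` in the last variable. -/
def Ctx.push (Γ : Ctx α) (N : α → ℕ) (hN : Γ.PB N) : Ctx (α × ℕ) where
  dom p := Γ.dom p.1 ∧ p.2 < N p.1
  size p := Γ.size p.1
  mem p := Γ.mem p.1
  k := Γ.k + 1
  var j p := if j < Γ.k then Γ.var j p.1 else p.2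
  two_le p h := Γ.two_le p.1 h.1
  mem_bits := let ⟨c, hc⟩ := Γ.mem_bits; ⟨c, fun p h => hc p.1 h.1⟩
  var_bits j _ := by
    by_cases h : j < Γ.k
    · obtain ⟨c, hc⟩ := Γ.var_bits j h
      exact ⟨c, fun p hp => by simpa only [h, if_true] using hc p.1 hp.1⟩
    · obtain ⟨c, hc⟩ := hN
      exact ⟨c, fun p hp => by
        simpa only [h, if_false] using (bits_natCast_le p.2).trans (hp.2.le.trans (hc p.1 hp.1))⟩

/-- The context with an additional natural number `i < N` and the `i`-th members of two sequences in
the last three variables. -/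
def Ctx.loop (Γ : Ctx α) (N : α → ℕ) (hN : Γ.PB N) (x y : α → ℕ → ℤ)
    (hx : ∃ c, ∀ a, Γ.dom a → ∀ i ≤ N a, bits (x a i) ≤ Γ.size a ^ c)
    (hy : ∃ c, ∀ a, Γ.dom a → ∀ i ≤ N a, bits (y a i) ≤ Γ.size a ^ c) : Ctx (α × ℕ) where
  dom p := Γ.dom p.1 ∧ p.2 < N p.1
  size p := Γ.size p.1
  mem p := Γ.mem p.1
  k := Γ.k + 3
  var j p := if j < Γ.k then Γ.var j p.1 else if j = Γ.k then p.2 else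
    if j = Γ.k + 1 then x p.1 p.2 else y p.1 p.2
  two_le p h := Γ.two_le p.1 h.1
  mem_bits := let ⟨c, hc⟩ := Γ.mem_bits; ⟨c, fun p h => hc p.1 h.1⟩
  var_bits j _ := by
    by_cases h : j < Γ.k
    · obtain ⟨c, hc⟩ := Γ.var_bits j h
      exact ⟨c, fun p hp => by simpa only [h, if_true] using hc p.1 hp.1⟩
    by_cases h0 : j = Γ.k
    · obtain ⟨c, hc⟩ := hN
      exact ⟨c, fun p hp => by
        simpa only [h, h0, lt_irrefl, if_false, if_true] using
          (bits_natCast_le p.2).trans (hp.2.le.trans (hc p.1 hp.1))⟩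
    by_cases h1 : j = Γ.k + 1
    · obtain ⟨c, hc⟩ := hx
      subst h1
      exact ⟨c, fun p hp => by simpa using hc p.1 hp.1 p.2 hp.2.le⟩
    · obtain ⟨c, hc⟩ := hy
      exact ⟨c, fun p hp => by
        simpa only [h, h0, h1, if_false, if_true] using hc p.1 hp.1 p.2 hp.2.le⟩

namespace Comp

theorem push {Γ : Ctx α} {F : α → ℤ} (h : Comp Γ F) (N : α → ℕ) (hN : Γ.PB N) :
    Comp (Γ.push N hN) fun p => F p.1 :=
  h.lift Prod.fst (fun _ h => h.1) (fun _ _ => rfl) (fun _ _ => rfl) (Nat.le_succ _)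
    fun _ _ i hi => by simp [Ctx.push, hi]

/-- The variable that is introduced by `Ctx.push`. -/
theorem last {Γ : Ctx α} {N : α → ℕ} {hN : Γ.PB N} :
    Comp (Γ.push N hN) fun p => (p.2 : ℤ) :=
  (var (Γ := Γ.push N hN) (i := Γ.k) (Nat.lt_succ_self _)).congr fun _ _ => by simp [Ctx.push]

section

variable {Γ : Ctx α} {N : α → ℕ} {hN : Γ.PB N} {x y : α → ℕ → ℤ}
  {hx : ∃ c, ∀ a, Γ.dom a → ∀ i ≤ N a, bits (x a i) ≤ Γ.size a ^ c}
  {hy : ∃ c, ∀ a, Γ.dom a → ∀ i ≤ N a, bits (y a i) ≤ Γ.size a ^ c}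

theorem loop {F : α × ℕ → ℤ} (h : Comp (Γ.push N hN) F) :
    Comp (Γ.loop N hN x y hx hy) F :=
  h.lift id (fun _ h => h) (fun _ _ => rfl) (fun _ _ => rfl) (by simp [Ctx.push, Ctx.loop])
    fun _ _ i hi => by
      simp only [Ctx.push] at hi
      by_cases h : i < Γ.k
      · simp [Ctx.push, Ctx.loop, h]
      · have : i = Γ.k := by omega
        simp [Ctx.push, Ctx.loop, this]

theorem loop_fst : Comp (Γ.loop N hN x y hx hy) fun p => x p.1 p.2 :=
  (var (Γ := Γ.loop N hN x y hx hy) (i := Γ.k + 1) (by simp [Ctx.loop])).congr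
    fun _ _ => by simp [Ctx.loop]

theorem loop_snd : Comp (Γ.loop N hN x y hx hy) fun p => y p.1 p.2 :=
  (var (Γ := Γ.loop N hN x y hx hy) (i := Γ.k + 2) (by simp [Ctx.loop])).congr
    fun _ _ => by simp [Ctx.loop]

/-- Registers `r` to `r + 3` hold the counter, the two accumulators and the bound `N`. Both new
values are computed into `r + 4` and `r + 5` before either old one is overwritten, so the update is
simultaneous; complex multiplication as a loop body depends on this. -/
theorem exists_loop_prog (hcN : Comp Γ fun a => (N a : ℤ))
    (hx0 : Comp Γ fun a => x a 0) (hy0 : Comp Γ fun a => y a 0)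
    (hxs : Comp (Γ.loop N hN x y hx hy) fun p => x p.1 (p.2 + 1))
    (hys : Comp (Γ.loop N hN x y hx hy) fun p => y p.1 (p.2 + 1))
    (ρ : ℕ → ℕ) (r : ℕ) (hr : ∀ i < Γ.k, ρ i < r) :
    ∃ (p : Prog) (T : α → ℕ), Γ.PB T ∧ ∀ a μ, Γ.dom a → Γ.Holds ρ a μ →
      ∃ ν t, Runs p μ ν t ∧ t ≤ T a ∧ ν (reg (r + 1)) = x a (N a) ∧
        ν (reg (r + 2)) = y a (N a) ∧ Frame r μ ν := by
  obtain ⟨px, Tx, hTx, hpx⟩ := hx0.2 ρ (r + 1) fun i hi => by have := hr i hi; omega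
  obtain ⟨py, Ty, hTy, hpy⟩ := hy0.2 ρ (r + 2) fun i hi => by have := hr i hi; omega
  obtain ⟨pN, TN, hTN, hpN⟩ := hcN.2 ρ (r + 3) fun i hi => by have := hr i hi; omega
  -- Old variables keep their registers; the three new variables `Γ.k`, `Γ.k + 1`, `Γ.k + 2` of the
  -- loop context sit in `r`, `r + 1`, `r + 2`.
  set ρ' : ℕ → ℕ := fun j => if j < Γ.k then ρ j else r + (j - Γ.k) with hρ'
  have hr4 : ∀ i < Γ.k + 3, ρ' i < r + 4 := fun i hi => by
    by_cases h : i < Γ.k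
    · have := hr i h; simp only [hρ', h, if_true]; omega
    · simp only [hρ', h, if_false]; omega
  obtain ⟨qx, Ux, ⟨cx, hUx⟩, hqx⟩ := hxs.2 ρ' (r + 4) hr4
  obtain ⟨qy, Uy, ⟨cy, hUy⟩, hqy⟩ := hys.2 ρ' (r + 5) fun i hi => by have := hr4 i hi; omega
  obtain ⟨bx, hbx⟩ := hx
  obtain ⟨by_, hby⟩ := hy
  let body : Prog := .seq qx (.seq qy (.seq (put (r + 1) (get (r + 4)))
    (.seq (put (r + 2) (get (r + 5))) (put r (.op .add (get r) (.const 1))))))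
  let c : Expn := .op .sub (get (r + 3)) (get r)
  let Bc : α → ℕ := fun a => 2 + 2 * bits (reg (r + 3)) + N a + (2 + 2 * bits (reg r) + N a) +
    (1 + N a) * (1 + N a)
  let Bb : α → ℕ := fun a => Γ.size a ^ cx + (Γ.size a ^ cy +
    (2 + 2 * bits (reg (r + 1)) + (2 + 2 * bits (reg (r + 4)) + Γ.size a ^ bx) + Γ.size a ^ bx +
    (2 + 2 * bits (reg (r + 2)) + (2 + 2 * bits (reg (r + 5)) + Γ.size a ^ by_) + Γ.size a ^ by_ +
    (2 + 2 * bits (reg r) + (2 + 2 * bits (reg r) + N a + 2 + (1 + N a) * 2) + N a))))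
  have hBc : Γ.PB Bc := ((((Ctx.PB.const _).add hN).add ((Ctx.PB.const _).add hN))).add
    (((Ctx.PB.const _).add hN).mul ((Ctx.PB.const _).add hN))
  have hsz : ∀ n, Γ.PB fun a => Γ.size a ^ n := fun n => Ctx.PB.size.pow n
  have hBb : Γ.PB Bb := (hsz _).add ((hsz _).add ((((Ctx.PB.const _).add
    ((Ctx.PB.const _).add (hsz _))).add (hsz _)).add ((((Ctx.PB.const _).add
    ((Ctx.PB.const _).add (hsz _))).add (hsz _)).add (((Ctx.PB.const _).add
    ((((Ctx.PB.const _).add hN).add (.const _)).add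
      (((Ctx.PB.const _).add hN).mul (.const _)))).add hN))))
  refine ⟨.seq px (.seq py (.seq pN (.seq (put r (.const 0)) (.loop c body)))), fun a => Tx a +
    (Ty a + (TN a + ((2 + 2 * bits (reg r) + 1) + (2 * (Bc a + Bb a) + 1) * (N a + 1)))),
    hTx.add (hTy.add (hTN.add ((Ctx.PB.const _).add
      ((((Ctx.PB.const _).mul (hBc.add hBb)).add (.const _)).mul (hN.add (.const _)))))),
    fun a μ ha hμ => ?_⟩
  have hr' : ∀ s, r ≤ s → ∀ i < Γ.k, ρ i < s := fun s hs i hi => (hr i hi).trans_le hs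
  obtain ⟨μ₁, t₁, run₁, ht₁, v₁, f₁⟩ := hpx a μ ha hμ
  obtain ⟨μ₂, t₂, run₂, ht₂, v₂, f₂⟩ := hpy a μ₁ ha (hμ.of_frame (hr' _ (by omega)) f₁)
  obtain ⟨μ₃, t₃, run₃, ht₃, v₃, f₃⟩ := hpN a μ₂ ha
    ((hμ.of_frame (hr' _ (by omega)) f₁).of_frame (hr' _ (by omega)) f₂)
  have run₄ := runs_put r (.const 0) μ₃
  set μ₄ := Function.update μ₃ (reg r) ((Expn.const 0).eval μ₃) with hμ₄
  have f₄ : Frame r μ μ₄ := ((f₁.mono (by omega)).trans ((f₂.mono (by omega)).trans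
    (f₃.mono (by omega)))).update le_rfl _
  let I : ℕ → Mem → Prop := fun i ν => Frame r μ ν ∧ ν (reg r) = i ∧ ν (reg (r + 1)) = x a i ∧
    ν (reg (r + 2)) = y a i ∧ ν (reg (r + 3)) = N a
  have hsize : ∀ i ≤ N a, bits (i : ℤ) ≤ N a := fun i hi => (bits_natCast_le i).trans hi
  have hc : ∀ i ≤ N a, ∀ ν, I i ν → c.eval ν = N a - i ∧ c.cost ν ≤ Bc a := by
    rintro i hi ν ⟨-, h0, -, -, h3⟩
    refine ⟨by simp [c, Expn.eval, ArithOp.apply, h0, h3], ?_⟩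
    simp only [c, Expn.cost, get_cost, get_eval, h0, h3, Bc]
    have h1 := hsize i hi
    have h2 := hsize (N a) le_rfl
    gcongr
  have hpos : ∀ i < N a, ∀ ν, I i ν → 0 < c.eval ν ∧ c.cost ν ≤ Bc a + Bb a ∧
      ∃ ξ t, Runs body ν ξ t ∧ t ≤ Bc a + Bb a ∧ I (i + 1) ξ := by
    intro i hi ν hν
    obtain ⟨h1, h2⟩ := hc i hi.le ν hν
    refine ⟨by rw [h1]; omega, by omega, ?_⟩
    obtain ⟨g, h0, hx1, hy1, h3⟩ := hν
    have hL : (Γ.loop N hN x y ⟨bx, hbx⟩ ⟨by_, hby⟩).Holds ρ' (a, i) ν := by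
      have := hμ.of_frame hr g
      refine ⟨this.1, fun j hj => ?_⟩
      simp only [Ctx.loop] at hj ⊢
      by_cases hj0 : j < Γ.k
      · simpa only [hρ', hj0, if_true] using this.2 j hj0
      obtain rfl | rfl | rfl : j = Γ.k ∨ j = Γ.k + 1 ∨ j = Γ.k + 2 := by omega
      · simpa [hρ'] using h0
      · simpa [hρ'] using hx1
      · simpa [hρ'] using hy1
    obtain ⟨ν₁, s₁, r₁, hs₁, w₁, g₁⟩ := hqx (a, i) ν ⟨ha, hi⟩ hL
    obtain ⟨ν₂, s₂, r₂, hs₂, w₂, g₂⟩ := hqy (a, i) ν₁ ⟨ha, hi⟩ (hL.of_frame hr4 g₁)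
    have hb1 := hUx (a, i) ⟨ha, hi⟩
    have hb2 := hUy (a, i) ⟨ha, hi⟩
    have hb3 := hbx a ha (i + 1) hi
    have hb4 := hby a ha (i + 1) hi
    have hb5 := hsize i hi.le
    have hb6 := hsize (i + 1) hi
    have e4 : ν₂ (reg (r + 4)) = x a (i + 1) := by rw [g₂.reg_eq (by omega), w₁]
    have e0 : ν₂ (reg r) = i := by rw [g₂.reg_eq (by omega), g₁.reg_eq (by omega), h0]
    have e3 : ν₂ (reg (r + 3)) = N a := by rw [g₂.reg_eq (by omega), g₁.reg_eq (by omega), h3]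
    have b1 : bits 1 = 1 := rfl
    have b2 : (1 + bits (i : ℤ)) * (1 + 1) ≤ (1 + N a) * 2 := by gcongr
    refine ⟨_, _, .seq r₁ (.seq r₂ (.seq (runs_put _ _ _) (.seq (runs_put _ _ _)
      (runs_put _ _ _)))), ?_, ?_, ?_, ?_, ?_, ?_⟩
    · simp only [Ctx.loop] at hb1 hb2
      simp [Expn.cost, Expn.eval, get_cost, e4, e0, w₂, ArithOp.apply, b1, -bits_natCast]
      push_cast at hb6
      simp only [Bb]
      omega
    · exact ((((g.trans ((g₁.mono (by omega)).trans (g₂.mono (by omega)))).update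
        (by omega) _).update (by omega) _).update le_rfl _)
    · simp [Expn.eval, ArithOp.apply, e0]
    · simp [Expn.eval, e4]
    · simp [Expn.eval, w₂]
    · simp [e3]
  have hend : ∀ ν, I (N a) ν → ¬ 0 < c.eval ν ∧ c.cost ν ≤ Bc a + Bb a := by
    intro ν hν
    obtain ⟨h1, h2⟩ := hc (N a) le_rfl ν hν
    exact ⟨by rw [h1]; omega, by omega⟩
  obtain ⟨ν, t, run₅, ht₅, hν⟩ := runs_loop (c := c) (p := body) I (N a) (Bc a + Bb a)
    hpos hend (μ := μ₄)
    ⟨f₄, by simp [μ₄, Expn.eval], by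
      rw [hμ₄, Function.update_of_ne (by simp), f₃.reg_eq (by omega), f₂.reg_eq (by omega), v₁],
      by rw [hμ₄, Function.update_of_ne (by simp), f₃.reg_eq (by omega), v₂],
      by rw [hμ₄, Function.update_of_ne (by simp), v₃]⟩
  refine ⟨ν, _, .seq run₁ (.seq run₂ (.seq run₃ (.seq run₄ run₅))), ?_, hν.2.2.1, hν.2.2.2.1,
    hν.1⟩
  simp only [Expn.cost, Expn.eval, bits_zero]
  omega

theorem fold_fst (hcN : Comp Γ fun a => (N a : ℤ))
    (hx0 : Comp Γ fun a => x a 0) (hy0 : Comp Γ fun a => y a 0)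
    (hxs : Comp (Γ.loop N hN x y hx hy) fun p => x p.1 (p.2 + 1))
    (hys : Comp (Γ.loop N hN x y hx hy) fun p => y p.1 (p.2 + 1)) :
    Comp Γ fun a => x a (N a) := by
  obtain ⟨c, hc⟩ := id hx
  have hb : Γ.PB fun a => bits (x a (N a)) := ⟨c, fun a ha => hc a ha _ le_rfl⟩
  refine ⟨hb, fun ρ r hr => ?_⟩
  obtain ⟨p, T, hT, hp⟩ := exists_loop_prog hcN hx0 hy0 hxs hys ρ r hr
  refine ⟨.seq p (put r (get (r + 1))), fun a => T a + (2 + 2 * bits (reg r) + (2 + 2 *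
    bits (reg (r + 1)) + bits (x a (N a))) + bits (x a (N a))), hT.add (((Ctx.PB.const _).add
    ((Ctx.PB.const _).add hb)).add hb), fun a μ ha hμ => ?_⟩
  obtain ⟨ν, t, hrun, ht, h1, -, hf⟩ := hp a μ ha hμ
  refine ⟨_, _, .seq hrun (runs_put _ _ _), ?_, ?_, hf.update le_rfl _⟩
  · rw [get_cost, get_eval, h1]; beta_reduce; omega
  · simp [h1]

theorem fold_snd (hcN : Comp Γ fun a => (N a : ℤ))
    (hx0 : Comp Γ fun a => x a 0) (hy0 : Comp Γ fun a => y a 0)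
    (hxs : Comp (Γ.loop N hN x y hx hy) fun p => x p.1 (p.2 + 1))
    (hys : Comp (Γ.loop N hN x y hx hy) fun p => y p.1 (p.2 + 1)) :
    Comp Γ fun a => y a (N a) := by
  obtain ⟨c, hc⟩ := id hy
  have hb : Γ.PB fun a => bits (y a (N a)) := ⟨c, fun a ha => hc a ha _ le_rfl⟩
  refine ⟨hb, fun ρ r hr => ?_⟩
  obtain ⟨p, T, hT, hp⟩ := exists_loop_prog hcN hx0 hy0 hxs hys ρ r hr
  refine ⟨.seq p (put r (get (r + 2))), fun a => T a + (2 + 2 * bits (reg r) + (2 + 2 *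
    bits (reg (r + 2)) + bits (y a (N a))) + bits (y a (N a))), hT.add (((Ctx.PB.const _).add
    ((Ctx.PB.const _).add hb)).add hb), fun a μ ha hμ => ?_⟩
  obtain ⟨ν, t, hrun, ht, -, h1, hf⟩ := hp a μ ha hμ
  refine ⟨_, _, .seq hrun (runs_put _ _ _), ?_, ?_, hf.update le_rfl _⟩
  · rw [get_cost, get_eval, h1]; beta_reduce; omega
  · simp [h1]

end

/-- Iterations with one accumulator. -/
theorem fold {Γ : Ctx α} {N : α → ℕ} (hN : Γ.PB N) {x : α → ℕ → ℤ}
    (hx : ∃ c, ∀ a, Γ.dom a → ∀ i ≤ N a, bits (x a i) ≤ Γ.size a ^ c)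
    (hcN : Comp Γ fun a => (N a : ℤ)) (hx0 : Comp Γ fun a => x a 0)
    (hxs : Comp (Γ.loop N hN x (fun _ _ => 0) hx ⟨0, by simp⟩) fun p => x p.1 (p.2 + 1)) :
    Comp Γ fun a => x a (N a) :=
  fold_fst (y := fun _ _ => 0) hcN hx0 (const 0) hxs (const 0)

theorem sum {Γ : Ctx α} {N : α → ℕ} (hN : Γ.PB N) (hcN : Comp Γ fun a => (N a : ℤ))
    {G : α → ℕ → ℤ} (hG : Comp (Γ.push N hN) fun p => G p.1 p.2) :
    Comp Γ fun a => ∑ i ∈ Finset.range (N a), G a i := by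
  obtain ⟨c, hc⟩ := id hG.1
  have hb : ∃ c, ∀ a, Γ.dom a → ∀ i ≤ N a,
      bits (∑ j ∈ Finset.range i, G a j) ≤ Γ.size a ^ c := by
    obtain ⟨e, he⟩ := hN.add (Ctx.PB.size.pow c)
    refine ⟨e, fun a ha i hi => (bits_sum_le _ _ (Γ.size a ^ c) fun j hj =>
      hc (a, j) ⟨ha, (Finset.mem_range.1 hj).trans_le hi⟩).trans ?_⟩
    rw [Finset.card_range]
    exact (Nat.add_le_add_right hi _).trans (he a ha)
  exact fold hN (x := fun a i => ∑ j ∈ Finset.range i, G a j) hb hcN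
    ((const 0).congr fun _ _ => by simp)
    ((loop_fst.add hG.loop).congr fun p _ => (Finset.sum_range_succ _ _).symm)

theorem prod {Γ : Ctx α} {N : α → ℕ} (hN : Γ.PB N) (hcN : Comp Γ fun a => (N a : ℤ))
    {G : α → ℕ → ℤ} (hG : Comp (Γ.push N hN) fun p => G p.1 p.2) :
    Comp Γ fun a => ∏ i ∈ Finset.range (N a), G a i := by
  obtain ⟨c, hc⟩ := id hG.1
  have hb : ∃ c, ∀ a, Γ.dom a → ∀ i ≤ N a,
      bits (∏ j ∈ Finset.range i, G a j) ≤ Γ.size a ^ c := by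
    obtain ⟨e, he⟩ := (hN.mul (Ctx.PB.size.pow c)).add (.const 1)
    refine ⟨e, fun a ha i hi => (bits_prod_le _ _ (Γ.size a ^ c) fun j hj =>
      hc (a, j) ⟨ha, (Finset.mem_range.1 hj).trans_le hi⟩).trans ?_⟩
    rw [Finset.card_range]
    exact (Nat.add_le_add_right (Nat.mul_le_mul_right _ hi) _).trans (he a ha)
  exact fold hN (x := fun a i => ∏ j ∈ Finset.range i, G a j) hb hcN
    ((const 1).congr fun _ _ => by simp)
    ((loop_fst.mul hG.loop).congr fun p _ => (Finset.prod_range_succ _ _).symm)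

theorem pow {Γ : Ctx α} {F : α → ℤ} {N : α → ℕ} (hF : Comp Γ F) (hN : Γ.PB N)
    (hcN : Comp Γ fun a => (N a : ℤ)) : Comp Γ fun a => F a ^ N a :=
  (prod hN hcN (G := fun a _ => F a) (hF.push N hN)).congr fun _ _ => by simp

/-- The bit length of a number. -/
theorem size {Γ : Ctx α} {F : α → ℕ} (hF : Comp Γ fun a => (F a : ℤ)) :
    Comp Γ fun a => (Nat.size (F a) : ℤ) := by
  have hb := hF.1
  simp only [bits_natCast] at hb
  refine ⟨hb.mono fun a _ => bits_natCast_le _, fun ρ r hr => ?_⟩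
  obtain ⟨p, T, hT, hp⟩ := hF.2 ρ (r + 1) fun i hi => (hr i hi).trans (Nat.lt_succ_self r)
  -- Halve until zero is reached and count the rounds: `F / 2 ^ i` is positive exactly for `i <
  -- Nat.size F`.
  let body : Prog := .seq (put (r + 1) (.op .quo (get (r + 1)) (.const 2)))
    (put r (.op .add (get r) (.const 1)))
  let B : α → ℕ := fun a => 2 + 2 * bits (reg (r + 1)) + ((2 + 2 * bits (reg (r + 1)) +
    Nat.size (F a)) + 3 + (1 + Nat.size (F a)) * 3) + Nat.size (F a) +
    (2 + 2 * bits (reg r) + ((2 + 2 * bits (reg r) + Nat.size (F a)) + 2 +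
      (1 + Nat.size (F a)) * 2) + (Nat.size (F a)))
  have hB : Γ.PB B := (((Ctx.PB.const _).add ((((Ctx.PB.const _).add hb).add (.const _)).add
    (((Ctx.PB.const _).add hb).mul (.const _)))).add hb).add (((Ctx.PB.const _).add
    ((((Ctx.PB.const _).add hb).add (.const _)).add
    (((Ctx.PB.const _).add hb).mul (.const _)))).add hb)
  refine ⟨.seq p (.seq (put r (.const 0)) (.loop (get (r + 1)) body)), fun a => T a +
    ((2 + 2 * bits (reg r) + 1) + (2 * B a + 1) * (Nat.size (F a) + 1)),
    hT.add ((Ctx.PB.const _).add ((((Ctx.PB.const _).mul hB).add (.const _)).mul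
      (hb.add (.const _)))), fun a μ ha hμ => ?_⟩
  obtain ⟨ν, t, hrun, ht, hv, hf⟩ := hp a μ ha hμ
  let I : ℕ → Mem → Prop := fun i ξ => Frame r μ ξ ∧ ξ (reg r) = i ∧
    ξ (reg (r + 1)) = (F a / 2 ^ i : ℕ)
  have hdiv : ∀ i, Nat.size (F a / 2 ^ i) ≤ Nat.size (F a) := fun i =>
    Nat.size_le_size (Nat.div_le_self _ _)
  have hcost : ∀ i ξ, I i ξ → (get (r + 1)).cost ξ ≤ B a := by
    rintro i ξ ⟨-, -, h⟩
    have := hdiv i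
    rw [get_cost, h, bits_natCast]
    simp only [B]
    omega
  have hpos : ∀ i < Nat.size (F a), ∀ ξ, I i ξ → 0 < (get (r + 1)).eval ξ ∧
      (get (r + 1)).cost ξ ≤ B a ∧ ∃ o t, Runs body ξ o t ∧ t ≤ B a ∧ I (i + 1) o := by
    intro i hi ξ hξ
    refine ⟨?_, hcost i ξ hξ, ?_⟩
    · rw [get_eval, hξ.2.2]
      exact_mod_cast Nat.div_pos (Nat.lt_size.1 hi) (by positivity)
    obtain ⟨h1, h2, h3⟩ := hξ
    refine ⟨_, _, .seq (runs_put _ _ _) (runs_put _ _ _), ?_,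
      (h1.update (Nat.le_succ r) _).update le_rfl _, ?_, ?_⟩
    · have b1 : bits 1 = 1 := rfl
      have b2 : bits 2 = 2 := rfl
      have d1 := hdiv i
      have d2 : bits ((F a / 2 ^ i : ℕ) / 2 : ℤ) ≤ Nat.size (F a) :=
        (bits_ediv_le _ _).trans d1
      have d3 : bits (i : ℤ) ≤ Nat.size (F a) := (bits_natCast_le i).trans hi.le
      have d4 : bits ((i : ℤ) + 1) ≤ Nat.size (F a) := by
        exact_mod_cast (bits_natCast_le (i + 1)).trans hi
      have m1 : (1 + Nat.size (F a / 2 ^ i)) * 3 ≤ (1 + Nat.size (F a)) * 3 := by gcongr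
      have m2 : (1 + bits (i : ℤ)) * 2 ≤ (1 + Nat.size (F a)) * 2 := by gcongr
      simp only [Expn.cost, Expn.eval, get_cost, get_eval, h2, h3, ArithOp.apply, b1, b2, B,
        Function.update_of_ne (reg_injective.ne (Nat.lt_succ_self r).ne)]
      rw [bits_natCast (F a / 2 ^ i)]
      omega
    · simp [Expn.eval, ArithOp.apply, h2]
    · simp only [Expn.eval, ArithOp.apply, get_eval, h3,
        Function.update_of_ne (reg_injective.ne (Nat.lt_succ_self r).ne'), Function.update_self]
      rw [pow_succ, ← Nat.div_div_eq_div_mul]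
      norm_cast
  have hend : ∀ ξ, I (Nat.size (F a)) ξ → ¬ 0 < (get (r + 1)).eval ξ ∧
      (get (r + 1)).cost ξ ≤ B a := by
    intro ξ hξ
    refine ⟨?_, hcost _ ξ hξ⟩
    rw [get_eval, hξ.2.2, Nat.div_eq_of_lt (Nat.lt_size_self _)]
    simp
  obtain ⟨ξ, s, hrun', hs, hξ⟩ := runs_loop (c := get (r + 1)) (p := body) I (Nat.size (F a)) (B a)
    hpos hend (μ := Function.update ν (reg r) 0)
    ⟨(hf.mono (Nat.le_succ r)).update le_rfl _, by simp, by simp [hv]⟩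
  refine ⟨ξ, _, .seq hrun (.seq (runs_put r (.const 0) ν) hrun'), ?_, hξ.2.1, hξ.1⟩
  simp only [Expn.cost, Expn.eval, bits_zero]
  omega

end Comp

end RAM

/-! ### Tables in the negative odd memory cells -/

namespace RAM

variable {α β : Type}

/-- The memory `m` in which the pairs `(u j, v j)` for `j < i` are written into the negative odd
cells. -/
def tabMem (m : Mem) (u v : ℕ → ℤ) (i : ℕ) : Mem := fun x =>
  if 0 ≤ x then m x
  else if x % 4 = 3 ∧ (-x - 1) / 4 < i then u ((-x - 1) / 4).toNat
  else if x % 4 = 1 ∧ (-x - 3) / 4 < i then v ((-x - 3) / 4).toNat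
  else m x

theorem tabMem_of_nonneg {m : Mem} {u v : ℕ → ℤ} {i : ℕ} {x : ℤ} (hx : 0 ≤ x) :
    tabMem m u v i x = m x := by simp [tabMem, hx]

theorem tabMem_zero (m : Mem) (u v : ℕ → ℤ) : tabMem m u v 0 = m := by
  funext x
  unfold tabMem
  split_ifs <;> first | rfl | (exfalso; simp only [Nat.cast_zero] at *; omega)

theorem tabMem_fst {m : Mem} {u v : ℕ → ℤ} {i j : ℕ} (h : j < i) :
    tabMem m u v i (-(4 * (j : ℤ) + 1)) = u j := by
  have h1 : ¬ (0 ≤ -(4 * (j : ℤ) + 1)) := by omega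
  have h2 : -(4 * (j : ℤ) + 1) % 4 = 3 := by omega
  have h3 : (- -(4 * (j : ℤ) + 1) - 1) / 4 = j := by omega
  simp only [tabMem, if_neg h1, h2, h3, true_and, Nat.cast_lt, if_pos h, Int.toNat_natCast]

theorem tabMem_snd {m : Mem} {u v : ℕ → ℤ} {i j : ℕ} (h : j < i) :
    tabMem m u v i (-(4 * (j : ℤ) + 3)) = v j := by
  have h1 : ¬ (0 ≤ -(4 * (j : ℤ) + 3)) := by omega
  have h2 : -(4 * (j : ℤ) + 3) % 4 = 1 := by omega
  have h3 : (- -(4 * (j : ℤ) + 3) - 3) / 4 = j := by omega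
  simp only [tabMem, if_neg h1, h2, h3, true_and, Nat.cast_lt, if_pos h, Int.toNat_natCast]
  norm_num

/-- The addresses `-(4 * i + 1)` and `-(4 * i + 3)` lie in different residue classes modulo 4, so
storing a pair disturbs no earlier entry. Being odd, they are never registers. -/
theorem tabMem_succ (m : Mem) (u v : ℕ → ℤ) (i : ℕ) :
    tabMem m u v (i + 1) = Function.update (Function.update (tabMem m u v i)
      (-(4 * (i : ℤ) + 1)) (u i)) (-(4 * (i : ℤ) + 3)) (v i) := by
  funext x
  by_cases h3 : x = -(4 * (i : ℤ) + 3)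
  · rw [h3, Function.update_self, tabMem_snd (Nat.lt_succ_self i)]
  rw [Function.update_of_ne h3]
  by_cases h1 : x = -(4 * (i : ℤ) + 1)
  · rw [h1, Function.update_self, tabMem_fst (Nat.lt_succ_self i)]
  rw [Function.update_of_ne h1]
  have e1 : (x % 4 = 3 ∧ (-x - 1) / 4 < ((i + 1 : ℕ) : ℤ)) ↔ (x % 4 = 3 ∧ (-x - 1) / 4 < (i : ℤ)) := by
    push_cast; omega
  have e2 : (x % 4 = 1 ∧ (-x - 3) / 4 < ((i + 1 : ℕ) : ℤ)) ↔ (x % 4 = 1 ∧ (-x - 3) / 4 < (i : ℤ)) := by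
    push_cast; omega
  simp only [tabMem, e1, e2]

theorem bits_tabMem_le {m : Mem} {u v : ℕ → ℤ} {i b : ℕ} (hm : ∀ x, bits (m x) ≤ b)
    (hu : ∀ j < i, bits (u j) ≤ b) (hv : ∀ j < i, bits (v j) ≤ b) (x : ℤ) :
    bits (tabMem m u v i x) ≤ b := by
  unfold tabMem
  split_ifs with h1 h2 h3
  · exact hm x
  · exact hu _ (by omega)
  · exact hv _ (by omega)
  · exact hm x

namespace Ctx

theorem exists_bits_tabMem_le (Γ : Ctx α) {N : α → ℕ} {u v : α → ℕ → ℤ}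
    (hu : ∃ c, ∀ a, Γ.dom a → ∀ i < N a, bits (u a i) ≤ Γ.size a ^ c)
    (hv : ∃ c, ∀ a, Γ.dom a → ∀ i < N a, bits (v a i) ≤ Γ.size a ^ c) :
    ∃ c, ∀ a, Γ.dom a → ∀ i ≤ N a, ∀ x,
      bits (tabMem (Γ.mem a) (u a) (v a) i x) ≤ Γ.size a ^ c := by
  obtain ⟨c₁, h₁⟩ := hu
  obtain ⟨c₂, h₂⟩ := hv
  obtain ⟨c₃, h₃⟩ := Γ.mem_bits
  have hp : ∀ a, Γ.dom a → ∀ c ≤ c₁ + c₂ + c₃, Γ.size a ^ c ≤ Γ.size a ^ (c₁ + c₂ + c₃) :=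
    fun a ha c hc => Nat.pow_le_pow_right (Γ.one_le ha) hc
  exact ⟨c₁ + c₂ + c₃, fun a ha i hi => bits_tabMem_le
    (fun x => (h₃ a ha x).trans (hp a ha _ (by omega)))
    (fun j hj => (h₁ a ha j (hj.trans_le hi)).trans (hp a ha _ (by omega)))
    (fun j hj => (h₂ a ha j (hj.trans_le hi)).trans (hp a ha _ (by omega)))⟩

/-- The context in which the first `i` pairs `(u j, v j)` are tabulated and `i < N` is held in the
only variable. -/
def tab (Γ : Ctx α) (N : α → ℕ) (hN : Γ.PB N) (u v : α → ℕ → ℤ)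
    (hu : ∃ c, ∀ a, Γ.dom a → ∀ i < N a, bits (u a i) ≤ Γ.size a ^ c)
    (hv : ∃ c, ∀ a, Γ.dom a → ∀ i < N a, bits (v a i) ≤ Γ.size a ^ c) : Ctx (α × ℕ) where
  dom p := Γ.dom p.1 ∧ p.2 < N p.1
  size p := Γ.size p.1
  mem p := tabMem (Γ.mem p.1) (u p.1) (v p.1) p.2
  k := 1
  var _ p := p.2
  two_le p h := Γ.two_le p.1 h.1
  mem_bits := let ⟨c, hc⟩ := Γ.exists_bits_tabMem_le hu hv
    ⟨c, fun p h => hc p.1 h.1 p.2 h.2.le⟩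
  var_bits _ _ := let ⟨c, hc⟩ := hN
    ⟨c, fun p hp => (bits_natCast_le p.2).trans (hp.2.le.trans (hc p.1 hp.1))⟩

/-- The context in which all pairs `(u j, v j)` for `j < N` are tabulated. -/
def tabbed (Γ : Ctx α) (N : α → ℕ) (u v : α → ℕ → ℤ)
    (hu : ∃ c, ∀ a, Γ.dom a → ∀ i < N a, bits (u a i) ≤ Γ.size a ^ c)
    (hv : ∃ c, ∀ a, Γ.dom a → ∀ i < N a, bits (v a i) ≤ Γ.size a ^ c) : Ctx α where
  dom := Γ.dom
  size := Γ.size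
  mem a := tabMem (Γ.mem a) (u a) (v a) (N a)
  k := 0
  var _ _ := 0
  two_le := Γ.two_le
  mem_bits := let ⟨c, hc⟩ := Γ.exists_bits_tabMem_le hu hv
    ⟨c, fun a h => hc a h (N a) le_rfl⟩
  var_bits _ h := absurd h (Nat.not_lt_zero _)

end Ctx

/-- Tabulate `N` pairs of numbers, each of which may depend on the preceding ones, and then put out
three numbers that are computed from the table. -/
theorem exists_table_prog (Γ : Ctx α) (hk : Γ.k = 0) {N : α → ℕ} (hN : Γ.PB N)
    (hcN : Comp Γ fun a => (N a : ℤ)) {u v : α → ℕ → ℤ}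
    (hu : ∃ c, ∀ a, Γ.dom a → ∀ i < N a, bits (u a i) ≤ Γ.size a ^ c)
    (hv : ∃ c, ∀ a, Γ.dom a → ∀ i < N a, bits (v a i) ≤ Γ.size a ^ c)
    (hcu : Comp (Γ.tab N hN u v hu hv) fun p => u p.1 p.2)
    (hcv : Comp (Γ.tab N hN u v hu hv) fun p => v p.1 p.2)
    {X Y Z : α → ℤ} (hX : Comp (Γ.tabbed N u v hu hv) X) (hY : Comp (Γ.tabbed N u v hu hv) Y)
    (hZ : Comp (Γ.tabbed N u v hu hv) Z) :
    ∃ (p : Prog) (c : ℕ), ∀ a μ, Γ.dom a → (∀ x, IsData x → μ x = Γ.mem a x) →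
      ∃ ν t, Runs p μ ν t ∧ t ≤ Γ.size a ^ c ∧ ν 0 = X a ∧ ν 1 = Y a ∧ ν 2 = Z a := by
  -- Register 0 holds the loop counter and register 1 the length `N`; `u` and `v` are computed from
  -- registers 2 and 3 upward. After the loop no register is live, so the three outputs start again
  -- at register 0.
  obtain ⟨pN, TN, hTN, hpN⟩ := hcN.2 id 1 (by simp [hk])
  obtain ⟨qu, Uu, ⟨cu, hUu⟩, hqu⟩ := hcu.2 (fun _ => 0) 2 (by simp)
  obtain ⟨qv, Uv, ⟨cv, hUv⟩, hqv⟩ := hcv.2 (fun _ => 0) 3 (by simp)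
  obtain ⟨pX, TX, hTX, hpX⟩ := hX.2 id 0 (by simp [Ctx.tabbed])
  obtain ⟨pY, TY, hTY, hpY⟩ := hY.2 id 1 (by simp [Ctx.tabbed])
  obtain ⟨pZ, TZ, hTZ, hpZ⟩ := hZ.2 id 2 (by simp [Ctx.tabbed])
  obtain ⟨bu, hbu⟩ := id hu
  obtain ⟨bv, hbv⟩ := id hv
  let cell (s : ℕ) : Expn := .op .sub (.const (-s)) (.op .mul (.const 4) (get 0))
  have hcell : ∀ (s : ℕ) (μ : Mem), (cell s).eval μ = -(4 * μ (reg 0) + s) := fun s μ => by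
    simp [cell, Expn.eval, ArithOp.apply]; ring
  let Bcell : ℕ → α → ℕ := fun s a => 1 + bits (-s) + (1 + 3 + (2 + 2 * bits (reg 0) + N a) +
    (1 + 3) * (1 + N a)) + (1 + bits (-s)) * (1 + (3 + N a))
  have hBcell : ∀ s, Γ.PB (Bcell s) := fun s => ((Ctx.PB.const _).add (((Ctx.PB.const _).add
    ((Ctx.PB.const _).add hN)).add ((Ctx.PB.const _).mul ((Ctx.PB.const _).add hN)))).add
    ((Ctx.PB.const _).mul ((Ctx.PB.const _).add ((Ctx.PB.const _).add hN)))
  have hbcell : ∀ (s : ℕ) (n i : ℕ), i ≤ n → bits (-(4 * (i : ℤ) + s)) ≤ 4 * n + s :=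
    fun s n i hi => (bits_le_natAbs _).trans (by omega)
  have hcellcost : ∀ (s : ℕ) (a : α) (μ : Mem) (i : ℕ), i ≤ N a → μ (reg 0) = i →
      (cell s).cost μ ≤ Bcell s a := by
    intro s a μ i hi h
    have h1 : bits (i : ℤ) ≤ N a := (bits_natCast_le i).trans hi
    have h2 : bits (4 * (i : ℤ)) ≤ 3 + N a := (bits_mul_le _ _).trans (Nat.add_le_add le_rfl h1)
    have h3 : bits 4 = 3 := rfl
    simp only [cell, Expn.cost, Expn.eval, get_cost, get_eval, ArithOp.apply, h, h3, Bcell]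
    gcongr
  let body : Prog := .seq qu (.seq qv (.seq (.store (cell 1) (get 2)) (.seq (.store (cell 3) (get 3))
    (put 0 (.op .add (get 0) (.const 1))))))
  let c : Expn := .op .sub (get 1) (get 0)
  let Bc : α → ℕ := fun a => 2 + 2 * bits (reg 1) + N a + (2 + 2 * bits (reg 0) + N a) +
    (1 + N a) * (1 + N a)
  have hBc : Γ.PB Bc := (((Ctx.PB.const _).add hN).add ((Ctx.PB.const _).add hN)).add
    (((Ctx.PB.const _).add hN).mul ((Ctx.PB.const _).add hN))
  -- The value stored at offset `s = 1` is read from register `2 = s + 1`; for `s = 3` it is read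
  -- from register 3, which the additional `2 * bits (reg 3)` pays for.
  let Bst : ℕ → ℕ → α → ℕ := fun s b a => Bcell s a + (2 + 2 * bits (reg (s + 1)) + Γ.size a ^ b +
    2 * bits (reg 3)) + (1 + (4 * N a + s) + Γ.size a ^ b)
  have hsz : ∀ n, Γ.PB fun a => Γ.size a ^ n := fun n => Ctx.PB.size.pow n
  have hBst : ∀ s b, Γ.PB (Bst s b) := fun s b => ((hBcell s).add ((((Ctx.PB.const _).add
    (hsz _)).add (.const _)))).add (((Ctx.PB.const _).add (((Ctx.PB.const _).mul hN).add
    (.const _))).add (hsz _))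
  let Bb : α → ℕ := fun a => Γ.size a ^ cu + (Γ.size a ^ cv + (Bst 1 bu a + (Bst 3 bv a +
    (2 + 2 * bits (reg 0) + (2 + 2 * bits (reg 0) + N a + 2 + (1 + N a) * 2) + N a))))
  have hBb : Γ.PB Bb := (hsz _).add ((hsz _).add ((hBst _ _).add ((hBst _ _).add
    (((Ctx.PB.const _).add ((((Ctx.PB.const _).add hN).add (.const _)).add
      (((Ctx.PB.const _).add hN).mul (.const _)))).add hN))))
  let out (s : ℕ) : Prog := .store (.const s) (get s)
  let Bo : ℕ → (α → ℤ) → α → ℕ := fun s F a => (1 + bits (s : ℤ)) +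
    (2 + 2 * bits (reg s) + bits (F a)) + (1 + bits (s : ℤ) + bits (F a))
  have hBo : ∀ (s : ℕ) (F : α → ℤ), Comp (Γ.tabbed N u v hu hv) F → Γ.PB (Bo s F) := fun s F hF =>
    have h : Γ.PB fun a => bits (F a) := hF.1
    ((Ctx.PB.const _).add ((Ctx.PB.const _).add h)).add ((Ctx.PB.const _).add h)
  have hT : Γ.PB fun a => (2 + 2 * bits (reg 0) + 1) + (TN a + ((2 * (Bc a + Bb a) + 1) *
      (N a + 1) + (TX a + (TY a + (TZ a + (Bo 0 X a + (Bo 1 Y a + Bo 2 Z a))))))) :=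
    (Ctx.PB.const _).add (hTN.add (((((Ctx.PB.const _).mul (hBc.add hBb)).add (.const _)).mul
      (hN.add (.const _))).add (Ctx.PB.add hTX (Ctx.PB.add hTY (Ctx.PB.add hTZ
        ((hBo 0 X hX).add ((hBo 1 Y hY).add (hBo 2 Z hZ))))))))
  obtain ⟨e, he⟩ := hT
  refine ⟨.seq (put 0 (.const 0)) (.seq pN (.seq (.loop c body) (.seq pX (.seq pY (.seq pZ
    (.seq (out 0) (.seq (out 1) (out 2)))))))), e, fun a μ ha hμ => ?_⟩
  have run₁ := runs_put 0 (.const 0) μ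
  set μ₁ := Function.update μ (reg 0) ((Expn.const 0).eval μ) with hμ₁
  have f₁ : Frame 0 μ μ₁ := (Frame.refl 0 μ).update le_rfl _
  obtain ⟨μ₂, t₂, run₂, ht₂, v₂, f₂⟩ := hpN a μ₁ ha
    ⟨fun x hx => by rw [f₁.data_eq hx, hμ x hx], by simp [hk]⟩
  let I : ℕ → Mem → Prop := fun i ν => (∀ x, IsData x → ν x = tabMem (Γ.mem a) (u a) (v a) i x) ∧
    ν (reg 0) = i ∧ ν (reg 1) = N a
  have hc : ∀ i ≤ N a, ∀ ν, I i ν → c.eval ν = N a - i ∧ c.cost ν ≤ Bc a := by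
    rintro i hi ν ⟨-, h0, h1⟩
    refine ⟨by simp [c, Expn.eval, ArithOp.apply, h0, h1], ?_⟩
    have b1 : bits (i : ℤ) ≤ N a := (bits_natCast_le i).trans hi
    have b2 : bits (N a : ℤ) ≤ N a := bits_natCast_le _
    simp only [c, Expn.cost, get_cost, get_eval, h0, h1, Bc]
    gcongr
  have hpos : ∀ i < N a, ∀ ν, I i ν → 0 < c.eval ν ∧ c.cost ν ≤ Bc a + Bb a ∧
      ∃ ξ t, Runs body ν ξ t ∧ t ≤ Bc a + Bb a ∧ I (i + 1) ξ := by
    intro i hi ν hν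
    obtain ⟨h1, h2⟩ := hc i hi.le ν hν
    refine ⟨by rw [h1]; omega, by omega, ?_⟩
    obtain ⟨g, h0, hN1⟩ := hν
    have hL : (Γ.tab N hN u v hu hv).Holds (fun _ => 0) (a, i) ν := ⟨g, fun j _ => h0⟩
    obtain ⟨ν₁, s₁, r₁, hs₁, w₁, g₁⟩ := hqu (a, i) ν ⟨ha, hi⟩ hL
    obtain ⟨ν₂, s₂, r₂, hs₂, w₂, g₂⟩ := hqv (a, i) ν₁ ⟨ha, hi⟩ (hL.of_frame (by simp) g₁)
    have hb1 := hUu (a, i) ⟨ha, hi⟩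
    have hb2 := hUv (a, i) ⟨ha, hi⟩
    have hb3 := hbu a ha i hi
    have hb4 := hbv a ha i hi
    have e2 : ν₂ (reg 2) = u a i := by rw [g₂.reg_eq (by omega), w₁]
    have e0 : ν₂ (reg 0) = i := by rw [g₂.reg_eq (by omega), g₁.reg_eq (by omega), h0]
    have e1 : ν₂ (reg 1) = N a := by rw [g₂.reg_eq (by omega), g₁.reg_eq (by omega), hN1]
    have run₃ := Runs.store (cell 1) (get 2) ν₂
    rw [hcell, e0, get_eval, e2] at run₃
    set ν₃ := Function.update ν₂ (-(4 * (i : ℤ) + (1 : ℕ))) (u a i) with hν₃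
    have hdata : ∀ s : ℕ, s % 2 = 1 → IsData (-(4 * (i : ℤ) + s)) := fun s hs =>
      .inr (by omega)
    have k3 : ∀ r, ν₃ (reg r) = ν₂ (reg r) := fun r =>
      Function.update_of_ne ((hdata 1 rfl).ne_reg r).symm _ _
    have run₄ := Runs.store (cell 3) (get 3) ν₃
    rw [hcell, k3, e0, get_eval, k3, w₂] at run₄
    set ν₄ := Function.update ν₃ (-(4 * (i : ℤ) + (3 : ℕ))) (v a i) with hν₄
    have k4 : ∀ r, ν₄ (reg r) = ν₂ (reg r) := fun r =>
      (Function.update_of_ne ((hdata 3 rfl).ne_reg r).symm _ _).trans (k3 r)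
    have c1 := hcellcost 1 a ν₂ i hi.le e0
    have c3 := hcellcost 3 a ν₃ i hi.le (by rw [k3, e0])
    have d1 := hbcell 1 (N a) i hi.le
    have d3 := hbcell 3 (N a) i hi.le
    have hb5 : bits (i : ℤ) ≤ N a := (bits_natCast_le i).trans hi.le
    have hb6 : bits ((i : ℤ) + 1) ≤ N a := by exact_mod_cast (bits_natCast_le (i + 1)).trans hi
    have b1 : bits 1 = 1 := rfl
    have b2 : (1 + bits (i : ℤ)) * (1 + 1) ≤ (1 + N a) * 2 := by gcongr
    refine ⟨_, _, .seq r₁ (.seq r₂ (.seq run₃ (.seq run₄ (runs_put _ _ _)))), ?_, ?_, ?_, ?_⟩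
    · have hb1' : Uu (a, i) ≤ Γ.size a ^ cu := hb1
      have hb2' : Uv (a, i) ≤ Γ.size a ^ cv := hb2
      simp only [Expn.cost, Expn.eval, get_cost, get_eval, k3, k4, e2, e0, w₂, ArithOp.apply, b1,
        Bb, Bst]
      simp only [Nat.reduceAdd] at *
      omega
    · intro x hx
      rw [Function.update_of_ne (hx.ne_reg 0), tabMem_succ, hν₄, hν₃]
      have : ν₂ x = tabMem (Γ.mem a) (u a) (v a) i x := by
        rw [g₂.data_eq hx, g₁.data_eq hx, g x hx]
      simp only [Function.update_apply, this, Nat.cast_one, Nat.cast_ofNat]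
    · simp [Expn.eval, ArithOp.apply, k4, e0]
    · simp [k4, e1]
  have hend : ∀ ν, I (N a) ν → ¬ 0 < c.eval ν ∧ c.cost ν ≤ Bc a + Bb a := by
    intro ν hν
    obtain ⟨h1, h2⟩ := hc (N a) le_rfl ν hν
    exact ⟨by rw [h1]; omega, by omega⟩
  obtain ⟨μ₃, t₃, run₃, ht₃, hI₃⟩ := runs_loop I (N a) (Bc a + Bb a) hpos hend (μ := μ₂)
    ⟨fun x hx => by rw [f₂.data_eq hx, f₁.data_eq hx, hμ x hx, tabMem_zero],
      by rw [f₂.reg_eq (by omega)]; simp [μ₁, Expn.eval], v₂⟩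
  have hH : (Γ.tabbed N u v hu hv).Holds id a μ₃ := ⟨hI₃.1, by simp [Ctx.tabbed]⟩
  obtain ⟨μ₄, t₄, run₄, ht₄, v₄, f₄⟩ := hpX a μ₃ ha hH
  have hH4 := hH.of_frame (by simp [Ctx.tabbed]) f₄
  obtain ⟨μ₅, t₅, run₅, ht₅, v₅, f₅⟩ := hpY a μ₄ ha hH4
  obtain ⟨μ₆, t₆, run₆, ht₆, v₆, f₆⟩ := hpZ a μ₅ ha (hH4.of_frame (by simp [Ctx.tabbed]) f₅)
  have w₅ : μ₆ (reg 1) = Y a := by rw [f₆.reg_eq (by omega), v₅]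
  have w₄ : μ₆ (reg 0) = X a := by rw [f₆.reg_eq (by omega), f₅.reg_eq (by omega), v₄]
  have hne : ∀ (s : ℕ) (r : ℕ), reg r ≠ (s : ℤ) := fun s r h => by simp only [reg] at h; omega
  have hbound := he a ha
  refine ⟨_, _, .seq run₁ (.seq run₂ (.seq run₃ (.seq run₄ (.seq run₅ (.seq run₆
    (.seq (.store _ _ _) (.seq (.store _ _ _) (.store _ _ _)))))))), ?_, ?_, ?_, ?_⟩
  · refine le_trans ?_ hbound
    simp only [Expn.cost, Expn.eval, get_cost, get_eval, bits_zero,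
      Function.update_of_ne (hne _ _), w₄, w₅, v₆, Bo]
    omega
  · have h1 : (0 : ℤ) ≠ (1 : ℕ) := by norm_num
    have h2 : (0 : ℤ) ≠ (2 : ℕ) := by norm_num
    simp [Expn.eval, w₄]
  · simp only [Expn.eval, get_eval, Function.update_of_ne (hne _ _), w₅]
    norm_num [Function.update_apply]
  · simp only [Expn.eval, get_eval, Function.update_of_ne (hne _ _), v₆]
    norm_num [Function.update_apply]

end RAM

/-! ### The layout of the input -/

theorem List.getD_flatten_of_length_eq {α : Type*} {c : ℕ} (z : α) :
    ∀ (l : List (List α)), (∀ x ∈ l, x.length = c) → ∀ a < l.length, ∀ j < c,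
      l.flatten.getD (a * c + j) z = (l.getD a []).getD j z
  | [], _, a, ha, _, _ => absurd ha (Nat.not_lt_zero a)
  | x :: l, h, 0, _, j, hj => by
    rw [zero_mul, zero_add, List.flatten_cons, List.getD_append _ _ _ _
      (by rw [h x (by simp)]; exact hj)]
    simp
  | x :: l, h, a + 1, ha, j, hj => by
    have hx := h x (by simp)
    rw [List.flatten_cons, List.getD_append_right _ _ _ _ (by rw [hx]; nlinarith), hx,
      show (a + 1) * c + j - c = a * c + j by rw [add_mul, one_mul]; omega,
      List.getD_flatten_of_length_eq z l (fun y hy => h y (by simp [hy])) a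
        (by simpa using ha) j hj, List.getD_cons_succ]

theorem List.length_flatten_of_length_eq {α : Type*} {c : ℕ} (l : List (List α))
    (h : ∀ x ∈ l, x.length = c) : l.flatten.length = l.length * c := by
  rw [List.length_flatten, List.map_congr_left h]
  simp

theorem List.getD_ofFn {α : Type*} {N : ℕ} (f : Fin N → α) (z : α) {a : ℕ} (ha : a < N) :
    (List.ofFn f).getD a z = f ⟨a, ha⟩ := by
  rw [List.getD_eq_getElem _ _ (by simpa using ha), List.getElem_ofFn]

namespace LocalTerm

variable {n d : ℕ}

instance : Inhabited (LocalTerm n d) := ⟨⟨0, ⟨Fin.elim0, fun a => a.elim0⟩, 0, 0⟩⟩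

/-- The number of the `a`-th site. -/
def siteNum (T : LocalTerm n d) (a : ℕ) : ℕ := if h : a < T.size then T.site ⟨a, h⟩ else 0

/-- The real part of the matrix entry in row `p` and column `q`. -/
def reEntry (T : LocalTerm n d) (p q : ℕ) : ℚ :=
  if h : p < d ^ T.size then if h' : q < d ^ T.size then
    T.re (finFunctionFinEquiv.symm ⟨p, h⟩) (finFunctionFinEquiv.symm ⟨q, h'⟩) else 0 else 0

/-- The imaginary part of the matrix entry in row `p` and column `q`. -/
def imEntry (T : LocalTerm n d) (p q : ℕ) : ℚ :=
  if h : p < d ^ T.size then if h' : q < d ^ T.size then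
    T.im (finFunctionFinEquiv.symm ⟨p, h⟩) (finFunctionFinEquiv.symm ⟨q, h'⟩) else 0 else 0

theorem length_encodeTerm (T : LocalTerm n d) :
    (encodeTerm T).length = 1 + T.size + 4 * (d ^ T.size * d ^ T.size) := by
  have h : ∀ a : Fin (d ^ T.size), (List.ofFn fun b : Fin (d ^ T.size) =>
      encodeRat (T.re (finFunctionFinEquiv.symm a) (finFunctionFinEquiv.symm b)) ++
      encodeRat (T.im (finFunctionFinEquiv.symm a) (finFunctionFinEquiv.symm b))).flatten.length =
      d ^ T.size * 4 := fun a => by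
    rw [List.length_flatten_of_length_eq (c := 4)]
    · simp
    · simp [encodeRat, List.mem_ofFn]
  rw [encodeTerm, List.cons_append, List.length_cons, List.length_append,
    List.length_flatten_of_length_eq (c := d ^ T.size * 4)]
  · simp; ring
  · simp only [List.mem_ofFn]
    rintro _ ⟨a, rfl⟩
    exact h a

theorem encodeTerm_zero (T : LocalTerm n d) : (encodeTerm T).getD 0 0 = T.size := by
  simp [encodeTerm]

theorem encodeTerm_site (T : LocalTerm n d) {a : ℕ} (ha : a < T.size) :
    (encodeTerm T).getD (1 + a) 0 = T.siteNum a := by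
  rw [encodeTerm, List.cons_append, add_comm, List.getD_cons_succ, List.getD_append _ _ _ _ (by simpa),
    List.getD_ofFn _ _ ha]
  simp [siteNum, ha]

theorem encodeTerm_entry (T : LocalTerm n d) {p q j : ℕ} (hp : p < d ^ T.size)
    (hq : q < d ^ T.size) (hj : j < 4) :
    (encodeTerm T).getD (1 + T.size + (4 * (p * d ^ T.size + q) + j)) 0 =
      [(T.reEntry p q).num, ((T.reEntry p q).den : ℤ), (T.imEntry p q).num,
        ((T.imEntry p q).den : ℤ)].getD j 0 := by
  have h : ∀ a : Fin (d ^ T.size), ∀ x ∈ (List.ofFn fun b : Fin (d ^ T.size) =>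
      encodeRat (T.re (finFunctionFinEquiv.symm a) (finFunctionFinEquiv.symm b)) ++
      encodeRat (T.im (finFunctionFinEquiv.symm a) (finFunctionFinEquiv.symm b))),
      x.length = 4 := fun a => by
    simp [encodeRat, List.mem_ofFn]
  have hlt : q * 4 + j < d ^ T.size * 4 := by omega
  rw [encodeTerm, List.cons_append,
    show 1 + T.size + (4 * (p * d ^ T.size + q) + j) =
      (T.size + (p * (d ^ T.size * 4) + (q * 4 + j))) + 1 by ring,
    List.getD_cons_succ, List.getD_append_right _ _ _ _ (by simp), List.length_ofFn,
    Nat.add_sub_cancel_left,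
    List.getD_flatten_of_length_eq (c := d ^ T.size * 4) _ _ _ _ (by simpa) _ hlt,
    List.getD_ofFn _ _ hp,
    List.getD_flatten_of_length_eq (c := 4) _ _ (h _) _ (by simpa) _ hj, List.getD_ofFn _ _ hq]
  · simp [encodeRat, reEntry, imEntry, hp, hq]
  · simp only [List.mem_ofFn]
    rintro _ ⟨a, rfl⟩
    rw [List.length_flatten_of_length_eq _ (h a), List.length_ofFn]

end LocalTerm

namespace LatticeHamiltonian

variable {D d n : ℕ}

/-- The local term with number `T`. -/
def term (H : LatticeHamiltonian D d n) (T : ℕ) : LocalTerm n d := H.terms.getD T default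

theorem term_mem (H : LatticeHamiltonian D d n) {T : ℕ} (hT : T < H.terms.length) :
    H.term T ∈ H.terms := by
  rw [term, List.getD_eq_getElem _ _ hT]
  exact List.getElem_mem hT

/-- The position of the description of the local term with number `T` in the input. -/
def offset (H : LatticeHamiltonian D d n) (T : ℕ) : ℕ :=
  8 + ((H.terms.take T).flatMap encodeTerm).length

theorem offset_zero (H : LatticeHamiltonian D d n) : H.offset 0 = 8 := by simp [offset]

theorem offset_succ (H : LatticeHamiltonian D d n) {T : ℕ} (hT : T < H.terms.length) :
    H.offset (T + 1) = H.offset T + (1 + (H.term T).size +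
      4 * (d ^ (H.term T).size * d ^ (H.term T).size)) := by
  rw [offset, offset, List.take_add_one, List.flatMap_append, List.length_append, ← add_assoc,
    List.getElem?_eq_getElem hT, term, List.getD_eq_getElem _ _ hT]
  simp [LocalTerm.length_encodeTerm]

theorem input_term (H : LatticeHamiltonian D d n) (β : ℚ × ℚ) (ε : ℚ) {T : ℕ}
    (hT : T < H.terms.length) {j : ℕ} (hj : j < (encodeTerm (H.term T)).length) :
    RAM.initMem (encodeInput H β ε) (H.offset T + j) = (encodeTerm (H.term T)).getD j 0 := by
  have h1 : H.terms.flatMap encodeTerm = (H.terms.take T).flatMap encodeTerm ++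
      (encodeTerm (H.term T) ++ (H.terms.drop (T + 1)).flatMap encodeTerm) := by
    conv_lhs => rw [← List.take_append_drop T H.terms, List.drop_eq_getElem_cons hT]
    rw [List.flatMap_append, List.flatMap_cons, term, List.getD_eq_getElem _ _ hT]
  rw [RAM.initMem, if_pos (by positivity), encodeInput, h1, ← List.append_assoc]
  rw [show ((H.offset T : ℤ) + j).toNat = H.offset T + j by omega]
  rw [List.getD_append_right _ _ _ _ (by simp [offset, encodeRat]; omega)]
  rw [show H.offset T + j - _ = j by simp [offset, encodeRat]; omega]
  rw [List.getD_append _ _ _ _ hj]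

theorem size_eq_card (T : LocalTerm n d) : T.supp.card = T.size := by simp [LocalTerm.supp]

/-- There are at most `n ^ κ` local terms. -/
theorem length_terms_le (H : LatticeHamiltonian D d n) {κ : ℕ}
    (hκ : ∀ T ∈ H.terms, T.size ≤ κ) : H.terms.length ≤ n ^ κ := by
  classical
  have hnodup : (H.terms.map LocalTerm.supp).Nodup := by
    rw [List.Nodup, List.pairwise_map]
    exact H.distinct
  have hsub : (H.terms.map LocalTerm.supp).toFinset ⊆
      (Finset.univ : Finset (Fin κ → Fin n)).image fun f => Finset.univ.image f := by
    intro S hS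
    rw [List.mem_toFinset, List.mem_map] at hS
    obtain ⟨T, hT, rfl⟩ := hS
    have hne : 0 < T.size := by
      rw [← size_eq_card]; exact Finset.card_pos.2 (H.nonempty T hT)
    -- A nonempty support of at most `κ` sites is the range of a `κ`-tuple: the last site is
    -- repeated to fill the tuple.
    refine Finset.mem_image.2 ⟨fun i => T.site ⟨min i (T.size - 1), by omega⟩, Finset.mem_univ _, ?_⟩
    ext v
    simp only [Finset.mem_image, Finset.mem_univ, true_and, LocalTerm.supp, Finset.mem_map]
    constructor
    · rintro ⟨i, rfl⟩; exact ⟨_, rfl⟩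
    · rintro ⟨i, rfl⟩
      refine ⟨⟨i, i.2.trans_le (hκ T hT)⟩, congrArg T.site (Fin.ext ?_)⟩
      have := i.2
      simp only
      omega
  calc H.terms.length = (H.terms.map LocalTerm.supp).toFinset.card := by
        rw [List.toFinset_card_of_nodup hnodup, List.length_map]
    _ ≤ _ := Finset.card_le_card hsub
    _ ≤ _ := Finset.card_image_le
    _ = n ^ κ := by simp

end LatticeHamiltonian

/-! ### Instances and the size parameter `X` -/

/-- The inputs of the algorithm. -/
structure Instance (D d κ : ℕ) where
  n : ℕ
  d_pos : 0 < d
  H : LatticeHamiltonian D d n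
  β : ℚ × ℚ
  ε : ℚ
  two_le : 2 ≤ n
  size_le : ∀ T ∈ H.terms, T.size ≤ κ
  ε_pos : 0 < ε
  ε_lt : ε < 1

namespace Instance

variable {D d κ : ℕ} (I : Instance D d κ)

/-- The input as a list of integers. -/
def input : List ℤ := encodeInput I.H I.β I.ε

/-- The number of local terms. -/
def m : ℕ := I.H.terms.length

/-- The number of bits of the integer part of `n / ε`. -/
def L : ℕ := Nat.size (I.n * I.ε.den / I.ε.num.toNat)

/-- The quantity in which the running time is polynomial. -/
def X : ℕ := RAM.maxBits I.input * I.n ^ I.L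

theorem num_pos : 0 < I.ε.num := Rat.num_pos.2 I.ε_pos

theorem num_lt_den : I.ε.num < I.ε.den := Rat.num_lt_denom_iff.2 I.ε_lt

theorem two_le_quo : 2 ≤ I.n * I.ε.den / I.ε.num.toNat := by
  have h1 := I.num_pos
  have h2 := I.num_lt_den
  have h3 := I.two_le
  rw [Nat.le_div_iff_mul_le (by omega)]
  exact Nat.mul_le_mul h3 (by omega)

theorem one_lt_L : 1 < I.L := Nat.lt_size.2 I.two_le_quo

theorem foldr_max_mem {l : List ℕ} {b : ℕ} (h : b ∈ l) : b ≤ l.foldr max 0 := by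
  induction l with
  | nil => simp at h
  | cons x l ih =>
    rcases List.mem_cons.1 h with rfl | h
    · exact le_max_left _ _
    · exact (ih h).trans (le_max_right _ _)

theorem bits_initMem_le (w : List ℤ) (x : ℤ) : RAM.bits (RAM.initMem w x) ≤ RAM.maxBits w := by
  unfold RAM.initMem
  split_ifs
  · by_cases h : x.toNat < w.length
    · rw [List.getD_eq_getElem _ _ h]
      exact foldr_max_mem (List.mem_map_of_mem (List.getElem_mem h))
    · rw [List.getD_eq_default _ _ (not_lt.1 h)]
      simp
  · simp

theorem initMem_zero : RAM.initMem I.input 0 = I.n := by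
  simp [RAM.initMem, input, encodeInput]

theorem two_le_maxBits : 2 ≤ RAM.maxBits I.input := by
  have := bits_initMem_le I.input 0
  rw [initMem_zero, RAM.bits_natCast] at this
  exact (Nat.lt_size.2 (by simpa using I.two_le)).trans_le this

theorem n_pow_le : I.n ^ I.L ≤ I.X := Nat.le_mul_of_pos_left _ (by have := I.two_le_maxBits; omega)

theorem n_le : I.n ≤ I.X :=
  (Nat.le_self_pow (by have := I.one_lt_L; omega) _).trans I.n_pow_le

theorem L_le : I.L ≤ I.X :=
  (Nat.lt_two_pow_self.le.trans (Nat.pow_le_pow_left I.two_le _)).trans I.n_pow_le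

theorem maxBits_le : RAM.maxBits I.input ≤ I.X :=
  Nat.le_mul_of_pos_right _ (pow_pos (by have := I.two_le; omega) _)

theorem m_le : I.m ≤ I.n ^ κ := I.H.length_terms_le I.size_le

/-- The number of letters of the words whose traces are computed. -/
def letters : ℕ := I.m * (d ^ κ * d ^ κ)

/-- The constant `c = d ^ κ * d ^ κ` moves into the exponent by `c < 2 ^ c ≤ n ^ c`. -/
theorem letters_le : I.letters ≤ I.n ^ (κ + d ^ κ * d ^ κ) := by
  rw [pow_add]
  exact Nat.mul_le_mul I.m_le
    (Nat.lt_two_pow_self.le.trans (Nat.pow_le_pow_left I.two_le _))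

/-- The source of the quasi-polynomial running time: over an alphabet of `n ^ O(1)` letters there
are `n ^ O(L)` words of length `O(L)`, which is a fixed power of `X`. -/
theorem letters_pow_le {k₀ N : ℕ} (hN : N ≤ k₀ * I.L) :
    I.letters ^ N ≤ I.X ^ ((κ + d ^ κ * d ^ κ) * k₀) := by
  have h2 := I.two_le
  calc I.letters ^ N ≤ (I.n ^ (κ + d ^ κ * d ^ κ)) ^ N := Nat.pow_le_pow_left I.letters_le N
    _ ≤ (I.n ^ (κ + d ^ κ * d ^ κ)) ^ (k₀ * I.L) :=
        Nat.pow_le_pow_right (pow_pos (by omega) _) hN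
    _ = (I.n ^ I.L) ^ ((κ + d ^ κ * d ^ κ) * k₀) := by rw [← pow_mul, ← pow_mul]; ring_nf
    _ ≤ _ := Nat.pow_le_pow_left I.n_pow_le _

end Instance

/-! ### Arithmetic of Gaussian integers and access to the input -/

namespace RAM

variable {α : Type} {D d κ : ℕ}

namespace Comp

variable {Γ : Ctx α}

theorem ite_lt {A B F G : α → ℤ} (hA : Comp Γ A) (hB : Comp Γ B)
    (hF : Comp (Γ.restrict fun a => A a < B a) F)
    (hG : Comp (Γ.restrict fun a => ¬ A a < B a) G) :
    Comp Γ fun a => if A a < B a then F a else G a :=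
  ite (hB.sub hA) (fun _ _ => by omega) hF hG

/-- Programs test positivity only; for integers, equality of `A` and `B` amounts to `0 < 1 - (A - B)
^ 2`. -/
theorem ite_eq {A B F G : α → ℤ} (hA : Comp Γ A) (hB : Comp Γ B)
    (hF : Comp (Γ.restrict fun a => A a = B a) F)
    (hG : Comp (Γ.restrict fun a => ¬ A a = B a) G) :
    Comp Γ fun a => if A a = B a then F a else G a :=
  ite ((const 1).sub ((hA.sub hB).mul (hA.sub hB))) (fun a _ => by
    rw [← sub_eq_zero (a := A a)]
    generalize A a - B a = z
    constructor
    · rintro rfl; norm_num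
    · intro h
      by_contra hz
      have := Int.one_le_abs hz
      nlinarith [abs_mul_abs_self z]) hF hG

end Comp

/-- Computability of a function with values in the Gaussian integers. -/
def CompG (Γ : Ctx α) (F : α → GaussianInt) : Prop :=
  Comp Γ (fun a => (F a).re) ∧ Comp Γ fun a => (F a).im

/-- Submultiplicativity of the norm `|re| + |im|`. It makes the bit lengths in long products add up,
as `bits_gprod_le` records. -/
theorem natAbs_add_natAbs_mul_le (z w : GaussianInt) :
    (z * w).re.natAbs + (z * w).im.natAbs ≤
      (z.re.natAbs + z.im.natAbs) * (w.re.natAbs + w.im.natAbs) := by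
  zify
  simp only [Zsqrtd.re_mul, Zsqrtd.im_mul]
  have h1 : |z.re * w.re + -1 * z.im * w.im| ≤ |z.re| * |w.re| + |z.im| * |w.im| := by
    rw [← abs_mul, ← abs_mul, neg_one_mul, neg_mul]
    exact (abs_add_le _ _).trans (by rw [abs_neg])
  have h2 : |z.re * w.im + z.im * w.re| ≤ |z.re| * |w.im| + |z.im| * |w.re| := by
    rw [← abs_mul, ← abs_mul]; exact abs_add_le _ _
  calc _ ≤ _ := add_le_add h1 h2
    _ = _ := by ring

theorem bits_gprod_le (f : ℕ → GaussianInt) (n b : ℕ)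
    (h : ∀ i < n, bits (f i).re ≤ b ∧ bits (f i).im ≤ b) :
    bits (∏ i ∈ Finset.range n, f i).re ≤ n * (b + 1) + 1 ∧
      bits (∏ i ∈ Finset.range n, f i).im ≤ n * (b + 1) + 1 := by
  suffices h : (∏ i ∈ Finset.range n, f i).re.natAbs + (∏ i ∈ Finset.range n, f i).im.natAbs ≤
      2 ^ (n * (b + 1)) by
    have : 2 ^ (n * (b + 1)) < 2 ^ (n * (b + 1) + 1) := Nat.pow_lt_pow_right (by norm_num) (by simp)
    rw [bits_le, bits_le]
    omega
  induction n with
  | zero => simp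
  | succ n ih =>
    rw [Finset.prod_range_succ, add_mul, pow_add, one_mul]
    refine (natAbs_add_natAbs_mul_le _ _).trans
      (Nat.mul_le_mul (ih fun i hi => h i (hi.trans n.lt_succ_self)) ?_)
    obtain ⟨h1, h2⟩ := h n n.lt_succ_self
    rw [bits_le] at h1 h2
    rw [pow_succ]
    omega

namespace CompG

variable {Γ : Ctx α}

theorem congr {F G : α → GaussianInt} (h : CompG Γ F) (hFG : ∀ a, Γ.dom a → F a = G a) :
    CompG Γ G :=
  ⟨h.1.congr fun a ha => by rw [hFG a ha], h.2.congr fun a ha => by rw [hFG a ha]⟩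

theorem ofInt {F : α → ℤ} (h : Comp Γ F) : CompG Γ fun a => (F a : GaussianInt) :=
  ⟨h.congr fun _ _ => by simp, (Comp.const 0).congr fun _ _ => by simp⟩

theorem ofNat {F : α → ℕ} (h : Comp Γ fun a => (F a : ℤ)) : CompG Γ fun a => (F a : GaussianInt) :=
  (ofInt h).congr fun _ _ => by simp

theorem sub {F G : α → GaussianInt} (hF : CompG Γ F) (hG : CompG Γ G) :
    CompG Γ fun a => F a - G a := ⟨(hF.1.sub hG.1).congr fun _ _ => by simp,
      (hF.2.sub hG.2).congr fun _ _ => by simp⟩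

theorem neg {F : α → GaussianInt} (hF : CompG Γ F) : CompG Γ fun a => -F a :=
  ⟨hF.1.neg, hF.2.neg⟩

theorem mul {F G : α → GaussianInt} (hF : CompG Γ F) (hG : CompG Γ G) :
    CompG Γ fun a => F a * G a :=
  ⟨((hF.1.mul hG.1).sub (hF.2.mul hG.2)).congr fun _ _ => by
      rw [Zsqrtd.re_mul]; ring,
    ((hF.1.mul hG.2).add (hF.2.mul hG.1)).congr fun _ _ => by rw [Zsqrtd.im_mul]⟩

theorem push {F : α → GaussianInt} (h : CompG Γ F) (N : α → ℕ) (hN : Γ.PB N) :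
    CompG (Γ.push N hN) fun p => F p.1 := ⟨h.1.push N hN, h.2.push N hN⟩

theorem sum {N : α → ℕ} (hN : Γ.PB N) (hcN : Comp Γ fun a => (N a : ℤ))
    {G : α → ℕ → GaussianInt} (hG : CompG (Γ.push N hN) fun p => G p.1 p.2) :
    CompG Γ fun a => ∑ i ∈ Finset.range (N a), G a i := by
  have hre : ∀ (n : ℕ) (f : ℕ → GaussianInt), (∑ i ∈ Finset.range n, f i).re =
      ∑ i ∈ Finset.range n, (f i).re := fun n f => by
    induction n with
    | zero => simp
    | succ n ih => simp [Finset.sum_range_succ, ih]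
  have him : ∀ (n : ℕ) (f : ℕ → GaussianInt), (∑ i ∈ Finset.range n, f i).im =
      ∑ i ∈ Finset.range n, (f i).im := fun n f => by
    induction n with
    | zero => simp
    | succ n ih => simp [Finset.sum_range_succ, ih]
  exact ⟨(Comp.sum hN hcN (G := fun a i => (G a i).re) hG.1).congr fun _ _ => (hre _ _).symm,
    (Comp.sum hN hcN (G := fun a i => (G a i).im) hG.2).congr fun _ _ => (him _ _).symm⟩

/-- Real and imaginary parts of the partial products are the two accumulators of one loop. The bound
`hb` on all partial products comes first, since the loop context cannot be formed without it. -/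
theorem prod {N : α → ℕ} (hN : Γ.PB N) (hcN : Comp Γ fun a => (N a : ℤ))
    {G : α → ℕ → GaussianInt} (hG : CompG (Γ.push N hN) fun p => G p.1 p.2) :
    CompG Γ fun a => ∏ i ∈ Finset.range (N a), G a i := by
  obtain ⟨c₁, hc₁⟩ := id hG.1.1
  obtain ⟨c₂, hc₂⟩ := id hG.2.1
  have hsz : ∀ c, Γ.PB fun a => Γ.size a ^ c := fun c => Ctx.PB.size.pow c
  obtain ⟨e, he⟩ := (hN.mul (((hsz c₁).add (hsz c₂)).add (.const 1))).add (.const 1)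
  have hb : ∀ a, Γ.dom a → ∀ i ≤ N a, bits (∏ j ∈ Finset.range i, G a j).re ≤ Γ.size a ^ e ∧
      bits (∏ j ∈ Finset.range i, G a j).im ≤ Γ.size a ^ e := by
    intro a ha i hi
    have h1 : i * (Γ.size a ^ c₁ + Γ.size a ^ c₂ + 1) + 1 ≤ Γ.size a ^ e :=
      (Nat.add_le_add_right (Nat.mul_le_mul_right _ hi) _).trans (he a ha)
    obtain ⟨h2, h3⟩ := bits_gprod_le (G a) i (Γ.size a ^ c₁ + Γ.size a ^ c₂) fun j hj =>
      ⟨(hc₁ (a, j) ⟨ha, hj.trans_le hi⟩).trans (Nat.le_add_right _ _),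
        (hc₂ (a, j) ⟨ha, hj.trans_le hi⟩).trans (Nat.le_add_left _ _)⟩
    exact ⟨h2.trans h1, h3.trans h1⟩
  have hx : ∃ c, ∀ a, Γ.dom a → ∀ i ≤ N a, bits (∏ j ∈ Finset.range i, G a j).re ≤ Γ.size a ^ c :=
    ⟨e, fun a ha i hi => (hb a ha i hi).1⟩
  have hy : ∃ c, ∀ a, Γ.dom a → ∀ i ≤ N a, bits (∏ j ∈ Finset.range i, G a j).im ≤ Γ.size a ^ c :=
    ⟨e, fun a ha i hi => (hb a ha i hi).2⟩
  have hstep : CompG (Γ.loop N hN (fun a i => (∏ j ∈ Finset.range i, G a j).re)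
      (fun a i => (∏ j ∈ Finset.range i, G a j).im) hx hy)
      fun p => ∏ j ∈ Finset.range (p.2 + 1), G p.1 j :=
    (mul (F := fun p => ∏ j ∈ Finset.range p.2, G p.1 j) ⟨Comp.loop_fst, Comp.loop_snd⟩
      ⟨hG.1.loop, hG.2.loop⟩).congr fun _ _ => (Finset.prod_range_succ _ _).symm
  have h0 : Comp Γ fun a => (∏ j ∈ Finset.range 0, G a j).re :=
    (Comp.const 1).congr fun _ _ => by simp
  have h1 : Comp Γ fun a => (∏ j ∈ Finset.range 0, G a j).im :=
    (Comp.const 0).congr fun _ _ => by simp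
  exact ⟨Comp.fold_fst (x := fun a i => (∏ j ∈ Finset.range i, G a j).re)
      (y := fun a i => (∏ j ∈ Finset.range i, G a j).im) hcN h0 h1 hstep.1 hstep.2,
    Comp.fold_snd (x := fun a i => (∏ j ∈ Finset.range i, G a j).re)
      (y := fun a i => (∏ j ∈ Finset.range i, G a j).im) hcN h0 h1 hstep.1 hstep.2⟩

theorem pow {F : α → GaussianInt} {N : α → ℕ} (hF : CompG Γ F) (hN : Γ.PB N)
    (hcN : Comp Γ fun a => (N a : ℤ)) : CompG Γ fun a => F a ^ N a :=
  (prod hN hcN (G := fun a _ => F a) (hF.push N hN)).congr fun _ _ => by simp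

end CompG

namespace Comp

variable {Γ : Ctx α}

theorem natMul {F G : α → ℕ} (hF : Comp Γ fun a => (F a : ℤ)) (hG : Comp Γ fun a => (G a : ℤ)) :
    Comp Γ fun a => ((F a * G a : ℕ) : ℤ) := (hF.mul hG).congr fun _ _ => by push_cast; rfl

theorem natAdd {F G : α → ℕ} (hF : Comp Γ fun a => (F a : ℤ)) (hG : Comp Γ fun a => (G a : ℤ)) :
    Comp Γ fun a => ((F a + G a : ℕ) : ℤ) := (hF.add hG).congr fun _ _ => by push_cast; rfl

theorem natDiv {F G : α → ℕ} (hF : Comp Γ fun a => (F a : ℤ)) (hG : Comp Γ fun a => (G a : ℤ)) :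
    Comp Γ fun a => ((F a / G a : ℕ) : ℤ) := (hF.quo hG).congr fun _ _ => by push_cast; rfl

theorem natMod {F G : α → ℕ} (hF : Comp Γ fun a => (F a : ℤ)) (hG : Comp Γ fun a => (G a : ℤ)) :
    Comp Γ fun a => ((F a % G a : ℕ) : ℤ) := (hF.mod hG).congr fun _ _ => by push_cast; rfl

theorem natPow {F N : α → ℕ} (hF : Comp Γ fun a => (F a : ℤ)) (hN : Γ.PB N)
    (hcN : Comp Γ fun a => (N a : ℤ)) : Comp Γ fun a => ((F a ^ N a : ℕ) : ℤ) :=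
  (hF.pow hN hcN).congr fun _ _ => by push_cast; rfl

theorem natSub {F G : α → ℕ} (hF : Comp Γ fun a => (F a : ℤ)) (hG : Comp Γ fun a => (G a : ℤ)) :
    Comp Γ fun a => ((F a - G a : ℕ) : ℤ) :=
  (ite_lt hG hF (F := fun a => (F a : ℤ) - G a) (G := fun _ => 0)
    ((hF.sub hG).restrict _) (const 0)).congr fun a _ => by split_ifs <;> omega

theorem natConst (n : ℕ) : Comp Γ fun _ => (n : ℤ) := const n

theorem natSum {N : α → ℕ} (hN : Γ.PB N) (hcN : Comp Γ fun a => (N a : ℤ))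
    {G : α → ℕ → ℕ} (hG : Comp (Γ.push N hN) fun p => (G p.1 p.2 : ℤ)) :
    Comp Γ fun a => ((∑ i ∈ Finset.range (N a), G a i : ℕ) : ℤ) :=
  (sum hN hcN (G := fun a i => (G a i : ℤ)) hG).congr fun _ _ => by push_cast; rfl

theorem natProd {N : α → ℕ} (hN : Γ.PB N) (hcN : Comp Γ fun a => (N a : ℤ))
    {G : α → ℕ → ℕ} (hG : Comp (Γ.push N hN) fun p => (G p.1 p.2 : ℤ)) :
    Comp Γ fun a => ((∏ i ∈ Finset.range (N a), G a i : ℕ) : ℤ) :=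
  (prod hN hcN (G := fun a i => (G a i : ℤ)) hG).congr fun _ _ => by push_cast; rfl

theorem natIteLt {A B F G : α → ℕ} (hA : Comp Γ fun a => (A a : ℤ))
    (hB : Comp Γ fun a => (B a : ℤ))
    (hF : Comp (Γ.restrict fun a => A a < B a) fun a => (F a : ℤ))
    (hG : Comp (Γ.restrict fun a => ¬ A a < B a) fun a => (G a : ℤ)) :
    Comp Γ fun a => ((if A a < B a then F a else G a : ℕ) : ℤ) :=
  (ite (P := fun a => A a < B a) (hB.sub hA) (fun _ _ => by omega) hF hG).congr
    fun _ _ => by push_cast; rfl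

theorem natIteEq {A B F G : α → ℕ} (hA : Comp Γ fun a => (A a : ℤ))
    (hB : Comp Γ fun a => (B a : ℤ)) (hF : Comp Γ fun a => (F a : ℤ))
    (hG : Comp Γ fun a => (G a : ℤ)) :
    Comp Γ fun a => ((if A a = B a then F a else G a : ℕ) : ℤ) :=
  (ite_eq hA hB (hF.restrict _) (hG.restrict _)).congr fun _ _ => by
    split_ifs with h1 h2 h2 <;> first | rfl | (exfalso; omega)

theorem natFactorial {N : α → ℕ} (hN : Γ.PB N) (hcN : Comp Γ fun a => (N a : ℤ)) :
    Comp Γ fun a => (((N a).factorial : ℕ) : ℤ) :=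
  (natProd hN hcN (G := fun _ i => i + 1) (last.natAdd (natConst 1))).congr
    fun _ _ => by rw [Finset.prod_range_add_one_eq_factorial]

end Comp

/-- The data cells with nonnegative addresses hold the input of the algorithm. -/
structure Ctx.Reads (Γ : Ctx α) (ι : α → Instance D d κ) : Prop where
  size_eq : ∀ a, Γ.dom a → Γ.size a = (ι a).X
  mem_eq : ∀ a, Γ.dom a → ∀ x, 0 ≤ x → Γ.mem a x = initMem (ι a).input x

namespace Ctx.Reads

variable {Γ : Ctx α} {ι : α → Instance D d κ}

theorem push (hΓ : Γ.Reads ι) (N : α → ℕ) (hN : Γ.PB N) :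
    (Γ.push N hN).Reads fun p => ι p.1 :=
  ⟨fun p hp => hΓ.size_eq p.1 hp.1, fun p hp => hΓ.mem_eq p.1 hp.1⟩

theorem loop (hΓ : Γ.Reads ι) (N : α → ℕ) (hN : Γ.PB N) (x y hx hy) :
    (Γ.loop N hN x y hx hy).Reads fun p => ι p.1 :=
  ⟨fun p hp => hΓ.size_eq p.1 hp.1, fun p hp => hΓ.mem_eq p.1 hp.1⟩

theorem restrict (hΓ : Γ.Reads ι) (P : α → Prop) : (Γ.restrict P).Reads ι :=
  ⟨fun a ha => hΓ.size_eq a ha.1, fun a ha => hΓ.mem_eq a ha.1⟩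

theorem tab (hΓ : Γ.Reads ι) (N : α → ℕ) (hN : Γ.PB N) (u v hu hv) :
    (Γ.tab N hN u v hu hv).Reads fun p => ι p.1 :=
  ⟨fun p hp => hΓ.size_eq p.1 hp.1, fun p hp x hx =>
    (tabMem_of_nonneg hx).trans (hΓ.mem_eq p.1 hp.1 x hx)⟩

theorem tabbed (hΓ : Γ.Reads ι) (N : α → ℕ) (u v hu hv) :
    (Γ.tabbed N u v hu hv).Reads ι :=
  ⟨hΓ.size_eq, fun a ha x hx => (tabMem_of_nonneg hx).trans (hΓ.mem_eq a ha x hx)⟩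

theorem pb (hΓ : Γ.Reads ι) {t : α → ℕ} (c : ℕ) (h : ∀ a, Γ.dom a → t a ≤ (ι a).X ^ c) : Γ.PB t :=
  ⟨c, fun a ha => by rw [hΓ.size_eq a ha]; exact h a ha⟩

theorem pb_n (hΓ : Γ.Reads ι) : Γ.PB fun a => (ι a).n :=
  hΓ.pb 1 fun a _ => by simpa using (ι a).n_le

theorem pb_L (hΓ : Γ.Reads ι) : Γ.PB fun a => (ι a).L :=
  hΓ.pb 1 fun a _ => by simpa using (ι a).L_le

theorem pb_m (hΓ : Γ.Reads ι) : Γ.PB fun a => (ι a).m :=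
  hΓ.pb κ fun a _ => (ι a).m_le.trans (Nat.pow_le_pow_left (ι a).n_le _)

theorem input (hΓ : Γ.Reads ι) (x : ℕ) {z : α → ℤ}
    (hz : ∀ a, Γ.dom a → initMem (ι a).input x = z a) : Comp Γ z :=
  ((Comp.const x).read fun _ _ => .inl (by positivity)).congr fun a ha => by
    rw [hΓ.mem_eq a ha _ (by positivity), hz a ha]

theorem comp_n (hΓ : Γ.Reads ι) : Comp Γ fun a => ((ι a).n : ℤ) :=
  hΓ.input 0 fun a _ => (ι a).initMem_zero

theorem comp_m (hΓ : Γ.Reads ι) : Comp Γ fun a => ((ι a).m : ℤ) :=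
  hΓ.input 1 fun a _ => by simp [initMem, Instance.input, encodeInput, Instance.m]

theorem comp_β (hΓ : Γ.Reads ι) : Comp Γ (fun a => (ι a).β.1.num) ∧
    Comp Γ (fun a => ((ι a).β.1.den : ℤ)) ∧ Comp Γ (fun a => (ι a).β.2.num) ∧
    Comp Γ fun a => ((ι a).β.2.den : ℤ) :=
  ⟨hΓ.input 2 fun a _ => by simp [initMem, Instance.input, encodeInput, encodeRat],
    hΓ.input 3 fun a _ => by simp [initMem, Instance.input, encodeInput, encodeRat],
    hΓ.input 4 fun a _ => by simp [initMem, Instance.input, encodeInput, encodeRat],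
    hΓ.input 5 fun a _ => by simp [initMem, Instance.input, encodeInput, encodeRat]⟩

theorem comp_L (hΓ : Γ.Reads ι) : Comp Γ fun a => ((ι a).L : ℤ) := by
  have h1 : Comp Γ fun a => (ι a).ε.num :=
    hΓ.input 6 fun a _ => by simp [initMem, Instance.input, encodeInput, encodeRat]
  have h2 : Comp Γ fun a => ((ι a).ε.den : ℤ) :=
    hΓ.input 7 fun a _ => by simp [initMem, Instance.input, encodeInput, encodeRat]
  refine Comp.size ((hΓ.comp_n.mul h2).quo h1 |>.congr fun a _ => ?_)
  push_cast
  rw [Int.toNat_of_nonneg (ι a).num_pos.le]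

end Ctx.Reads

end RAM

/-! ### Moments as sums over words of matrix units -/

namespace LocalTerm

variable {n d : ℕ}

/-- The number of times that the site `v` occurs. -/
def mult (T : LocalTerm n d) (v : ℕ) : ℕ :=
  ∑ a ∈ Finset.range T.size, if T.siteNum a = v then 1 else 0

/-- The state of the site `v` in the basis state with number `p`. -/
def digit (T : LocalTerm n d) (p v : ℕ) : ℕ :=
  ∑ a ∈ Finset.range T.size, if T.siteNum a = v then p / d ^ a % d else 0

/-- The effect of the matrix unit in row `p` and column `q` on the state `x` of the site `v`, where
`d` stands for failure. -/
def next (T : LocalTerm n d) (p q v x : ℕ) : ℕ :=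
  if 0 < T.mult v then (if x = T.digit p v then T.digit q v else d) else x

theorem digit_le (T : LocalTerm n d) (hd : 0 < d) (p v : ℕ) : T.digit p v ≤ T.size * d := by
  refine (Finset.sum_le_card_nsmul _ _ d fun a _ => ?_).trans (by simp)
  split_ifs
  · exact (Nat.mod_lt _ hd).le
  · exact Nat.zero_le d

theorem next_le (T : LocalTerm n d) (hd : 0 < d) (p q v x : ℕ) :
    T.next p q v x ≤ x + (T.size * d + d) := by
  have := T.digit_le hd q v
  unfold next
  split_ifs <;> omega

end LocalTerm

namespace Instance

variable {D d κ : ℕ} (I : Instance D d κ)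

/-- The product of the denominators of all matrix entries. -/
def Q : ℕ := ∏ T ∈ Finset.range I.m, ∏ p ∈ Finset.range (d ^ (I.H.term T).size),
  ∏ q ∈ Finset.range (d ^ (I.H.term T).size),
    ((I.H.term T).reEntry p q).den * ((I.H.term T).imEntry p q).den

/-- The local term that belongs to a letter. -/
def letterTerm (l : ℕ) : LocalTerm I.n d := I.H.term (l / (d ^ κ * d ^ κ))

/-- The row that belongs to a letter. -/
def letterRow (_ : Instance D d κ) (l : ℕ) : ℕ := l / d ^ κ % d ^ κ

/-- The column that belongs to a letter. -/
def letterCol (_ : Instance D d κ) (l : ℕ) : ℕ := l % d ^ κ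

/-- The matrix entry that belongs to a letter, multiplied by `Q`. -/
def weight (l : ℕ) : GaussianInt :=
  ⟨((I.letterTerm l).reEntry (I.letterRow l) (I.letterCol l)).num *
      (I.Q / ((I.letterTerm l).reEntry (I.letterRow l) (I.letterCol l)).den : ℕ),
    ((I.letterTerm l).imEntry (I.letterRow l) (I.letterCol l)).num *
      (I.Q / ((I.letterTerm l).imEntry (I.letterRow l) (I.letterCol l)).den : ℕ)⟩

/-- The `i`-th letter of the word with number `w`. -/
def letter (w i : ℕ) : ℕ := w / I.letters ^ i % I.letters

/-- The state of the site `v` after `i` letters of the word with number `w`. -/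
def path (v w s : ℕ) : ℕ → ℕ
  | 0 => s
  | i + 1 => (I.letterTerm (I.letter w i)).next (I.letterRow (I.letter w i))
      (I.letterCol (I.letter w i)) v (path v w s i)

/-- The trace of the product of the matrix units of a word. -/
def closed (w N : ℕ) : ℕ :=
  ∏ v ∈ Finset.range I.n, ∑ s ∈ Finset.range d, if I.path v w s N = s then 1 else 0

/-- The trace of `(Q H) ^ N`. -/
def moment (N : ℕ) : GaussianInt :=
  ∑ w ∈ Finset.range (I.letters ^ N),
    (∏ i ∈ Finset.range N, I.weight (I.letter w i)) * (I.closed w N : GaussianInt)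

theorem size_term_le {T : ℕ} (hT : T < I.m) : (I.H.term T).size ≤ κ :=
  I.size_le _ (I.H.term_mem hT)

theorem pow_size_le {T : ℕ} (hT : T < I.m) : d ^ (I.H.term T).size ≤ d ^ κ :=
  Nat.pow_le_pow_right I.d_pos (I.size_term_le hT)

theorem offset_le {T : ℕ} (hT : T ≤ I.m) :
    I.H.offset T ≤ 8 + T * (1 + κ + 4 * (d ^ κ * d ^ κ)) := by
  induction T with
  | zero => simp [LatticeHamiltonian.offset_zero]
  | succ T ih =>
    have h1 := I.size_term_le hT
    have h2 := Nat.mul_le_mul (I.pow_size_le hT) (I.pow_size_le hT)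
    have := ih (by omega)
    rw [LatticeHamiltonian.offset_succ _ hT, add_mul]
    omega

theorem letter_lt (w i : ℕ) (h : 0 < I.letters) : I.letter w i < I.letters := Nat.mod_lt _ h

theorem div_lt_m {l : ℕ} (h : l < I.letters) : l / (d ^ κ * d ^ κ) < I.m :=
  Nat.div_lt_of_lt_mul (by rwa [mul_comm])

theorem path_le (v w s i : ℕ) (h : 0 < I.letters) : I.path v w s i ≤ s + i * (κ * d + d) := by
  induction i with
  | zero => simp [path]
  | succ i ih =>
    have h1 := (I.letterTerm (I.letter w i)).next_le I.d_pos (I.letterRow (I.letter w i))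
      (I.letterCol (I.letter w i)) v (I.path v w s i)
    have h2 : (I.letterTerm (I.letter w i)).size * d ≤ κ * d :=
      Nat.mul_le_mul_right d (I.size_term_le (I.div_lt_m (I.letter_lt w i h)))
    rw [path, add_mul, one_mul]
    omega

end Instance

/-! ### Computability of the moments -/

namespace RAM.Ctx.Reads

open RAM.Comp

variable {α : Type} {D d κ : ℕ} {Γ : Ctx α} {ι : α → Instance D d κ}

theorem read_term (hΓ : Γ.Reads ι) {T j : α → ℕ} {z : α → ℤ}
    (hc : Comp Γ fun a => (((ι a).H.offset (T a) + j a : ℕ) : ℤ))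
    (hT : ∀ a, Γ.dom a → T a < (ι a).m)
    (hj : ∀ a, Γ.dom a → j a < (encodeTerm ((ι a).H.term (T a))).length)
    (hz : ∀ a, Γ.dom a → (encodeTerm ((ι a).H.term (T a))).getD (j a) 0 = z a) : Comp Γ z :=
  (hc.read fun _ _ => .inl (by positivity)).congr fun a ha => by
    rw [hΓ.mem_eq a ha _ (by positivity), ← hz a ha, Nat.cast_add]
    exact (ι a).H.input_term _ _ (hT a ha) (hj a ha)

theorem pb_of_const (_ : Γ.Reads ι) {t : α → ℕ} (c : ℕ) (h : ∀ a, Γ.dom a → t a ≤ c) : Γ.PB t :=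
  (PB.const c).mono h

/-- Descriptions of terms have different lengths, so they are located by walking through the input:
the size found at one offset determines the next offset. -/
theorem comp_offset (hΓ : Γ.Reads ι) {T : α → ℕ} (hcT : Comp Γ fun a => (T a : ℤ))
    (hT : ∀ a, Γ.dom a → T a ≤ (ι a).m) : Comp Γ fun a => ((ι a).H.offset (T a) : ℤ) := by
  have hN : Γ.PB T := hΓ.pb_m.mono hT
  have hx : ∃ c, ∀ a, Γ.dom a → ∀ i ≤ T a, bits (((ι a).H.offset i : ℕ) : ℤ) ≤ Γ.size a ^ c := by
    obtain ⟨c, hc⟩ := (PB.const 8).add (hΓ.pb_m.mul (.const (1 + κ + 4 * (d ^ κ * d ^ κ))))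
    refine ⟨c, fun a ha i hi => ((bits_natCast_le _).trans
      ((ι a).offset_le (hi.trans (hT a ha)))).trans (le_trans ?_ (hc a ha))⟩
    exact Nat.add_le_add_left (Nat.mul_le_mul_right _ (hi.trans (hT a ha))) _
  refine fold hN (x := fun a i => ((ι a).H.offset i : ℤ)) hx hcT
    ((const 8).congr fun a _ => by simp [LatticeHamiltonian.offset_zero]) ?_
  have hL := hΓ.loop T hN (fun a i => ((ι a).H.offset i : ℤ)) (fun _ _ => 0) hx ⟨0, by simp⟩
  have hlt : ∀ p, (Γ.loop T hN (fun a i => ((ι a).H.offset i : ℤ)) (fun _ _ => 0) hx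
      ⟨0, by simp⟩).dom p → p.2 < (ι p.1).m := fun p hp => hp.2.trans_le (hT p.1 hp.1)
  have hs := hL.read_term (T := Prod.snd) (j := fun _ => 0)
    (z := fun p => (((ι p.1).H.term p.2).size : ℤ)) loop_fst hlt
    (fun p _ => by rw [LocalTerm.length_encodeTerm]; omega) fun p _ => LocalTerm.encodeTerm_zero _
  have hd := natPow (natConst d) (hL.pb_of_const κ fun p hp =>
    (ι p.1).size_term_le (hlt p hp)) hs
  exact (loop_fst.add (((const 1).add hs).add ((const 4).mul (natMul hd hd)))).congr
    fun p hp => by rw [LatticeHamiltonian.offset_succ _ (hlt p hp)]; push_cast; ring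

section

variable {T : α → ℕ}

theorem comp_size (hΓ : Γ.Reads ι) (hcT : Comp Γ fun a => (T a : ℤ))
    (hT : ∀ a, Γ.dom a → T a < (ι a).m) : Comp Γ fun a => (((ι a).H.term (T a)).size : ℤ) :=
  hΓ.read_term (j := fun _ => 0) (hΓ.comp_offset hcT fun a ha => (hT a ha).le) hT
    (fun a _ => by rw [LocalTerm.length_encodeTerm]; omega) fun a _ => LocalTerm.encodeTerm_zero _

theorem pb_size (hΓ : Γ.Reads ι) (hT : ∀ a, Γ.dom a → T a < (ι a).m) :
    Γ.PB fun a => ((ι a).H.term (T a)).size :=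
  hΓ.pb_of_const κ fun a ha => (ι a).size_term_le (hT a ha)

theorem comp_pow_size (hΓ : Γ.Reads ι) (hcT : Comp Γ fun a => (T a : ℤ))
    (hT : ∀ a, Γ.dom a → T a < (ι a).m) :
    Comp Γ fun a => ((d ^ ((ι a).H.term (T a)).size : ℕ) : ℤ) :=
  natPow (natConst d) (hΓ.pb_size hT) (hΓ.comp_size hcT hT)

theorem pb_pow_size (hΓ : Γ.Reads ι) (hT : ∀ a, Γ.dom a → T a < (ι a).m) :
    Γ.PB fun a => d ^ ((ι a).H.term (T a)).size :=
  hΓ.pb_of_const (d ^ κ) fun a ha => (ι a).pow_size_le (hT a ha)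

theorem comp_siteNum (hΓ : Γ.Reads ι) (hcT : Comp Γ fun a => (T a : ℤ))
    (hT : ∀ a, Γ.dom a → T a < (ι a).m) {i : α → ℕ} (hci : Comp Γ fun a => (i a : ℤ))
    (hi : ∀ a, Γ.dom a → i a < ((ι a).H.term (T a)).size) :
    Comp Γ fun a => (((ι a).H.term (T a)).siteNum (i a) : ℤ) :=
  hΓ.read_term (j := fun a => 1 + i a)
    (natAdd (hΓ.comp_offset hcT fun a ha => (hT a ha).le) (natAdd (natConst 1) hci)) hT
    (fun a ha => by rw [LocalTerm.length_encodeTerm]; have := hi a ha; omega)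
    fun a ha => LocalTerm.encodeTerm_site _ (hi a ha)

/-- The index `j` selects one of the four integers that encode an entry. The default `z` is for rows
and columns outside of the matrix: `comp_entry` takes 0 for numerators and 1 for denominators, the
representation of the rational number 0. -/
theorem comp_entry_aux (hΓ : Γ.Reads ι) (hcT : Comp Γ fun a => (T a : ℤ))
    (hT : ∀ a, Γ.dom a → T a < (ι a).m) {p q : α → ℕ} (hcp : Comp Γ fun a => (p a : ℤ))
    (hcq : Comp Γ fun a => (q a : ℤ)) (z : ℤ) {j : ℕ} (hj : j < 4) :
    Comp Γ fun a => if p a < d ^ ((ι a).H.term (T a)).size then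
      if q a < d ^ ((ι a).H.term (T a)).size then
        [(((ι a).H.term (T a)).reEntry (p a) (q a)).num,
          ((((ι a).H.term (T a)).reEntry (p a) (q a)).den : ℤ),
          (((ι a).H.term (T a)).imEntry (p a) (q a)).num,
          ((((ι a).H.term (T a)).imEntry (p a) (q a)).den : ℤ)].getD j 0 else z else z := by
  have hs := hΓ.comp_size hcT hT
  have hd := hΓ.comp_pow_size hcT hT
  have hdd := (hd.sub hcq).restrict fun a => p a < d ^ ((ι a).H.term (T a)).size
  refine ite (hd.sub hcp) (fun a _ => by omega) (ite hdd (fun a _ => by omega)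
    ?_ (const z)) (const z)
  have hΓ' := (hΓ.restrict fun a => p a < d ^ ((ι a).H.term (T a)).size).restrict
    fun a => q a < d ^ ((ι a).H.term (T a)).size
  refine hΓ'.read_term (T := T) (j := fun a => 1 + ((ι a).H.term (T a)).size +
    (4 * (p a * d ^ ((ι a).H.term (T a)).size + q a) + j)) ((Comp.restrict (Comp.restrict
      (natAdd (hΓ.comp_offset hcT fun a ha => (hT a ha).le) (natAdd (natAdd (natConst 1) hs)
        (natAdd (natMul (natConst 4) (natAdd (natMul hcp hd) hcq)) (natConst j)))) _) _))
    (fun a ha => hT a ha.1.1) (fun a ha => ?_)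
    fun a ha => LocalTerm.encodeTerm_entry _ ha.1.2 ha.2 hj
  rw [LocalTerm.length_encodeTerm]
  have h1 : p a < d ^ ((ι a).H.term (T a)).size := ha.1.2
  have h2 : q a < d ^ ((ι a).H.term (T a)).size := ha.2
  have : p a * d ^ ((ι a).H.term (T a)).size + q a <
      d ^ ((ι a).H.term (T a)).size * d ^ ((ι a).H.term (T a)).size := by nlinarith
  omega

theorem comp_entry (hΓ : Γ.Reads ι) (hcT : Comp Γ fun a => (T a : ℤ))
    (hT : ∀ a, Γ.dom a → T a < (ι a).m) {p q : α → ℕ} (hcp : Comp Γ fun a => (p a : ℤ))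
    (hcq : Comp Γ fun a => (q a : ℤ)) :
    Comp Γ (fun a => (((ι a).H.term (T a)).reEntry (p a) (q a)).num) ∧
    Comp Γ (fun a => ((((ι a).H.term (T a)).reEntry (p a) (q a)).den : ℤ)) ∧
    Comp Γ (fun a => (((ι a).H.term (T a)).imEntry (p a) (q a)).num) ∧
    Comp Γ (fun a => ((((ι a).H.term (T a)).imEntry (p a) (q a)).den : ℤ)) := by
  refine ⟨(hΓ.comp_entry_aux hcT hT hcp hcq 0 (j := 0) (by norm_num)).congr fun a _ => ?_,
    (hΓ.comp_entry_aux hcT hT hcp hcq 1 (j := 1) (by norm_num)).congr fun a _ => ?_,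
    (hΓ.comp_entry_aux hcT hT hcp hcq 0 (j := 2) (by norm_num)).congr fun a _ => ?_,
    (hΓ.comp_entry_aux hcT hT hcp hcq 1 (j := 3) (by norm_num)).congr fun a _ => ?_⟩ <;>
  · split_ifs with h1 h2
    · simp
    · simp [LocalTerm.reEntry, LocalTerm.imEntry, h2]
    · simp [LocalTerm.reEntry, LocalTerm.imEntry, h1]

theorem comp_mult (hΓ : Γ.Reads ι) (hcT : Comp Γ fun a => (T a : ℤ))
    (hT : ∀ a, Γ.dom a → T a < (ι a).m) {v : α → ℕ} (hcv : Comp Γ fun a => (v a : ℤ)) :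
    Comp Γ fun a => (((ι a).H.term (T a)).mult (v a) : ℤ) := by
  have hN := hΓ.pb_size hT
  have hlt : ∀ p, (Γ.push _ hN).dom p → p.2 < ((ι p.1).H.term (T p.1)).size :=
    fun p hp => hp.2
  have hs := (hΓ.push _ hN).comp_siteNum (T := fun p => T p.1) (i := fun p => p.2)
    (hcT.push _ _) (fun p hp => hT p.1 hp.1) last
  replace hs := hs hlt
  have hG : Comp (Γ.push _ hN) fun p =>
      ((if ((ι p.1).H.term (T p.1)).siteNum p.2 = v p.1 then 1 else 0 : ℕ) : ℤ) :=
    natIteEq (F := fun _ => 1) (G := fun _ => 0) hs (hcv.push _ _) (natConst 1) (natConst 0)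
  simp only [LocalTerm.mult]
  exact natSum (G := fun a i => if ((ι a).H.term (T a)).siteNum i = v a then 1 else 0) hN
    (hΓ.comp_size hcT hT) hG

theorem comp_digit (hΓ : Γ.Reads ι) (hcT : Comp Γ fun a => (T a : ℤ))
    (hT : ∀ a, Γ.dom a → T a < (ι a).m) {p v : α → ℕ} (hcp : Comp Γ fun a => (p a : ℤ))
    (hcv : Comp Γ fun a => (v a : ℤ)) :
    Comp Γ fun a => (((ι a).H.term (T a)).digit (p a) (v a) : ℤ) := by
  have hN := hΓ.pb_size hT
  have hlt : ∀ p, (Γ.push _ hN).dom p → p.2 < ((ι p.1).H.term (T p.1)).size :=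
    fun p hp => hp.2
  have hs := (hΓ.push _ hN).comp_siteNum (T := fun p => T p.1) (i := fun p => p.2)
    (hcT.push _ _) (fun p hp => hT p.1 hp.1) last
  replace hs := hs hlt
  have hpow : Comp (Γ.push _ hN) fun p => ((d ^ p.2 : ℕ) : ℤ) :=
    natPow (natConst d) ((hΓ.push _ hN).pb_of_const κ fun p hp =>
      hp.2.le.trans ((ι p.1).size_term_le (hT p.1 hp.1))) last
  have hG : Comp (Γ.push _ hN) fun r => ((if ((ι r.1).H.term (T r.1)).siteNum r.2 = v r.1 then
      p r.1 / d ^ r.2 % d else 0 : ℕ) : ℤ) :=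
    natIteEq (G := fun _ => 0) hs (hcv.push _ _)
      (natMod (natDiv (hcp.push _ _) hpow) (natConst d)) (natConst 0)
  simp only [LocalTerm.digit]
  exact natSum (G := fun a i => if ((ι a).H.term (T a)).siteNum i = v a then
    p a / d ^ i % d else 0) hN (hΓ.comp_size hcT hT) hG

theorem comp_next (hΓ : Γ.Reads ι) (hcT : Comp Γ fun a => (T a : ℤ))
    (hT : ∀ a, Γ.dom a → T a < (ι a).m) {p q v x : α → ℕ} (hcp : Comp Γ fun a => (p a : ℤ))
    (hcq : Comp Γ fun a => (q a : ℤ)) (hcv : Comp Γ fun a => (v a : ℤ))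
    (hcx : Comp Γ fun a => (x a : ℤ)) :
    Comp Γ fun a => (((ι a).H.term (T a)).next (p a) (q a) (v a) (x a) : ℤ) :=
  natIteLt (natConst 0) (hΓ.comp_mult hcT hT hcv)
    ((natIteEq hcx (hΓ.comp_digit hcT hT hcp hcv) (hΓ.comp_digit hcT hT hcq hcv)
      (natConst d)).restrict _) (hcx.restrict _)

end

theorem comp_Q (hΓ : Γ.Reads ι) : Comp Γ fun a => ((ι a).Q : ℤ) := by
  have hm := hΓ.pb_m
  have h1 := hΓ.push _ hm
  have d1 : ∀ p, (Γ.push _ hm).dom p → p.2 < (ι p.1).m := fun p hp => hp.2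
  have c1 := h1.comp_pow_size (T := Prod.snd) last d1
  have b1 := h1.pb_pow_size (T := Prod.snd) d1
  have h2 := h1.push _ b1
  have c2 := c1.push _ b1
  have b2 := h2.pb_pow_size (T := fun p => p.1.2) fun p hp => d1 p.1 hp.1
  have h3 := h2.push _ b2
  obtain ⟨-, e1, -, e2⟩ := h3.comp_entry (T := fun p => p.1.1.2) (p := fun p => p.1.2)
    (q := fun p => p.2) ((last.push _ _).push _ _) (fun p hp => d1 p.1.1 hp.1.1)
    (last.push _ _) last
  exact natProd hm hΓ.comp_m (natProd b1 c1 (natProd b2 c2 (natMul e1 e2)))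

theorem comp_letters (hΓ : Γ.Reads ι) : Comp Γ fun a => ((ι a).letters : ℤ) :=
  natMul hΓ.comp_m (natConst _)

theorem comp_weight (hΓ : Γ.Reads ι) {l : α → ℕ} (hcl : Comp Γ fun a => (l a : ℤ))
    (hl : ∀ a, Γ.dom a → l a < (ι a).letters) : CompG Γ fun a => (ι a).weight (l a) := by
  obtain ⟨e1, e2, e3, e4⟩ := hΓ.comp_entry (natDiv hcl (natConst (d ^ κ * d ^ κ)))
    (fun a ha => (ι a).div_lt_m (hl a ha))
    (natMod (natDiv hcl (natConst (d ^ κ))) (natConst (d ^ κ))) (natMod hcl (natConst (d ^ κ)))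
  exact ⟨e1.mul (natDiv hΓ.comp_Q e2), e3.mul (natDiv hΓ.comp_Q e4)⟩

section

variable {k₀ : ℕ} {N : α → ℕ}

theorem pb_of_le_L (hΓ : Γ.Reads ι) (hN : ∀ a, Γ.dom a → N a ≤ k₀ * (ι a).L) : Γ.PB N :=
  ((PB.const k₀).mul hΓ.pb_L).mono hN

theorem pb_letters_pow (hΓ : Γ.Reads ι) (hN : ∀ a, Γ.dom a → N a ≤ k₀ * (ι a).L) :
    Γ.PB fun a => (ι a).letters ^ N a :=
  hΓ.pb _ fun a ha => (ι a).letters_pow_le (hN a ha)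

theorem comp_letters_pow (hΓ : Γ.Reads ι) (hcN : Comp Γ fun a => (N a : ℤ))
    (hN : ∀ a, Γ.dom a → N a ≤ k₀ * (ι a).L) :
    Comp Γ fun a => (((ι a).letters ^ N a : ℕ) : ℤ) :=
  natPow hΓ.comp_letters (hΓ.pb_of_le_L hN) hcN

theorem comp_letter (hΓ : Γ.Reads ι) {w : α → ℕ} (hcw : Comp Γ fun a => (w a : ℤ))
    (hcN : Comp Γ fun a => (N a : ℤ)) (hN : ∀ a, Γ.dom a → N a ≤ k₀ * (ι a).L) :
    Comp Γ fun a => ((ι a).letter (w a) (N a) : ℤ) :=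
  natMod (natDiv hcw (hΓ.comp_letters_pow hcN hN)) hΓ.comp_letters

theorem comp_path (hΓ : Γ.Reads ι) {v w s : α → ℕ} (hcv : Comp Γ fun a => (v a : ℤ))
    (hcw : Comp Γ fun a => (w a : ℤ)) (hcs : Comp Γ fun a => (s a : ℤ))
    (hs : ∀ a, Γ.dom a → s a < d) (hcN : Comp Γ fun a => (N a : ℤ))
    (hN : ∀ a, Γ.dom a → N a ≤ k₀ * (ι a).L)
    (hpos : ∀ a, Γ.dom a → 0 < (ι a).letters) :
    Comp Γ fun a => ((ι a).path (v a) (w a) (s a) (N a) : ℤ) := by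
  have hN' := hΓ.pb_of_le_L hN
  have hx : ∃ c, ∀ a, Γ.dom a → ∀ i ≤ N a,
      bits (((ι a).path (v a) (w a) (s a) i : ℕ) : ℤ) ≤ Γ.size a ^ c := by
    obtain ⟨c, hc⟩ := (PB.const d).add (hN'.mul (.const (κ * d + d)))
    refine ⟨c, fun a ha i hi => ((bits_natCast_le _).trans
      ((ι a).path_le _ _ _ _ (hpos a ha))).trans (le_trans ?_ (hc a ha))⟩
    exact Nat.add_le_add (hs a ha).le (Nat.mul_le_mul_right _ hi)
  refine fold hN' (x := fun a i => ((ι a).path (v a) (w a) (s a) i : ℤ)) hx hcN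
    (hcs.congr fun a _ => by rw [Instance.path]) ?_
  have hL := hΓ.loop N hN' (fun a i => ((ι a).path (v a) (w a) (s a) i : ℤ)) (fun _ _ => 0) hx
    ⟨0, by simp⟩
  have hl := hL.comp_letter (w := fun p => w p.1) (N := fun p => p.2) (k₀ := k₀)
    (hcw.push N hN').loop last.loop fun p hp => hp.2.le.trans (hN p.1 hp.1)
  exact (hL.comp_next (natDiv hl (natConst (d ^ κ * d ^ κ)))
    (fun p hp => (ι p.1).div_lt_m ((ι p.1).letter_lt _ _ (hpos p.1 hp.1)))
    (natMod (natDiv hl (natConst (d ^ κ))) (natConst (d ^ κ))) (natMod hl (natConst (d ^ κ)))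
    (hcv.push N hN').loop loop_fst).congr fun p _ => by rw [Instance.path]; rfl

theorem comp_closed (hΓ : Γ.Reads ι) {w : α → ℕ} (hcw : Comp Γ fun a => (w a : ℤ))
    (hcN : Comp Γ fun a => (N a : ℤ)) (hN : ∀ a, Γ.dom a → N a ≤ k₀ * (ι a).L)
    (hpos : ∀ a, Γ.dom a → 0 < (ι a).letters) : Comp Γ fun a => ((ι a).closed (w a) (N a) : ℤ) := by
  have h1 := hΓ.push _ hΓ.pb_n
  have hd : (Γ.push _ hΓ.pb_n).PB fun _ => d := .const d
  have h2 := h1.push _ hd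
  refine natProd hΓ.pb_n hΓ.comp_n (natSum hd (natConst d) (natIteEq ?_ last (natConst 1)
    (natConst 0)))
  exact h2.comp_path (v := fun p => p.1.2) (w := fun p => w p.1.1) (s := fun p => p.2)
    (N := fun p => N p.1.1) (k₀ := k₀) (last.push _ _) ((hcw.push _ _).push _ _) last
    (fun p hp => hp.2) ((hcN.push _ _).push _ _) (fun p hp => hN p.1.1 hp.1.1)
    fun p hp => hpos p.1.1 hp.1.1

theorem comp_moment (hΓ : Γ.Reads ι) (hcN : Comp Γ fun a => (N a : ℤ))
    (hN : ∀ a, Γ.dom a → 0 < N a ∧ N a ≤ k₀ * (ι a).L) :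
    CompG Γ fun a => (ι a).moment (N a) := by
  have hb := hΓ.pb_letters_pow fun a ha => (hN a ha).2
  have h1 := hΓ.push _ hb
  -- An empty alphabet has no words of positive length, so inside the sum there is a letter. Here `0
  -- < N` is indispensable.
  have hpos : ∀ p, (Γ.push _ hb).dom p → 0 < (ι p.1).letters := fun p hp =>
    Nat.pos_of_ne_zero fun h0 => by
      have h2 : p.2 < (ι p.1).letters ^ N p.1 := hp.2
      rw [h0, zero_pow (hN p.1 hp.1).1.ne'] at h2
      omega
  have hN1 : ∀ p, (Γ.push _ hb).dom p → N p.1 ≤ k₀ * (ι p.1).L := fun p hp => (hN p.1 hp.1).2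
  have hb2 := h1.pb_of_le_L hN1
  have h2 := h1.push _ hb2
  refine CompG.sum hb (hΓ.comp_letters_pow hcN fun a ha => (hN a ha).2) (CompG.mul
    (CompG.prod hb2 (hcN.push _ _) (h2.comp_weight ?_ fun p hp =>
      (ι p.1.1).letter_lt _ _ (hpos p.1 hp.1))) (CompG.ofNat
        (h1.comp_closed last (hcN.push _ _) hN1 hpos)))
  exact h2.comp_letter (w := fun p => p.1.2) (N := fun p => p.2) (k₀ := k₀) (last.push _ _) last
    fun p hp => hp.2.le.trans (hN1 p.1 hp.1)

end

end RAM.Ctx.Reads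

/-! ### Common denominators and the fraction that is put out -/

namespace Instance

variable {D d κ : ℕ} (I : Instance D d κ)

/-- The inverse temperature multiplied by its denominators. -/
def zeta : GaussianInt := ⟨I.β.1.num * I.β.2.den, I.β.2.num * I.β.1.den⟩

/-- The normalized moments of `-β H`, brought to a common denominator. -/
def scaledMoment (k N : ℕ) : GaussianInt :=
  if 0 < N then (-I.zeta) ^ N * I.moment N *
    ((d ^ (I.n * (N - 1)) * (k.factorial ^ N / N.factorial) : ℕ) : GaussianInt) else 0

/-- The base of the denominators of the scaled moments. -/
def base (k : ℕ) : ℕ := k.factorial * (I.Q * (I.β.1.den * I.β.2.den)) * d ^ I.n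

/-- The scaled coefficients of the logarithmic derivative of the partition function. -/
def logCoeff (k j : ℕ) : GaussianInt :=
  j * I.scaledMoment k j - ∑ i : Fin j, logCoeff k i * I.scaledMoment k (j - i)
termination_by j

theorem logCoeff_eq (k j : ℕ) : I.logCoeff k j = j * I.scaledMoment k j -
    ∑ i ∈ Finset.range j, I.logCoeff k i * I.scaledMoment k (j - i) := by
  rw [logCoeff, Finset.sum_range]

/-- The numerator of the truncated logarithm. -/
def logNum (k : ℕ) : GaussianInt := ∑ i ∈ Finset.range k,
  I.logCoeff k (i + 1) * ((I.base k ^ (k - (i + 1)) * (k.factorial / (i + 1)) : ℕ) : GaussianInt)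

/-- The denominator of the truncated logarithm. -/
def logDen (k : ℕ) : ℕ := I.base k ^ k * k.factorial

/-- The numerator of the approximation of the partition function. -/
def outNum (k M : ℕ) : GaussianInt := (d ^ I.n : ℕ) * ∑ N ∈ Finset.range M,
  I.logNum k ^ N * ((I.logDen k ^ (M - N) * (M.factorial / N.factorial) : ℕ) : GaussianInt)

/-- The denominator of the approximation of the partition function. -/
def outDen (k M : ℕ) : ℕ := I.logDen k ^ M * M.factorial

end Instance

/-! ### Bit lengths in Newton's recurrence and the complete program -/

namespace RAM

theorem natAbs_gsum_le (s : Finset ℕ) (f : ℕ → GaussianInt) :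
    (∑ i ∈ s, f i).re.natAbs + (∑ i ∈ s, f i).im.natAbs ≤
      ∑ i ∈ s, ((f i).re.natAbs + (f i).im.natAbs) := by
  induction s using Finset.cons_induction with
  | empty => simp
  | cons a s ha ih =>
    rw [Finset.sum_cons, Finset.sum_cons, Zsqrtd.re_add, Zsqrtd.im_add]
    have := Int.natAbs_add_le (f a).re (∑ i ∈ s, f i).re
    have := Int.natAbs_add_le (f a).im (∑ i ∈ s, f i).im
    omega

/-- Strong induction with `K = 2 * (k + 1) * G`: in the step to `j + 1` the leading term and the sum
contribute at most `(k + 1) * G * K ^ j` each. So the values grow geometrically and their bit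
lengths only linearly in `j`. -/
theorem natAbs_recurrence_le {A B : ℕ → GaussianInt} {k G : ℕ} (hG : 0 < G)
    (hA : ∀ j ≤ k, (A j).re.natAbs + (A j).im.natAbs ≤ G)
    (hB : ∀ j, B j = j * A j - ∑ i ∈ Finset.range j, B i * A (j - i)) (j : ℕ) (hj : j ≤ k) :
    (B j).re.natAbs + (B j).im.natAbs ≤ (2 * (k + 1) * G) ^ j := by
  induction j using Nat.strong_induction_on with
  | _ j ih =>
    rcases j with _ | j
    · simp [hB 0]
    have hK : 0 < 2 * (k + 1) * G := by positivity
    have h1 : ∀ z w : GaussianInt, (z - w).re.natAbs + (z - w).im.natAbs ≤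
        (z.re.natAbs + z.im.natAbs) + (w.re.natAbs + w.im.natAbs) := fun z w => by
      rw [Zsqrtd.re_sub, Zsqrtd.im_sub]; omega
    have h2 : ((((j + 1 : ℕ) : GaussianInt)) * A (j + 1)).re.natAbs +
        (((j + 1 : ℕ) : GaussianInt) * A (j + 1)).im.natAbs ≤
        (k + 1) * G * (2 * (k + 1) * G) ^ j := by
      refine (natAbs_add_natAbs_mul_le _ _).trans ?_
      have : (((j + 1 : ℕ) : GaussianInt)).re.natAbs + (((j + 1 : ℕ) : GaussianInt)).im.natAbs ≤
          k + 1 := by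
        rw [Zsqrtd.re_natCast, Zsqrtd.im_natCast]; omega
      exact (Nat.mul_le_mul this (hA _ hj)).trans (Nat.le_mul_of_pos_right _ (pow_pos hK j))
    have h3 : (∑ i ∈ Finset.range (j + 1), B i * A (j + 1 - i)).re.natAbs +
        (∑ i ∈ Finset.range (j + 1), B i * A (j + 1 - i)).im.natAbs ≤
        (k + 1) * G * (2 * (k + 1) * G) ^ j := by
      refine (natAbs_gsum_le _ _).trans ((Finset.sum_le_card_nsmul _ _
        (G * (2 * (k + 1) * G) ^ j) fun i hi => ?_).trans ?_)
      · rw [Finset.mem_range] at hi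
        refine (natAbs_add_natAbs_mul_le _ _).trans ?_
        rw [mul_comm G]
        exact Nat.mul_le_mul ((ih i hi (by omega)).trans
          (Nat.pow_le_pow_right hK (by omega))) (hA _ (by omega))
      · rw [Finset.card_range, smul_eq_mul, mul_assoc (k + 1)]
        exact Nat.mul_le_mul_right _ (by omega)
    rw [hB]
    calc _ ≤ _ := (h1 _ _).trans (Nat.add_le_add h2 h3)
      _ = _ := by ring

theorem bits_recurrence_le {A B : ℕ → GaussianInt} {k b : ℕ}
    (hA : ∀ j ≤ k, bits (A j).re ≤ b ∧ bits (A j).im ≤ b)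
    (hB : ∀ j, B j = j * A j - ∑ i ∈ Finset.range j, B i * A (j - i)) (j : ℕ) (hj : j ≤ k) :
    bits (B j).re ≤ (k + 2 + b + 1) * k + 1 ∧ bits (B j).im ≤ (k + 2 + b + 1) * k + 1 := by
  have h := natAbs_recurrence_le (G := 2 ^ (b + 1)) (by positivity) (fun i hi => by
    have := hA i hi
    rw [bits_le, bits_le] at this
    rw [pow_succ]
    omega) hB j hj
  have h1 : 2 * (k + 1) ≤ 2 ^ (k + 2) := by
    have : k + 1 < 2 ^ (k + 1) := Nat.lt_two_pow_self
    rw [pow_succ]; omega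
  have h2 : (2 * (k + 1) * 2 ^ (b + 1)) ^ j ≤ 2 ^ ((k + 2 + b + 1) * k) := by
    rw [add_assoc _ b, pow_mul, pow_add _ (k + 2)]
    have h4 : 0 < 2 ^ (k + 2) * 2 ^ (b + 1) := by positivity
    exact (Nat.pow_le_pow_left (Nat.mul_le_mul_right _ h1) j).trans (Nat.pow_le_pow_right h4 hj)
  have h3 : 2 ^ ((k + 2 + b + 1) * k) < 2 ^ ((k + 2 + b + 1) * k + 1) :=
    Nat.pow_lt_pow_right (by norm_num) (Nat.lt_succ_self _)
  rw [bits_le, bits_le]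
  omega

theorem CompG.natIteLt {α : Type} {Γ : Ctx α} {A B : α → ℕ} {F G : α → GaussianInt}
    (hA : Comp Γ fun a => (A a : ℤ)) (hB : Comp Γ fun a => (B a : ℤ))
    (hF : CompG (Γ.restrict fun a => A a < B a) F) (hG : CompG Γ G) :
    CompG Γ fun a => if A a < B a then F a else G a :=
  ⟨(Comp.ite (P := fun a => A a < B a) (hB.sub hA) (fun _ _ => by omega) hF.1
      (hG.1.restrict _)).congr fun _ _ => by beta_reduce; split_ifs <;> rfl,
    (Comp.ite (P := fun a => A a < B a) (hB.sub hA) (fun _ _ => by omega) hF.2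
      (hG.2.restrict _)).congr fun _ _ => by beta_reduce; split_ifs <;> rfl⟩

namespace Ctx.Reads

open RAM.Comp

variable {α : Type} {D d κ : ℕ} {Γ : Ctx α} {ι : α → Instance D d κ} (k₀ M₀ : ℕ)

theorem pb_k (hΓ : Γ.Reads ι) : Γ.PB fun a => k₀ * (ι a).L := (PB.const k₀).mul hΓ.pb_L

theorem comp_k (hΓ : Γ.Reads ι) : Comp Γ fun a => ((k₀ * (ι a).L : ℕ) : ℤ) :=
  natMul (natConst k₀) hΓ.comp_L

theorem comp_pow_n (hΓ : Γ.Reads ι) : Comp Γ fun a => ((d ^ (ι a).n : ℕ) : ℤ) :=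
  natPow (natConst d) hΓ.pb_n hΓ.comp_n

theorem comp_base (hΓ : Γ.Reads ι) : Comp Γ fun a => (((ι a).base (k₀ * (ι a).L) : ℕ) : ℤ) :=
  natMul (natMul (natFactorial (hΓ.pb_k k₀) (hΓ.comp_k k₀)) (natMul hΓ.comp_Q
    (natMul hΓ.comp_β.2.1 hΓ.comp_β.2.2.2))) hΓ.comp_pow_n

theorem comp_scaledMoment (hΓ : Γ.Reads ι) {N : α → ℕ} (hcN : Comp Γ fun a => (N a : ℤ))
    (hN : ∀ a, Γ.dom a → N a ≤ k₀ * (ι a).L) :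
    CompG Γ fun a => (ι a).scaledMoment (k₀ * (ι a).L) (N a) := by
  have hΓ' := hΓ.restrict fun a => 0 < N a
  have hp := hΓ'.pb_of_le_L (k₀ := k₀) fun a ha => hN a ha.1
  have hcN' : Comp (Γ.restrict fun a => 0 < N a) fun a => (N a : ℤ) := hcN.restrict _
  have hz : CompG (Γ.restrict fun a => 0 < N a) fun a => (ι a).zeta :=
    ⟨hΓ'.comp_β.1.mul hΓ'.comp_β.2.2.2, hΓ'.comp_β.2.2.1.mul hΓ'.comp_β.2.1⟩
  have hm := hΓ'.comp_moment (k₀ := k₀) hcN' fun a ha => ⟨ha.2, hN a ha.1⟩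
  have he : Comp (Γ.restrict fun a => 0 < N a) fun a => (((ι a).n * (N a - 1) : ℕ) : ℤ) :=
    natMul hΓ'.comp_n (natSub hcN' (natConst 1))
  have hep : (Γ.restrict fun a => 0 < N a).PB fun a => (ι a).n * (N a - 1) :=
    (hΓ'.pb_n.mul hp).mono fun a _ => Nat.mul_le_mul_left _ (Nat.sub_le _ _)
  have hf := natDiv (natPow (natFactorial (hΓ'.pb_k k₀) (hΓ'.comp_k k₀)) hp hcN')
    (natFactorial hp hcN')
  exact CompG.natIteLt (A := fun _ => 0) (natConst 0) hcN
    (((hz.neg.pow hp hcN').mul hm).mul (CompG.ofNat (natMul (natPow (natConst d) hep he) hf)))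
    (CompG.ofInt (const 0) |>.congr fun _ _ => by simp)

/-- A tabulated sequence may be read. -/
theorem comp_table {u : α → ℕ → ℤ} {v : α → ℕ → ℤ} {K j : α → ℕ}
    (hmem : ∀ a, Γ.dom a → ∃ m, Γ.mem a = tabMem m (u a) (v a) (K a))
    (hcj : Comp Γ fun a => (j a : ℤ)) (hj : ∀ a, Γ.dom a → j a < K a) :
    Comp Γ (fun a => u a (j a)) ∧ Comp Γ fun a => v a (j a) := by
  refine ⟨(((const 4).mul hcj).add (const 1)).neg.read (fun a _ => .inr (by omega)) |>.congr
      fun a ha => ?_, (((const 4).mul hcj).add (const 3)).neg.read (fun a _ => .inr (by omega))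
      |>.congr fun a ha => ?_⟩
  · obtain ⟨m, hm⟩ := hmem a ha
    rw [hm, tabMem_fst (hj a ha)]
  · obtain ⟨m, hm⟩ := hmem a ha
    rw [hm, tabMem_snd (hj a ha)]

/-- The real parts of the coefficients that are tabulated. -/
def tableRe (k₀ : ℕ) (ι : α → Instance D d κ) (a : α) (j : ℕ) : ℤ :=
  ((ι a).logCoeff (k₀ * (ι a).L) j).re

/-- The imaginary parts of the coefficients that are tabulated. -/
def tableIm (k₀ : ℕ) (ι : α → Instance D d κ) (a : α) (j : ℕ) : ℤ :=
  ((ι a).logCoeff (k₀ * (ι a).L) j).im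

theorem pb_succ_k (hΓ : Γ.Reads ι) : Γ.PB fun a => k₀ * (ι a).L + 1 := (hΓ.pb_k k₀).add (.const 1)

/-- Needed before the table can be built, because `tab` and `tabbed` demand length bounds for all
entries. The bounds follow from the recurrence and the lengths of the scaled moments alone. -/
theorem bits_table_le (hΓ : Γ.Reads ι) : ∃ c, ∀ a, Γ.dom a → ∀ j < k₀ * (ι a).L + 1,
    bits (tableRe k₀ ι a j) ≤ Γ.size a ^ c ∧ bits (tableIm k₀ ι a j) ≤ Γ.size a ^ c := by
  obtain ⟨⟨c₁, h₁⟩, c₂, h₂⟩ :=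
    And.intro ((hΓ.push _ (hΓ.pb_succ_k k₀)).comp_scaledMoment k₀ (N := Prod.snd) last
      fun p hp => Nat.lt_succ_iff.1 hp.2).1.1
    ((hΓ.push _ (hΓ.pb_succ_k k₀)).comp_scaledMoment k₀ (N := Prod.snd) last
      fun p hp => Nat.lt_succ_iff.1 hp.2).2.1
  obtain ⟨c, hc⟩ := ((((hΓ.pb_k k₀).add (.const 2)).add ((PB.size.pow c₁).add
    (PB.size.pow c₂))).add (.const 1)).mul (hΓ.pb_k k₀) |>.add (.const 1)
  refine ⟨c, fun a ha j hj => ?_⟩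
  obtain ⟨h3, h4⟩ := bits_recurrence_le (A := (ι a).scaledMoment (k₀ * (ι a).L))
    (B := (ι a).logCoeff (k₀ * (ι a).L)) (k := k₀ * (ι a).L)
    (b := Γ.size a ^ c₁ + Γ.size a ^ c₂) (fun i hi =>
      ⟨(h₁ (a, i) ⟨ha, Nat.lt_succ_iff.2 hi⟩).trans (Nat.le_add_right _ _),
        (h₂ (a, i) ⟨ha, Nat.lt_succ_iff.2 hi⟩).trans (Nat.le_add_left _ _)⟩)
    ((ι a).logCoeff_eq _) j (Nat.lt_succ_iff.1 hj)
  exact ⟨h3.trans (hc a ha), h4.trans (hc a ha)⟩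

/-- Course-of-values recursion: entry `j` is computed while all earlier entries can be read from the
table, so no coefficient is ever recomputed. -/
theorem comp_logCoeff_step (hΓ : Γ.Reads ι) (hu hv) :
    CompG (Γ.tab (fun a => k₀ * (ι a).L + 1) (hΓ.pb_succ_k k₀) (tableRe k₀ ι) (tableIm k₀ ι) hu hv)
      fun p => (ι p.1).logCoeff (k₀ * (ι p.1).L) p.2 := by
  have h1 := hΓ.tab _ (hΓ.pb_succ_k k₀) (tableRe k₀ ι) (tableIm k₀ ι) hu hv
  set Δ := Γ.tab _ (hΓ.pb_succ_k k₀) (tableRe k₀ ι) (tableIm k₀ ι) hu hv with hΔ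
  have hj : Comp Δ fun p => (p.2 : ℤ) := RAM.Comp.var (Γ := Δ) (i := 0) (by simp [hΔ, Ctx.tab])
  have hle : ∀ p, Δ.dom p → p.2 ≤ k₀ * (ι p.1).L := fun p hp => Nat.lt_succ_iff.1 hp.2
  have hb : Δ.PB Prod.snd := (h1.pb_k k₀).mono hle
  have h2 := h1.push _ hb
  have hlt : ∀ p, (Δ.push _ hb).dom p → p.2 < p.1.2 := fun p hp => hp.2
  have ht' := comp_table (Γ := Δ.push _ hb) (u := fun p => tableRe k₀ ι p.1.1) (v := fun p => tableIm k₀ ι p.1.1)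
      (K := fun p => p.1.2) (j := fun p => p.2) (fun p _ => ⟨Γ.mem p.1.1, rfl⟩) last hlt
  have ht : CompG (Δ.push _ hb) fun p => (ι p.1.1).logCoeff (k₀ * (ι p.1.1).L) p.2 :=
    ⟨ht'.1, ht'.2⟩
  have hs := h2.comp_scaledMoment k₀ (N := fun p => p.1.2 - p.2) (natSub (hj.push _ _) last)
    fun p hp => (Nat.sub_le _ _).trans (hle p.1 hp.1)
  exact (((CompG.ofNat hj).mul (h1.comp_scaledMoment k₀ hj hle)).sub
    (CompG.sum hb hj (ht.mul hs))).congr fun p _ => ((ι p.1).logCoeff_eq _ _).symm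

theorem comp_out (hΓ : Γ.Reads ι) (hu hv) :
    CompG (Γ.tabbed (fun a => k₀ * (ι a).L + 1) (tableRe k₀ ι) (tableIm k₀ ι) hu hv)
      (fun a => (ι a).outNum (k₀ * (ι a).L) (M₀ * ((ι a).n + (ι a).L))) ∧
    Comp (Γ.tabbed (fun a => k₀ * (ι a).L + 1) (tableRe k₀ ι) (tableIm k₀ ι) hu hv)
      fun a => (((ι a).outDen (k₀ * (ι a).L) (M₀ * ((ι a).n + (ι a).L)) : ℕ) : ℤ) := by
  have h1 := hΓ.tabbed (fun a => k₀ * (ι a).L + 1) (tableRe k₀ ι) (tableIm k₀ ι) hu hv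
  set Δ := Γ.tabbed (fun a => k₀ * (ι a).L + 1) (tableRe k₀ ι) (tableIm k₀ ι) hu hv with hΔ
  have hk := h1.pb_k k₀
  have hck := h1.comp_k k₀
  have hkf := natFactorial hk hck
  have hlt : ∀ p, (Δ.push _ hk).dom p → p.2 + 1 ≤ k₀ * (ι p.1).L := fun p hp => hp.2
  have hi : Comp (Δ.push _ hk) fun p => ((p.2 + 1 : ℕ) : ℤ) := natAdd last (natConst 1)
  have ht' := comp_table (Γ := Δ.push _ hk) (u := fun p => tableRe k₀ ι p.1) (v := fun p => tableIm k₀ ι p.1)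
      (K := fun p => k₀ * (ι p.1).L + 1) (fun p _ => ⟨Γ.mem p.1, rfl⟩) hi
      fun p hp => Nat.lt_succ_iff.2 (hlt p hp)
  have ht : CompG (Δ.push _ hk) fun p => (ι p.1).logCoeff (k₀ * (ι p.1).L) (p.2 + 1) :=
    ⟨ht'.1, ht'.2⟩
  have hsub : (Δ.push _ hk).PB fun p => k₀ * (ι p.1).L - (p.2 + 1) :=
    ((h1.push _ hk).pb_k k₀).mono fun p _ => Nat.sub_le _ _
  have hnum : CompG Δ fun a => (ι a).logNum (k₀ * (ι a).L) :=
    CompG.sum hk hck (ht.mul (CompG.ofNat (natMul (natPow ((h1.push _ hk).comp_base k₀) hsub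
      (natSub (hck.push _ _) hi)) (natDiv (hkf.push _ _) hi))))
  have hden : Comp Δ fun a => (((ι a).logDen (k₀ * (ι a).L) : ℕ) : ℤ) :=
    natMul (natPow (h1.comp_base k₀) hk hck) hkf
  have hM : Δ.PB fun a => M₀ * ((ι a).n + (ι a).L) := (PB.const M₀).mul (h1.pb_n.add h1.pb_L)
  have hcM : Comp Δ fun a => ((M₀ * ((ι a).n + (ι a).L) : ℕ) : ℤ) :=
    natMul (natConst M₀) (natAdd h1.comp_n h1.comp_L)
  have hMf := natFactorial hM hcM
  have h2 := h1.push _ hM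
  have hN : (Δ.push _ hM).PB Prod.snd := ((PB.const M₀).mul (h2.pb_n.add h2.pb_L)).mono
    fun p hp => le_of_lt hp.2
  have hsub' : (Δ.push _ hM).PB fun p => M₀ * ((ι p.1).n + (ι p.1).L) - p.2 :=
    ((PB.const M₀).mul (h2.pb_n.add h2.pb_L)).mono fun p _ => Nat.sub_le _ _
  exact ⟨(CompG.ofNat h1.comp_pow_n).mul (CompG.sum hM hcM (((hnum.push _ _).pow hN last).mul
    (CompG.ofNat (natMul (natPow (hden.push _ _) hsub' (natSub (hcM.push _ _) last))
      (natDiv (hMf.push _ _) (natFactorial hN last)))))), natMul (natPow hden hM hcM) hMf⟩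

end Ctx.Reads

/-- The context of all inputs of the algorithm. -/
def inputCtx (D d κ : ℕ) : Ctx (Instance D d κ) where
  dom _ := True
  size := Instance.X
  mem I := initMem I.input
  k := 0
  var _ _ := 0
  two_le I _ := I.two_le_maxBits.trans I.maxBits_le
  mem_bits := ⟨1, fun I _ x => by
    rw [pow_one]; exact (Instance.bits_initMem_le _ x).trans I.maxBits_le⟩
  var_bits _ h := absurd h (Nat.not_lt_zero _)

/-- The algorithm and its running time. -/
theorem exists_prog (D d κ k₀ M₀ : ℕ) : ∃ (p : Prog) (c : ℕ), ∀ I : Instance D d κ, ∃ ν t,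
    Runs p (initMem I.input) ν t ∧ t ≤ I.X ^ c ∧
      ν 0 = (I.outNum (k₀ * I.L) (M₀ * (I.n + I.L))).re ∧
      ν 1 = (I.outNum (k₀ * I.L) (M₀ * (I.n + I.L))).im ∧
      ν 2 = I.outDen (k₀ * I.L) (M₀ * (I.n + I.L)) := by
  have hΓ : (inputCtx D d κ).Reads id := ⟨fun _ _ => rfl, fun _ _ _ _ => rfl⟩
  obtain ⟨c, hc⟩ := hΓ.bits_table_le k₀
  have hu : ∃ c, ∀ a, (inputCtx D d κ).dom a → ∀ i < k₀ * (id a).L + 1,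
      bits (Ctx.Reads.tableRe k₀ id a i) ≤ (inputCtx D d κ).size a ^ c :=
    ⟨c, fun a ha i hi => (hc a ha i hi).1⟩
  have hv : ∃ c, ∀ a, (inputCtx D d κ).dom a → ∀ i < k₀ * (id a).L + 1,
      bits (Ctx.Reads.tableIm k₀ id a i) ≤ (inputCtx D d κ).size a ^ c :=
    ⟨c, fun a ha i hi => (hc a ha i hi).2⟩
  have hstep := hΓ.comp_logCoeff_step k₀ hu hv
  have hout := hΓ.comp_out k₀ M₀ hu hv
  obtain ⟨p, e, hp⟩ := exists_table_prog (inputCtx D d κ) rfl (hΓ.pb_succ_k k₀)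
    (Comp.natAdd (hΓ.comp_k k₀) (Comp.natConst 1)) hu hv hstep.1 hstep.2 hout.1.1 hout.1.2 hout.2
  exact ⟨p, e, fun I => hp I _ trivial fun _ _ => rfl⟩

end RAM

/-! ### The word sums are the traces of powers of the Hamiltonian -/

section Trace

open Matrix

theorem Finset.sum_range_mul_eq {M : Type*} [AddCommMonoid M] (a b : ℕ) (f : ℕ → M) :
    ∑ w ∈ Finset.range (a * b), f w = ∑ j ∈ Finset.range b, ∑ i ∈ Finset.range a, f (i + a * j) := by
  induction b with
  | zero => simp
  | succ b ih =>
    rw [Nat.mul_succ, Finset.sum_range_add, ih, Finset.sum_range_succ]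
    simp only [add_comm]

/-- The ordered product of the first `i` members of a sequence. -/
def orderedProd {R : Type*} [Monoid R] (M : ℕ → R) : ℕ → R
  | 0 => 1
  | i + 1 => orderedProd M i * M i

theorem orderedProd_congr {R : Type*} [Monoid R] {M M' : ℕ → R} {N : ℕ}
    (h : ∀ i < N, M i = M' i) : orderedProd M N = orderedProd M' N := by
  induction N with
  | zero => rfl
  | succ N ih =>
    rw [orderedProd, orderedProd, ih fun i hi => h i (hi.trans N.lt_succ_self),
      h N N.lt_succ_self]

/-- Words are numbers below `L ^ N`, with their base-`L` digits as letters. A new last letter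
becomes the leading digit, which leaves the earlier digits alone. -/
theorem sum_pow_eq_sum_words {R : Type*} [Semiring R] (L : ℕ) (M : ℕ → R) (N : ℕ) :
    (∑ l ∈ Finset.range L, M l) ^ N =
      ∑ w ∈ Finset.range (L ^ N), orderedProd (fun i => M (w / L ^ i % L)) N := by
  induction N with
  | zero => simp [orderedProd]
  | succ N ih =>
    rw [pow_succ, ih, pow_succ, Finset.sum_range_mul_eq, Finset.sum_mul_sum, Finset.sum_comm]
    refine Finset.sum_congr rfl fun l hl => Finset.sum_congr rfl fun w hw => ?_
    rw [Finset.mem_range] at hl hw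
    rw [orderedProd]
    congr 1
    · refine orderedProd_congr fun i hi => ?_
      obtain ⟨e, rfl⟩ := Nat.exists_eq_add_of_lt hi
      congr 1
      have hL : 0 < L := by omega
      rw [show w + L ^ (i + e + 1) * l = w + L ^ i * (L * (L ^ e * l)) by ring,
        Nat.add_mul_div_left _ _ (pow_pos hL i), Nat.add_mul_mod_self_left]
    · have hL : 0 < L := by omega
      rw [Nat.add_mul_div_left _ _ (pow_pos hL N), Nat.div_eq_of_lt hw, zero_add,
        Nat.mod_eq_of_lt hl]

namespace LocalTerm

variable {n d : ℕ} (T : LocalTerm n d)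

theorem siteNum_eq (a : Fin T.size) : T.siteNum a = T.site a := by simp [siteNum]

theorem sum_siteNum_site (a : Fin T.size) (f : ℕ → ℕ) :
    (∑ b ∈ Finset.range T.size, if T.siteNum b = T.site a then f b else 0) = f a := by
  rw [Finset.sum_range, Finset.sum_eq_single a]
  · simp [siteNum_eq]
  · intro b _ hb
    rw [siteNum_eq, if_neg]
    exact fun h => hb (T.site.injective (Fin.ext h))
  · simp

theorem mult_site (a : Fin T.size) : T.mult (T.site a) = 1 := T.sum_siteNum_site a fun _ => 1

theorem digit_site (p : ℕ) (a : Fin T.size) : T.digit p (T.site a) = p / d ^ (a : ℕ) % d :=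
  T.sum_siteNum_site a fun b => p / d ^ b % d

theorem mult_of_notMem {v : Fin n} (hv : v ∉ T.supp) : T.mult v = 0 := by
  refine Finset.sum_eq_zero fun a ha => if_neg fun h => hv ?_
  rw [Finset.mem_range] at ha
  rw [supp, Finset.mem_map]
  refine ⟨⟨a, ha⟩, Finset.mem_univ _, Fin.ext ?_⟩
  rw [← siteNum_eq]
  exact h

theorem mem_supp {v : Fin n} : v ∈ T.supp ↔ ∃ a, T.site a = v := by
  simp [supp]

/-- The failure mark `d` is absorbing: no digit equals it, and off the support states do not change.
Hence one mismatch at a site spoils the whole word. -/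
theorem next_of_le (hd : 0 < d) (p q : ℕ) (v : Fin n) {x : ℕ} (hx : d ≤ x) :
    d ≤ T.next p q v x := by
  unfold next
  split_ifs with h1 h2
  · exfalso
    by_cases hv : v ∈ T.supp
    · obtain ⟨a, rfl⟩ := T.mem_supp.1 hv
      rw [digit_site] at h2
      have := Nat.mod_lt (p / d ^ (a : ℕ)) hd
      omega
    · rw [T.mult_of_notMem hv] at h1
      omega
  · exact le_rfl
  · exact hx

/-- A matrix unit on `X` tensored with the identity is itself a tensor product over the sites, so
its entry at `(s, t)` can be tested site by site. This replaces work with configurations of the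
lattice by work with single sites. -/
theorem forall_next_eq_iff (p q : ℕ) (s t : Fin n → Fin d) :
    (∀ v : Fin n, T.next p q v (s v) = t v) ↔ (∀ v ∉ T.supp, s v = t v) ∧
      (∀ a, (s (T.site a) : ℕ) = p / d ^ (a : ℕ) % d) ∧
      ∀ a, (t (T.site a) : ℕ) = q / d ^ (a : ℕ) % d := by
  have hsite : ∀ a, T.next p q (T.site a) (s (T.site a)) = t (T.site a) ↔
      (s (T.site a) : ℕ) = p / d ^ (a : ℕ) % d ∧ (t (T.site a) : ℕ) = q / d ^ (a : ℕ) % d := by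
    intro a
    rw [next, mult_site, if_pos one_pos, digit_site, digit_site]
    have := (t (T.site a)).2
    split_ifs with h
    · exact ⟨fun e => ⟨h, e.symm⟩, fun e => e.2.symm⟩
    · exact ⟨fun e => by omega, fun e => absurd e.1 h⟩
  constructor
  · intro h
    refine ⟨fun v hv => ?_, fun a => ((hsite a).1 (h _)).1, fun a => ((hsite a).1 (h _)).2⟩
    have := h v
    rw [next, T.mult_of_notMem hv, if_neg (lt_irrefl 0)] at this
    exact Fin.ext this
  · rintro ⟨h1, h2, h3⟩ v
    by_cases hv : v ∈ T.supp
    · obtain ⟨a, rfl⟩ := T.mem_supp.1 hv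
      exact (hsite a).2 ⟨h2 a, h3 a⟩
    · rw [next, T.mult_of_notMem hv, if_neg (lt_irrefl 0), h1 v hv]

theorem eq_digits_iff {σ : Fin T.size → Fin d} {p : ℕ} (hp : p < d ^ T.size) :
    (∀ a, (σ a : ℕ) = p / d ^ (a : ℕ) % d) ↔ p = (finFunctionFinEquiv σ : ℕ) := by
  have key : (∀ a, (σ a : ℕ) = p / d ^ (a : ℕ) % d) ↔ σ = finFunctionFinEquiv.symm ⟨p, hp⟩ := by
    rw [funext_iff]
    exact forall_congr' fun a => by rw [Fin.ext_iff]; rfl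
  rw [key, Equiv.eq_symm_apply, Fin.ext_iff, eq_comm]

theorem reEntry_equiv (σ τ : Fin T.size → Fin d) :
    T.reEntry (finFunctionFinEquiv σ : ℕ) (finFunctionFinEquiv τ : ℕ) = T.re σ τ := by
  rw [reEntry, dif_pos (finFunctionFinEquiv σ).2, dif_pos (finFunctionFinEquiv τ).2, Fin.eta,
    Fin.eta, Equiv.symm_apply_apply, Equiv.symm_apply_apply]

theorem imEntry_equiv (σ τ : Fin T.size → Fin d) :
    T.imEntry (finFunctionFinEquiv σ : ℕ) (finFunctionFinEquiv τ : ℕ) = T.im σ τ := by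
  rw [imEntry, dif_pos (finFunctionFinEquiv σ).2, dif_pos (finFunctionFinEquiv τ).2, Fin.eta,
    Fin.eta, Equiv.symm_apply_apply, Equiv.symm_apply_apply]

/-- The local term is the sum of its matrix units. -/
theorem onLattice_apply (s t : Fin n → Fin d) : T.onLattice s t =
    ∑ p ∈ Finset.range (d ^ T.size), ∑ q ∈ Finset.range (d ^ T.size),
      ((T.reEntry p q : ℂ) + (T.imEntry p q : ℂ) * Complex.I) *
        if ∀ v : Fin n, T.next p q v (s v) = t v then 1 else 0 := by
  rw [onLattice, of_apply]
  set σ : Fin T.size → Fin d := fun i => s (T.site i)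
  set τ : Fin T.size → Fin d := fun i => t (T.site i)
  have hiff : ∀ p < d ^ T.size, ∀ q < d ^ T.size, ((∀ v : Fin n, T.next p q v (s v) = t v) ↔
      (∀ v ∉ T.supp, s v = t v) ∧ p = (finFunctionFinEquiv σ : ℕ) ∧
        q = (finFunctionFinEquiv τ : ℕ)) := fun p hp q hq => by
    rw [forall_next_eq_iff, ← T.eq_digits_iff hp, ← T.eq_digits_iff hq]
  rw [Finset.sum_eq_single (finFunctionFinEquiv σ : ℕ), Finset.sum_eq_single (finFunctionFinEquiv τ : ℕ)]
  · simp only [hiff _ (finFunctionFinEquiv σ).2 _ (finFunctionFinEquiv τ).2, and_true]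
    rw [mul_ite, mul_one, mul_zero]
    congr 1
    rw [reEntry_equiv, imEntry_equiv, mat, of_apply]
  · intro q hq hne
    rw [if_neg, mul_zero]
    rw [hiff _ (finFunctionFinEquiv σ).2 _ (Finset.mem_range.1 hq)]
    exact fun h => hne h.2.2
  · exact fun h => absurd (Finset.mem_range.2 (finFunctionFinEquiv τ).2) h
  · intro p hp hne
    refine Finset.sum_eq_zero fun q hq => ?_
    rw [if_neg, mul_zero]
    rw [hiff _ (Finset.mem_range.1 hp) _ (Finset.mem_range.1 hq)]
    exact fun h => hne h.2.1
  · exact fun h => absurd (Finset.mem_range.2 (finFunctionFinEquiv σ).2) h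

end LocalTerm

namespace Instance

variable {D d κ : ℕ} (I : Instance D d κ)

theorem Q_pos : 0 < I.Q := Finset.prod_pos fun _ _ => Finset.prod_pos fun _ _ =>
  Finset.prod_pos fun _ _ => Nat.mul_pos (Rat.den_pos _) (Rat.den_pos _)

theorem den_dvd_Q {T p q : ℕ} (hT : T < I.m) (hp : p < d ^ (I.H.term T).size)
    (hq : q < d ^ (I.H.term T).size) : ((I.H.term T).reEntry p q).den ∣ I.Q ∧
      ((I.H.term T).imEntry p q).den ∣ I.Q := by
  have h : ((I.H.term T).reEntry p q).den * ((I.H.term T).imEntry p q).den ∣ I.Q :=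
    (Finset.dvd_prod_of_mem (fun q => ((I.H.term T).reEntry p q).den *
      ((I.H.term T).imEntry p q).den) (Finset.mem_range.2 hq)).trans
    ((Finset.dvd_prod_of_mem (fun p => ∏ q ∈ Finset.range (d ^ (I.H.term T).size),
      ((I.H.term T).reEntry p q).den * ((I.H.term T).imEntry p q).den)
      (Finset.mem_range.2 hp)).trans (Finset.dvd_prod_of_mem (fun T =>
        ∏ p ∈ Finset.range (d ^ (I.H.term T).size), ∏ q ∈ Finset.range (d ^ (I.H.term T).size),
          ((I.H.term T).reEntry p q).den * ((I.H.term T).imEntry p q).den)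
        (Finset.mem_range.2 hT)))
  exact ⟨(Dvd.intro _ rfl).trans h, (Dvd.intro_left _ rfl).trans h⟩

theorem num_mul_div_den (q : ℚ) {Q : ℕ} (h : q.den ∣ Q) :
    ((q.num * (Q / q.den : ℕ) : ℤ) : ℂ) = Q * (q : ℂ) := by
  obtain ⟨e, rfl⟩ := h
  rw [Nat.mul_div_cancel_left _ q.den_pos]
  have h1 : ((q : ℚ) : ℂ) = (q.num : ℂ) / (q.den : ℂ) := Rat.cast_def q
  have h2 : (q.den : ℂ) ≠ 0 := Nat.cast_ne_zero.2 q.den_ne_zero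
  rw [h1]
  push_cast
  field_simp

/-- The matrix unit that belongs to a letter. -/
noncomputable def unit (l : ℕ) : Matrix (Fin I.n → Fin d) (Fin I.n → Fin d) ℂ :=
  of fun s t => if ∀ v : Fin I.n, (I.letterTerm l).next (I.letterRow l) (I.letterCol l) v (s v) = t v
    then 1 else 0

theorem letter_decomp {T p q : ℕ} (hp : p < d ^ κ) (hq : q < d ^ κ) :
    I.letterTerm (q + d ^ κ * p + d ^ κ * d ^ κ * T) = I.H.term T ∧
      I.letterRow (q + d ^ κ * p + d ^ κ * d ^ κ * T) = p ∧
      I.letterCol (q + d ^ κ * p + d ^ κ * d ^ κ * T) = q := by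
  have h0 : 0 < d ^ κ := by omega
  refine ⟨?_, ?_, ?_⟩
  · rw [letterTerm, Nat.add_mul_div_left _ _ (Nat.mul_pos h0 h0), Nat.div_eq_of_lt, zero_add]
    nlinarith
  · rw [letterRow, add_assoc, mul_assoc, ← mul_add, Nat.add_mul_div_left _ _ h0,
      Nat.div_eq_of_lt hq, zero_add, Nat.add_mul_mod_self_left, Nat.mod_eq_of_lt hp]
  · rw [letterCol, add_assoc, mul_assoc, ← mul_add, Nat.add_mul_mod_self_left, Nat.mod_eq_of_lt hq]

theorem toMatrix_eq_sum : I.H.toMatrix = ∑ T ∈ Finset.range I.m, (I.H.term T).onLattice := by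
  rw [LatticeHamiltonian.toMatrix, Finset.sum_range, ← List.sum_ofFn]
  congr 1
  refine List.ext_getElem (by simp [m]) fun i h1 h2 => ?_
  simp only [List.length_map] at h1
  simp [LatticeHamiltonian.term, h1]

/-- `Q H` is the weighted sum of the matrix units of the letters. -/
theorem smul_toMatrix_eq : (I.Q : ℂ) • I.H.toMatrix =
    ∑ l ∈ Finset.range I.letters, GaussianInt.toComplex (I.weight l) • I.unit l := by
  ext s t
  rw [toMatrix_eq_sum, letters, mul_comm, Finset.sum_range_mul_eq, Finset.smul_sum,
    Matrix.sum_apply, Matrix.sum_apply]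
  refine Finset.sum_congr rfl fun T hT => ?_
  rw [Finset.mem_range] at hT
  rw [Finset.sum_range_mul_eq, Matrix.smul_apply, LocalTerm.onLattice_apply, Matrix.sum_apply,
    smul_eq_mul, Finset.mul_sum]
  have hle := I.pow_size_le hT
  -- Every term receives `d ^ κ * d ^ κ` letters whatever its size. Rows and columns beyond `d ^
  -- size` have weight 0, since `reEntry` and `imEntry` vanish there.
  refine Finset.sum_subset_zero_on_sdiff (Finset.range_subset_range.2 hle) (fun p hp => ?_)
    fun p hp => ?_
  · rw [Finset.mem_sdiff, Finset.mem_range, Finset.mem_range] at hp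
    rw [Matrix.sum_apply]
    refine Finset.sum_eq_zero fun q hq => ?_
    obtain ⟨h1, h2, h3⟩ := I.letter_decomp (T := T) hp.1 (Finset.mem_range.1 hq)
    have : I.weight (q + d ^ κ * p + d ^ κ * d ^ κ * T) = 0 := by
      rw [weight, h1, h2, h3]
      simp [LocalTerm.reEntry, LocalTerm.imEntry, hp.2, Zsqrtd.ext_iff]
    rw [this]
    simp
  · rw [Finset.mem_range] at hp
    rw [Matrix.sum_apply, Finset.mul_sum]
    refine Finset.sum_subset_zero_on_sdiff (Finset.range_subset_range.2 hle) (fun q hq => ?_)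
      fun q hq => ?_
    · rw [Finset.mem_sdiff, Finset.mem_range, Finset.mem_range] at hq
      obtain ⟨h1, h2, h3⟩ := I.letter_decomp (T := T) (hp.trans_le hle) hq.1
      have : I.weight (q + d ^ κ * p + d ^ κ * d ^ κ * T) = 0 := by
        rw [weight, h1, h2, h3]
        simp [LocalTerm.reEntry, LocalTerm.imEntry, hq.2, Zsqrtd.ext_iff]
      rw [this]
      simp
    · rw [Finset.mem_range] at hq
      obtain ⟨h1, h2, h3⟩ := I.letter_decomp (T := T) (hp.trans_le hle) (hq.trans_le hle)
      obtain ⟨d1, d2⟩ := I.den_dvd_Q hT hp hq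
      rw [Matrix.smul_apply, unit, of_apply, h1, h2, h3, smul_eq_mul, ← mul_assoc]
      congr 1
      rw [weight, h1, h2, h3, GaussianInt.toComplex_def, num_mul_div_den _ d1, num_mul_div_den _ d2]
      ring

/-- The entries of the product of the matrix units of a word. -/
theorem orderedProd_apply (w N : ℕ) (s t : Fin I.n → Fin d) :
    orderedProd (fun i => GaussianInt.toComplex (I.weight (I.letter w i)) • I.unit (I.letter w i)) N
      s t = GaussianInt.toComplex (∏ i ∈ Finset.range N, I.weight (I.letter w i)) *
        if ∀ v : Fin I.n, I.path v w (s v) N = t v then 1 else 0 := by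
  induction N generalizing t with
  | zero =>
    simp only [orderedProd, Finset.range_zero, Finset.prod_empty, map_one, one_mul, path,
      Matrix.one_apply, funext_iff, Fin.ext_iff]
    congr
  | succ N ih =>
    rw [orderedProd, Matrix.mul_apply]
    simp only [ih]
    simp only [Matrix.smul_apply, smul_eq_mul, Finset.prod_range_succ, map_mul, unit, of_apply]
    -- If no site has failed, exactly one intermediate configuration survives in the matrix product.
    -- Otherwise both sides are zero, because failure persists.
    by_cases hd : ∀ v : Fin I.n, I.path v w (s v) N < d
    · rw [Finset.sum_eq_single fun v => ⟨I.path v w (s v) N, hd v⟩]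
      · rw [if_pos fun _ => rfl, mul_one, ← mul_assoc]
        exact congrArg _ (if_congr Iff.rfl rfl rfl)
      · intro u _ hu
        rw [if_neg, mul_zero, zero_mul]
        exact fun h => hu (funext fun v => Fin.ext (h v).symm)
      · simp
    · push Not at hd
      obtain ⟨v, hv⟩ := hd
      rw [if_neg (c := ∀ v : Fin I.n, I.path v w (s v) (N + 1) = t v), mul_zero]
      · refine Finset.sum_eq_zero fun u _ => ?_
        rw [if_neg, mul_zero, zero_mul]
        intro h
        have := h v
        have := (u v).2
        omega
      · intro h
        have h1 := (I.letterTerm (I.letter w N)).next_of_le I.d_pos (I.letterRow (I.letter w N))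
          (I.letterCol (I.letter w N)) v hv
        have h2 := (t v).2
        have h3 : (I.letterTerm (I.letter w N)).next _ _ v _ = t v := h v
        omega

/-- The condition at `v` involves the state of `v` only, so the sum over `d ^ n` configurations is a
product of `n` sums with `d` terms each. -/
theorem sum_prod_closed (w N : ℕ) :
    (∑ s : Fin I.n → Fin d, if ∀ v : Fin I.n, I.path v w (s v) N = s v then (1 : ℂ) else 0) =
      I.closed w N := by
  have h : ∀ s : Fin I.n → Fin d, (if ∀ v : Fin I.n, I.path v w (s v) N = s v then (1 : ℂ) else 0) =
      ∏ v : Fin I.n, if I.path v w (s v) N = s v then (1 : ℂ) else 0 := fun s => by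
    rw [Finset.prod_ite_zero]
    simp
  simp only [h]
  rw [closed, Finset.prod_range, Nat.cast_prod]
  simp only [Finset.sum_range, Nat.cast_sum, Nat.cast_ite, Nat.cast_one, Nat.cast_zero]
  rw [Finset.prod_univ_sum, Fintype.piFinset_univ]

/-- The moments are the traces of the powers of `Q H`. -/
theorem toComplex_moment (N : ℕ) : GaussianInt.toComplex (I.moment N) =
    trace (((I.Q : ℂ) • I.H.toMatrix) ^ N) := by
  rw [smul_toMatrix_eq, sum_pow_eq_sum_words, Matrix.trace_sum, moment, map_sum]
  refine Finset.sum_congr rfl fun w _ => ?_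
  rw [map_mul, map_natCast, ← sum_prod_closed, Finset.mul_sum, Matrix.trace]
  refine Finset.sum_congr rfl fun s _ => ?_
  rw [diag_apply]
  exact (I.orderedProd_apply w N s s).symm

end Instance

end Trace

/-! ### Zero-freeness of functions on finite sets -/

section AltSum

variable {ι M : Type*} [DecidableEq ι] [AddCommGroup M]

/-- The alternating sum of a function of a finite set over the sets between `A` and `A ∪ B`. -/
def altSum (Z : Finset ι → M) (A B : Finset ι) : M :=
  ∑ C ∈ B.powerset, (-1 : ℤ) ^ (B.card + C.card) • Z (A ∪ C)

theorem altSum_empty (Z : Finset ι → M) (A : Finset ι) : altSum Z A ∅ = Z A := by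
  simp [altSum]

/-- `altSum` is an iterated difference: the sets `C` with and without `a` give the two terms of the
difference in direction `a`. -/
theorem altSum_insert (Z : Finset ι → M) (A : Finset ι) {B : Finset ι} {a : ι} (ha : a ∉ B) :
    altSum Z A (insert a B) = altSum Z (insert a A) B - altSum Z A B := by
  rw [altSum, Finset.sum_powerset_insert ha, add_comm, sub_eq_add_neg, altSum, altSum,
    ← Finset.sum_neg_distrib]
  congr 1
  · refine Finset.sum_congr rfl fun C hC => ?_
    rw [Finset.card_insert_of_notMem ha,
      Finset.card_insert_of_notMem fun h => ha (Finset.mem_powerset.1 hC h),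
      Finset.union_insert, Finset.insert_union]
    congr 1
    ring
  · refine Finset.sum_congr rfl fun C hC => ?_
    rw [Finset.card_insert_of_notMem ha, ← neg_smul]
    congr 1
    ring

/-- Summing out a part of the set over which the sign alternates. -/
theorem sum_powerset_altSum (Z : Finset ι → M) (A F B : Finset ι) (hF : Disjoint F B) :
    ∑ B' ∈ F.powerset, altSum Z A (B ∪ B') = altSum Z (A ∪ F) B := by
  induction F using Finset.induction_on generalizing A with
  | empty => simp
  | insert a F ha ih =>
    rw [Finset.disjoint_insert_left] at hF
    rw [Finset.sum_powerset_insert ha, ← Finset.sum_add_distrib, Finset.union_insert,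
      ← Finset.insert_union, ← ih _ hF.2]
    refine Finset.sum_congr rfl fun B' hB' => ?_
    rw [Finset.union_insert, altSum_insert, add_sub_cancel]
    rw [Finset.mem_union, not_or]
    exact ⟨hF.1, fun h => ha (Finset.mem_powerset.1 hB' h)⟩

end AltSum

section ZeroFree

variable {ι V : Type*} [DecidableEq ι] [DecidableEq V] {supp : ι → Finset V}
  {Z : Finset ι → ℂ} {u : ι → ℝ} {κ : ℕ} {t q : ℝ}

/-- The bound for alternating sums from which the absence of zeros follows. -/
def AltSumBound (supp : ι → Finset V) (Z : Finset ι → ℂ) (u : ι → ℝ) (t : ℝ) (A : Finset ι) :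
    Prop :=
  ∀ (S : Finset V) (B : Finset ι), Disjoint A B → (∀ i ∈ A, ∀ j ∈ B, supp i ∩ supp j ⊆ S) →
    ‖altSum Z A B‖ ≤ (∏ i ∈ B, u i) * Real.exp (t * S.card) * ‖Z A‖

/-- The hypothesis is applied to `B ∪ B'`. Overlaps with the terms that avoid `x` lie in `S.erase x`
or in the supports of members of `B'`, again without `x`. As each such support contains `x`, it adds
at most `κ - 1` points, whence a factor `exp (t * (κ - 1))` per member of `B'`. -/
theorem AltSumBound.remove {A B : Finset ι} {S : Finset V} {x : V} (ht : 0 ≤ t)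
    (hu : ∀ i, 0 ≤ u i) (hcard : ∀ i, (supp i).card ≤ κ)
    (h : AltSumBound supp Z u t (A.filter fun i => x ∉ supp i)) (hAB : Disjoint A B)
    (hS : ∀ i ∈ A, ∀ j ∈ B, supp i ∩ supp j ⊆ S) {B' : Finset ι}
    (hB' : B' ⊆ A.filter fun i => x ∈ supp i) :
    ‖altSum Z (A.filter fun i => x ∉ supp i) (B ∪ B')‖ ≤
      (∏ i ∈ B, u i) * Real.exp (t * (S.erase x).card) * ‖Z (A.filter fun i => x ∉ supp i)‖ *
        ∏ i ∈ B', u i * Real.exp (t * (κ - 1)) := by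
  have hdisj : Disjoint B B' := by
    rw [disjoint_comm]
    exact hAB.mono_left (hB'.trans (Finset.filter_subset _ _))
  have h1 := h (S.erase x ∪ B'.biUnion fun i => (supp i).erase x) (B ∪ B') ?_ ?_
  · refine h1.trans ?_
    rw [Finset.prod_union hdisj, Finset.prod_mul_distrib, Finset.prod_const, ← Real.exp_nat_mul]
    have hc : (((S.erase x ∪ B'.biUnion fun i => (supp i).erase x).card : ℕ) : ℝ) ≤
        (S.erase x).card + B'.card * ((κ : ℝ) - 1) := by
      have h2 : (((S.erase x ∪ B'.biUnion fun i => (supp i).erase x).card : ℕ) : ℝ) ≤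
          (S.erase x).card + ∑ i ∈ B', (((supp i).erase x).card : ℝ) := by
        exact_mod_cast (Finset.card_union_le _ _).trans
          (Nat.add_le_add_left Finset.card_biUnion_le _)
      refine h2.trans (add_le_add le_rfl ?_)
      refine (Finset.sum_le_card_nsmul _ _ ((κ : ℝ) - 1) fun i hi => ?_).trans (by rw [nsmul_eq_mul])
      have hx : x ∈ supp i := (Finset.mem_filter.1 (hB' hi)).2
      have h3 := hcard i
      have h4 := Finset.card_erase_add_one hx
      have h5 : (((supp i).erase x).card : ℝ) + 1 ≤ κ := by exact_mod_cast h4.trans_le h3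
      linarith
    have he : Real.exp (t * ((S.erase x ∪ B'.biUnion fun i => (supp i).erase x).card : ℕ)) ≤
        Real.exp (t * (S.erase x).card) * Real.exp (B'.card * (t * (κ - 1))) := by
      rw [← Real.exp_add, Real.exp_le_exp]
      nlinarith
    have hp : 0 ≤ (∏ i ∈ B, u i) * ∏ i ∈ B', u i :=
      mul_nonneg (Finset.prod_nonneg fun i _ => hu i) (Finset.prod_nonneg fun i _ => hu i)
    calc _ ≤ _ := mul_le_mul_of_nonneg_right (mul_le_mul_of_nonneg_left he hp) (norm_nonneg _)
      _ = _ := by ring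
  · rw [Finset.disjoint_union_right]
    refine ⟨hAB.mono_left (Finset.filter_subset _ _), ?_⟩
    rw [Finset.disjoint_left]
    exact fun i hi hi' => (Finset.mem_filter.1 hi).2 (Finset.mem_filter.1 (hB' hi')).2
  · intro i hi j hj y hy
    rw [Finset.mem_filter] at hi
    have hyx : y ≠ x := by
      rintro rfl
      exact hi.2 (Finset.mem_inter.1 hy).1
    rw [Finset.mem_union]
    rcases Finset.mem_union.1 hj with hj | hj
    · exact Or.inl (Finset.mem_erase.2 ⟨hyx, hS i hi.1 j hj hy⟩)
    · exact Or.inr (Finset.mem_biUnion.2 ⟨j, hj,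
        Finset.mem_erase.2 ⟨hyx, (Finset.mem_inter.1 hy).2⟩⟩)

/-- Zero-freeness, by removing the members at one point after the other. -/
theorem altSumBound_and_ne_zero (ht : 0 ≤ t) (hu : ∀ i, 0 ≤ u i) (hcard : ∀ i, (supp i).card ≤ κ)
    (hne : ∀ i, (supp i).Nonempty) (hZ : Z ∅ = 1)
    (hfac : ∀ A B : Finset ι, (∀ i ∈ A, ∀ j ∈ B, Disjoint (supp i) (supp j)) →
      Z (A ∪ B) = Z A * Z B)
    (hterm : ∀ B, ‖altSum Z ∅ B‖ ≤ ∏ i ∈ B, u i) (hq : Real.exp q < 2)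
    (hqt : Real.exp q ≤ (2 - Real.exp q) * Real.exp t)
    (hsum : ∀ (A : Finset ι) (x : V), (∀ i ∈ A, x ∈ supp i) →
      ∑ i ∈ A, u i * Real.exp (t * (κ - 1)) ≤ q) (A : Finset ι) :
    Z A ≠ 0 ∧ AltSumBound supp Z u t A := by
  induction A using Finset.strongInduction with
  | H A ih =>
  have hprod : ∀ x, ∏ i ∈ A.filter (fun i => x ∈ supp i), (1 + u i * Real.exp (t * (κ - 1))) ≤
      Real.exp q := fun x => by
    refine (Finset.prod_le_prod (fun i _ => ?_) fun i _ => ?_).trans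
      (((Real.exp_sum _ _).symm.le).trans (Real.exp_le_exp.2
        (hsum (A.filter (fun i => x ∈ supp i)) x fun i hi => (Finset.mem_filter.1 hi).2)))
    · have := mul_nonneg (hu i) (Real.exp_pos (t * (κ - 1))).le
      linarith
    · rw [add_comm]
      exact Real.add_one_le_exp _
  -- Removing the terms through `x` costs at most the factor `2 - exp q`. Expand `Z A` over the
  -- subsets of the removed terms: the empty subset gives the value `Z A'` on the remaining terms,
  -- and all others together are at most `(exp q - 1) * ‖Z A'‖`.
  have hlow : ∀ x, (A.filter fun i => x ∈ supp i).Nonempty →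
      Z (A.filter fun i => x ∉ supp i) ≠ 0 ∧ AltSumBound supp Z u t (A.filter fun i => x ∉ supp i) ∧
      (2 - Real.exp q) * ‖Z (A.filter fun i => x ∉ supp i)‖ ≤ ‖Z A‖ := fun x hx => by
    have hss : (A.filter fun i => x ∉ supp i) ⊂ A := by
      obtain ⟨i, hi⟩ := hx
      rw [Finset.mem_filter] at hi
      exact Finset.filter_ssubset.2 ⟨i, hi.1, fun h => h hi.2⟩
    obtain ⟨h1, h2⟩ := ih _ hss
    refine ⟨h1, h2, ?_⟩
    set A' := A.filter fun i => x ∉ supp i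
    set F := A.filter fun i => x ∈ supp i
    have hun : A' ∪ F = A := by
      rw [Finset.union_comm]; exact Finset.filter_union_filter_not_eq _ _
    have h3 := sum_powerset_altSum Z A' F ∅ (Finset.disjoint_empty_right F)
    rw [altSum_empty, hun] at h3
    have h4 : ∀ B' ∈ F.powerset, ‖altSum Z A' (∅ ∪ B')‖ ≤
        ‖Z A'‖ * ∏ i ∈ B', u i * Real.exp (t * (κ - 1)) := fun B' hB' => by
      have := h2.remove (S := ∅) ht hu hcard (Finset.disjoint_empty_right A) (by simp)
        (Finset.mem_powerset.1 hB')
      simpa using this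
    rw [← Finset.add_sum_erase _ _ (Finset.empty_mem_powerset F), Finset.union_empty,
      altSum_empty] at h3
    have h5 : ‖∑ B' ∈ F.powerset.erase ∅, altSum Z A' (∅ ∪ B')‖ ≤
        ‖Z A'‖ * (Real.exp q - 1) := by
      refine (norm_sum_le_of_le _ fun B' hB' => h4 B' (Finset.mem_of_mem_erase hB')).trans ?_
      rw [← Finset.mul_sum]
      refine mul_le_mul_of_nonneg_left ?_ (norm_nonneg _)
      have h6 := Finset.prod_one_add (f := fun i => u i * Real.exp (t * (κ - 1))) F
      rw [← Finset.add_sum_erase _ _ (Finset.empty_mem_powerset F), Finset.prod_empty] at h6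
      have := hprod x
      linarith
    have h7 := norm_sub_norm_le (Z A') (-∑ B' ∈ F.powerset.erase ∅, altSum Z A' (∅ ∪ B'))
    rw [sub_neg_eq_add, norm_neg, h3] at h7
    linarith
  constructor
  · rcases A.eq_empty_or_nonempty with rfl | ⟨i, hi⟩
    · rw [hZ]; exact one_ne_zero
    · obtain ⟨x, hx⟩ := hne i
      obtain ⟨h1, _, h3⟩ := hlow x ⟨i, Finset.mem_filter.2 ⟨hi, hx⟩⟩
      have h4 : 0 < ‖Z A‖ := (mul_pos (by linarith) (norm_pos_iff.2 h1)).trans_le h3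
      exact norm_pos_iff.1 h4
  · intro S B hAB hS
    have hB0 : 0 ≤ ∏ i ∈ B, u i := Finset.prod_nonneg fun i _ => hu i
    -- Peel off a point of `S` that is met by `A`. The loss `exp q / (2 - exp q)` is paid by the
    -- factor `exp t` gained from the smaller set `S.erase x`; this is `hqt`.
    by_cases hx : ∃ x ∈ S, (A.filter fun i => x ∈ supp i).Nonempty
    · obtain ⟨x, hxS, hx⟩ := hx
      obtain ⟨h1, h2, h3⟩ := hlow x hx
      set A' := A.filter fun i => x ∉ supp i with hA'
      set F := A.filter fun i => x ∈ supp i with hF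
      have hun : A' ∪ F = A := by
        rw [Finset.union_comm]; exact Finset.filter_union_filter_not_eq _ _
      have hFB : Disjoint F B := hAB.mono_left (Finset.filter_subset _ _)
      have h4 := sum_powerset_altSum Z A' F B hFB
      rw [hun] at h4
      rw [← h4]
      refine (norm_sum_le_of_le _ fun B' hB' => h2.remove ht hu hcard hAB hS
        (Finset.mem_powerset.1 hB')).trans ?_
      rw [← Finset.mul_sum, ← Finset.prod_one_add]
      have hc : ((S.erase x).card : ℝ) + 1 = S.card := by
        exact_mod_cast Finset.card_erase_add_one hxS
      have he : Real.exp (t * S.card) = Real.exp (t * (S.erase x).card) * Real.exp t := by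
        rw [← hc, ← Real.exp_add]; ring_nf
      rw [he]
      have h5 : Real.exp q * ‖Z A'‖ ≤ Real.exp t * ‖Z A‖ :=
        calc Real.exp q * ‖Z A'‖ ≤ (2 - Real.exp q) * Real.exp t * ‖Z A'‖ :=
              mul_le_mul_of_nonneg_right hqt (norm_nonneg _)
          _ = Real.exp t * ((2 - Real.exp q) * ‖Z A'‖) := by ring
          _ ≤ _ := mul_le_mul_of_nonneg_left h3 (Real.exp_pos t).le
      have h6 : 0 ≤ (∏ i ∈ B, u i) * Real.exp (t * (S.erase x).card) :=
        mul_nonneg hB0 (Real.exp_pos _).le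
      calc _ ≤ (∏ i ∈ B, u i) * Real.exp (t * (S.erase x).card) * ‖Z A'‖ * Real.exp q :=
            mul_le_mul_of_nonneg_left (hprod x) (mul_nonneg h6 (norm_nonneg _))
        _ = (∏ i ∈ B, u i) * Real.exp (t * (S.erase x).card) * (Real.exp q * ‖Z A'‖) := by ring
        _ ≤ _ := mul_le_mul_of_nonneg_left h5 h6
        _ = _ := by ring
    -- If no member of `A` meets `S`, there are no overlaps with `B`. Then `Z A` factors out, and
    -- `hterm` bounds what remains.
    · have hdisj : ∀ i ∈ A, ∀ j ∈ B, Disjoint (supp i) (supp j) := fun i hi j hj => by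
        rw [Finset.disjoint_left]
        exact fun y hy hy' => hx ⟨y, hS i hi j hj (Finset.mem_inter.2 ⟨hy, hy'⟩),
          i, Finset.mem_filter.2 ⟨hi, hy⟩⟩
      have h1 : altSum Z A B = Z A * altSum Z ∅ B := by
        rw [altSum, altSum, Finset.mul_sum]
        refine Finset.sum_congr rfl fun C hC => ?_
        rw [hfac A C fun i hi j hj => hdisj i hi j (Finset.mem_powerset.1 hC hj),
          Finset.empty_union, mul_smul_comm]
      rw [h1, norm_mul, mul_comm]
      refine mul_le_mul_of_nonneg_right ((hterm B).trans (le_mul_of_one_le_right hB0 ?_))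
        (norm_nonneg _)
      exact Real.one_le_exp (by positivity)

end ZeroFree

/-! ### Alternating sums of exponentials -/

section AltSumExp

variable {ι : Type*} [DecidableEq ι]

theorem altSum_const {M : Type*} [AddCommGroup M] (x : M) (A B : Finset ι) :
    altSum (fun _ => x) A B = if B = ∅ then x else 0 := by
  induction B using Finset.induction_on generalizing A with
  | empty => simp [altSum_empty]
  | insert a B ha ih => rw [altSum_insert _ _ ha, ih, ih, sub_self, if_neg (Finset.insert_ne_empty a B)]

/-- A Leibniz rule. For fixed `i` only the sets `C` containing `i` contribute, and `altSum_insert`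
evaluates their signed sum. The right side is free of signs, which allows norm estimates by
induction. -/
theorem altSum_sum_mul {R : Type*} [Ring R] (a : ι → R) (W : Finset ι → R) (B : Finset ι) :
    altSum (fun C => (∑ i ∈ C, a i) * W C) ∅ B =
      ∑ i ∈ B, a i * (altSum W ∅ B + altSum W ∅ (B.erase i)) := by
  have h1 : ∀ i ∈ B, altSum W ∅ B + altSum W ∅ (B.erase i) =
      ∑ C ∈ B.powerset, if i ∈ C then (-1 : ℤ) ^ (B.card + C.card) • W C else 0 := fun i hi => by
    have hi' := Finset.notMem_erase i B
    have h2 : altSum W ∅ B = altSum W ∅ (insert i (B.erase i)) := by rw [Finset.insert_erase hi]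
    rw [h2, altSum_insert _ _ hi', sub_add_cancel]
    conv_rhs => rw [← Finset.insert_erase hi]
    rw [Finset.sum_powerset_insert hi', Finset.sum_eq_zero, zero_add, altSum]
    · refine Finset.sum_congr rfl fun C hC => ?_
      rw [if_pos (Finset.mem_insert_self i C), Finset.card_insert_of_notMem hi',
        Finset.card_insert_of_notMem fun h => hi' (Finset.mem_powerset.1 hC h), insert_empty_eq,
        ← Finset.insert_eq]
      congr 1
      ring
    · exact fun C hC => if_neg fun h => hi' (Finset.mem_powerset.1 hC h)
  rw [Finset.sum_congr rfl fun i hi => by rw [h1 i hi, Finset.mul_sum], Finset.sum_comm, altSum]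
  refine Finset.sum_congr rfl fun C hC => ?_
  simp only [mul_ite, mul_zero, Finset.empty_union]
  rw [← Finset.sum_filter, Finset.filter_mem_eq_inter,
    Finset.inter_eq_right.2 (Finset.mem_powerset.1 hC), Finset.sum_mul, Finset.smul_sum]
  exact Finset.sum_congr rfl fun i _ => (mul_smul_comm _ _ _).symm

/-- When expanded, the left side is the sum over the words of length `m` in which every member of
`B` occurs, all with sign `+`, and the right side is the same sum with norms. The recursion
`altSum_sum_mul` gives the estimate without introducing words and without commutativity. -/
theorem norm_altSum_pow_le {R : Type*} [NormedRing R] [NormOneClass R] (a : ι → R) (m : ℕ)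
    (B : Finset ι) : ‖altSum (fun C => (∑ i ∈ C, a i) ^ m) ∅ B‖ ≤
      altSum (fun C => (∑ i ∈ C, ‖a i‖) ^ m) ∅ B := by
  induction m generalizing B with
  | zero =>
    simp only [pow_zero, altSum_const]
    split_ifs <;> simp
  | succ m ih =>
    simp only [pow_succ']
    rw [altSum_sum_mul, altSum_sum_mul]
    refine norm_sum_le_of_le _ fun i _ => (norm_mul_le _ _).trans ?_
    exact mul_le_mul_of_nonneg_left ((norm_add_le _ _).trans (add_le_add (ih _) (ih _)))
      (norm_nonneg _)

theorem altSum_exp_sum (b : ι → ℝ) (B : Finset ι) :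
    altSum (fun C => Real.exp (∑ i ∈ C, b i)) ∅ B = ∏ i ∈ B, (Real.exp (b i) - 1) := by
  induction B using Finset.induction_on with
  | empty => simp [altSum_empty]
  | insert a B ha ih =>
    rw [altSum_insert _ _ ha, Finset.prod_insert ha, sub_mul, one_mul, ← ih]
    congr 1
    rw [altSum, altSum, Finset.mul_sum]
    refine Finset.sum_congr rfl fun C hC => ?_
    rw [mul_smul_comm, insert_empty_eq, ← Finset.insert_eq, Finset.empty_union,
      Finset.sum_insert fun h => ha (Finset.mem_powerset.1 hC h), Real.exp_add]

theorem hasSum_altSum_exp {R : Type*} [NormedRing R] [NormedAlgebra ℂ R] [CompleteSpace R]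
    (a : ι → R) (B : Finset ι) :
    HasSum (fun m : ℕ => ((m.factorial : ℂ)⁻¹) • altSum (fun C => (∑ i ∈ C, a i) ^ m) ∅ B)
      (altSum (fun C => NormedSpace.exp (∑ i ∈ C, a i)) ∅ B) := by
  have h : HasSum (fun m : ℕ => ∑ C ∈ B.powerset, (-1 : ℤ) ^ (B.card + C.card) •
      (((m.factorial : ℂ)⁻¹) • (∑ i ∈ ∅ ∪ C, a i) ^ m))
      (altSum (fun C => NormedSpace.exp (∑ i ∈ C, a i)) ∅ B) :=
    hasSum_sum fun C _ => (NormedSpace.exp_series_hasSum_exp' (𝕂 := ℂ) _).const_smul _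
  refine h.congr_fun fun m => ?_
  rw [altSum, Finset.smul_sum]
  exact Finset.sum_congr rfl fun C _ => smul_comm _ _ _

/-- The exponential series is compared term by term with its scalar version in the norms `‖a i‖`,
where the alternating sum is the product by `altSum_exp_sum`. -/
theorem norm_altSum_exp_le {R : Type*} [NormedRing R] [NormOneClass R] [NormedAlgebra ℂ R]
    [CompleteSpace R] (a : ι → R) (B : Finset ι) :
    ‖altSum (fun C => NormedSpace.exp (∑ i ∈ C, a i)) ∅ B‖ ≤ ∏ i ∈ B, (Real.exp ‖a i‖ - 1) := by
  have h1 : HasSum (fun m : ℕ => ((m.factorial : ℝ)⁻¹) *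
      altSum (fun C => (∑ i ∈ C, ‖a i‖) ^ m) ∅ B)
      (altSum (fun C => Real.exp (∑ i ∈ C, ‖a i‖)) ∅ B) := by
    have h : HasSum (fun m : ℕ => ∑ C ∈ B.powerset, (-1 : ℤ) ^ (B.card + C.card) •
        (((m.factorial : ℝ)⁻¹) * (∑ i ∈ ∅ ∪ C, ‖a i‖) ^ m))
        (altSum (fun C => Real.exp (∑ i ∈ C, ‖a i‖)) ∅ B) :=
      hasSum_sum fun C _ => by
        have := NormedSpace.exp_series_hasSum_exp' (𝕂 := ℝ) (∑ i ∈ ∅ ∪ C, ‖a i‖)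
        rw [← Real.exp_eq_exp_ℝ] at this
        exact this.const_smul _
    refine h.congr_fun fun m => ?_
    rw [altSum, Finset.mul_sum]
    exact Finset.sum_congr rfl fun C _ => mul_smul_comm _ _ _
  rw [← altSum_exp_sum, ← (hasSum_altSum_exp a B).tsum_eq]
  refine tsum_of_norm_bounded h1 fun m => ?_
  rw [norm_smul, norm_inv, Complex.norm_natCast]
  exact mul_le_mul_of_nonneg_left (norm_altSum_pow_le a m B) (by positivity)

end AltSumExp

/-! ### Operators on tensor products -/

section Tensor

open Matrix Kronecker

variable {α γ δ : Type*} [Fintype α] [Fintype γ] [Fintype δ] [DecidableEq α] [DecidableEq γ]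
  [DecidableEq δ]

/-- Matrices on the first factor of a tensor product. -/
def leftEmb (e : δ ≃ α × γ) : Matrix α α ℂ →⋆ₐ[ℂ] Matrix δ δ ℂ where
  toFun M := (M ⊗ₖ (1 : Matrix γ γ ℂ)).submatrix e e
  map_one' := by rw [one_kronecker_one, submatrix_one_equiv]
  map_mul' M N := by rw [submatrix_mul_equiv, ← mul_kronecker_mul, one_mul]
  map_zero' := by rw [zero_kronecker]; rfl
  map_add' M N := by rw [add_kronecker]; rfl
  commutes' z := by
    rw [Algebra.algebraMap_eq_smul_one, smul_kronecker, one_kronecker_one,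
      Algebra.algebraMap_eq_smul_one, ← submatrix_one_equiv e]
    rfl
  map_star' M := by
    rw [star_eq_conjTranspose, star_eq_conjTranspose, conjTranspose_submatrix,
      conjTranspose_kronecker, conjTranspose_one]

/-- Matrices on the second factor of a tensor product. -/
def rightEmb (e : δ ≃ α × γ) : Matrix γ γ ℂ →⋆ₐ[ℂ] Matrix δ δ ℂ :=
  leftEmb (e.trans (Equiv.prodComm α γ))

theorem leftEmb_apply (e : δ ≃ α × γ) (M : Matrix α α ℂ) (s t : δ) :
    leftEmb e M s t = if (e s).2 = (e t).2 then M (e s).1 (e t).1 else 0 := by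
  change M _ _ * (1 : Matrix γ γ ℂ) _ _ = _
  rw [one_apply, mul_ite, mul_one, mul_zero]

theorem rightEmb_apply (e : δ ≃ α × γ) (M : Matrix γ γ ℂ) (s t : δ) :
    rightEmb e M s t = if (e s).1 = (e t).1 then M (e s).2 (e t).2 else 0 :=
  leftEmb_apply _ M s t

theorem rightEmb_eq (e : δ ≃ α × γ) (N : Matrix γ γ ℂ) :
    rightEmb e N = ((1 : Matrix α α ℂ) ⊗ₖ N).submatrix e e := by
  ext s t
  rw [rightEmb_apply]
  change _ = (1 : Matrix α α ℂ) _ _ * N _ _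
  rw [one_apply, ite_mul, one_mul, zero_mul]

theorem leftEmb_mul_rightEmb (e : δ ≃ α × γ) (M : Matrix α α ℂ) (N : Matrix γ γ ℂ) :
    leftEmb e M * rightEmb e N = (M ⊗ₖ N).submatrix e e := by
  rw [rightEmb_eq]
  change (M ⊗ₖ (1 : Matrix γ γ ℂ)).submatrix e e * _ = _
  rw [submatrix_mul_equiv, ← mul_kronecker_mul, one_mul, mul_one]

theorem commute_leftEmb_rightEmb (e : δ ≃ α × γ) (M : Matrix α α ℂ) (N : Matrix γ γ ℂ) :
    Commute (leftEmb e M) (rightEmb e N) := by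
  rw [Commute, SemiconjBy, leftEmb_mul_rightEmb, rightEmb_eq]
  change _ = _ * (M ⊗ₖ (1 : Matrix γ γ ℂ)).submatrix e e
  rw [submatrix_mul_equiv, ← mul_kronecker_mul, one_mul, mul_one]

theorem trace_leftEmb_mul_rightEmb (e : δ ≃ α × γ) (M : Matrix α α ℂ) (N : Matrix γ γ ℂ) :
    (leftEmb e M * rightEmb e N).trace = M.trace * N.trace := by
  rw [leftEmb_mul_rightEmb, ← trace_kronecker]
  exact e.sum_comp fun p => (M ⊗ₖ N) p p

theorem exp_leftEmb (e : δ ≃ α × γ) (M : Matrix α α ℂ) :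
    NormedSpace.exp (leftEmb e M) = leftEmb e (NormedSpace.exp M) := by
  open scoped Matrix.Norms.L2Operator in
  exact (NormedSpace.map_exp_of_mem_ball (𝕂 := ℂ) (leftEmb e)
    (LinearMap.continuous_of_finiteDimensional (leftEmb e).toAlgHom.toLinearMap) M
    ((NormedSpace.expSeries_radius_eq_top ℂ (Matrix α α ℂ)).symm ▸ edist_lt_top _ _)).symm

theorem exp_rightEmb (e : δ ≃ α × γ) (M : Matrix γ γ ℂ) :
    NormedSpace.exp (rightEmb e M) = rightEmb e (NormedSpace.exp M) := exp_leftEmb _ M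

theorem trace_leftEmb (e : δ ≃ α × γ) (M : Matrix α α ℂ) :
    (leftEmb e M).trace = M.trace * Fintype.card γ := by
  have := trace_leftEmb_mul_rightEmb e M 1
  rwa [map_one, mul_one, trace_one] at this

theorem trace_rightEmb (e : δ ≃ α × γ) (M : Matrix γ γ ℂ) :
    (rightEmb e M).trace = M.trace * Fintype.card α := trace_leftEmb _ M

/-- The normalized trace of the exponential is multiplicative over tensor products. -/
theorem trace_exp_leftEmb_add_rightEmb (e : δ ≃ α × γ) (M : Matrix α α ℂ) (N : Matrix γ γ ℂ) :
    (NormedSpace.exp (leftEmb e M + rightEmb e N)).trace * Fintype.card δ =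
      (NormedSpace.exp (leftEmb e M)).trace * (NormedSpace.exp (rightEmb e N)).trace := by
  rw [Matrix.exp_add_of_commute _ _ (commute_leftEmb_rightEmb e M N), exp_leftEmb, exp_rightEmb,
    trace_leftEmb_mul_rightEmb, trace_leftEmb, trace_rightEmb, Fintype.card_congr e,
    Fintype.card_prod, Nat.cast_mul]
  ring

open scoped Matrix.Norms.L2Operator in
theorem norm_leftEmb_le (e : δ ≃ α × γ) (M : Matrix α α ℂ) : ‖leftEmb e M‖ ≤ ‖M‖ :=
  NonUnitalStarAlgHom.norm_apply_le (leftEmb e) M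

open scoped Matrix.Norms.L2Operator in
theorem norm_trace_le (M : Matrix δ δ ℂ) : ‖M.trace‖ ≤ Fintype.card δ * ‖M‖ := by
  have h : ∀ i, ‖M i i‖ ≤ ‖M‖ := fun i => by
    have h1 := l2_opNorm_mulVec M (EuclideanSpace.single i (1 : ℂ))
    rw [PiLp.norm_single, norm_one, mul_one] at h1
    refine le_trans ?_ h1
    refine le_trans (le_of_eq ?_) (PiLp.norm_apply_le _ i)
    simp
  refine (norm_sum_le_of_le _ fun i _ => h i).trans ?_
  simp

end Tensor

section ZeroFreeness

/-! ### The partition function has no zeros at high temperature -/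

open Matrix
open scoped Matrix.Norms.L2Operator

namespace LocalTerm

variable {n d : ℕ} (T : LocalTerm n d)

/-- The numbering of the sites of a local term. -/
noncomputable def siteEquiv : {v : Fin n // v ∈ T.supp} ≃ Fin T.size :=
  (Equiv.ofBijective (fun i => (⟨T.site i, T.mem_supp.2 ⟨i, rfl⟩⟩ : {v : Fin n // v ∈ T.supp}))
    ⟨fun _ _ h => T.site.injective (Subtype.ext_iff.1 h), fun v => by
      obtain ⟨i, hi⟩ := T.mem_supp.1 v.2
      exact ⟨i, Subtype.ext hi⟩⟩).symm

/-- The configurations of the lattice as pairs of configurations of the sites of a local term and of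
the other sites. -/
noncomputable def splitting : (Fin n → Fin d) ≃
    (Fin T.size → Fin d) × ({v : Fin n // v ∉ T.supp} → Fin d) :=
  (Equiv.piEquivPiSubtypeProd (· ∈ T.supp) fun _ => Fin d).trans
    ((Equiv.arrowCongr T.siteEquiv (Equiv.refl _)).prodCongr (Equiv.refl _))

theorem splitting_fst (s : Fin n → Fin d) : (T.splitting s).1 = fun i => s (T.site i) := rfl

theorem splitting_snd (s : Fin n → Fin d) : (T.splitting s).2 = fun v => s v.1 := rfl

theorem onLattice_eq_leftEmb : T.onLattice = leftEmb T.splitting T.mat := by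
  ext s t
  rw [leftEmb_apply, onLattice, of_apply, splitting_fst, splitting_fst, splitting_snd,
    splitting_snd]
  simp only [funext_iff, Subtype.forall]

theorem norm_onLattice_le : ‖T.onLattice‖ ≤ T.opNorm := by
  rw [onLattice_eq_leftEmb]
  exact norm_leftEmb_le _ _

theorem opNorm_nonneg : 0 ≤ T.opNorm := norm_nonneg _

/-- Unlike in `onLattice_eq_leftEmb`, the region may be larger than the support, so that several
terms can be moved into one common tensor factor. -/
theorem exists_leftEmb_eq (p : Fin n → Prop) [DecidablePred p] (hp : ∀ v ∈ T.supp, p v) :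
    ∃ M, leftEmb (Equiv.piEquivPiSubtypeProd p fun _ => Fin d) M = T.onLattice := by
  refine ⟨of fun σ τ => if ∀ v : {v // p v}, (v : Fin n) ∉ T.supp → σ v = τ v then
    T.mat (fun i => σ ⟨T.site i, hp _ (T.mem_supp.2 ⟨i, rfl⟩)⟩)
      (fun i => τ ⟨T.site i, hp _ (T.mem_supp.2 ⟨i, rfl⟩)⟩) else 0, ?_⟩
  ext s t
  rw [leftEmb_apply, of_apply, onLattice, of_apply]
  simp only [Equiv.piEquivPiSubtypeProd_apply, funext_iff, Subtype.forall]
  rw [← ite_and]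
  refine if_congr ⟨fun h v hv => ?_, fun h => ⟨fun v hv => h v fun h' => hv (hp v h'),
    fun v _ => h v⟩⟩ rfl rfl
  by_cases hpv : p v
  · exact h.2 v hpv hv
  · exact h.1 v hpv

theorem exists_rightEmb_eq (p : Fin n → Prop) [DecidablePred p] (hp : ∀ v ∈ T.supp, ¬ p v) :
    ∃ M, rightEmb (Equiv.piEquivPiSubtypeProd p fun _ => Fin d) M = T.onLattice := by
  refine ⟨of fun σ τ => if ∀ v : {v // ¬ p v}, (v : Fin n) ∉ T.supp → σ v = τ v then
    T.mat (fun i => σ ⟨T.site i, hp _ (T.mem_supp.2 ⟨i, rfl⟩)⟩)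
      (fun i => τ ⟨T.site i, hp _ (T.mem_supp.2 ⟨i, rfl⟩)⟩) else 0, ?_⟩
  ext s t
  rw [rightEmb_apply, of_apply, onLattice, of_apply]
  simp only [Equiv.piEquivPiSubtypeProd_apply, funext_iff, Subtype.forall]
  rw [← ite_and]
  refine if_congr ⟨fun h v hv => ?_, fun h => ⟨fun v hv => h v fun h' => hp v h' hv,
    fun v _ => h v⟩⟩ rfl rfl
  by_cases hpv : p v
  · exact h.1 v hpv
  · exact h.2 v hpv hv

end LocalTerm

theorem List.sum_map_filter_eq {α M : Type*} [AddCommMonoid M] (l : List α) (p : α → Prop)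
    [DecidablePred p] (f : α → M) :
    ((l.filter fun a => p a).map f).sum = (l.map fun a => if p a then f a else 0).sum := by
  induction l with
  | nil => rfl
  | cons a l ih =>
    rw [List.filter_cons]
    split_ifs with h <;> simp_all

namespace LatticeHamiltonian

variable {D d n : ℕ} (H : LatticeHamiltonian D d n)

theorem toMatrix_eq_sum_fin : H.toMatrix = ∑ i : Fin H.terms.length, (H.terms[i]).onLattice := by
  rw [toMatrix]
  exact (Fin.sum_univ_fun_getElem H.terms LocalTerm.onLattice).symm

theorem HasGrowthConstant.sum_le {H : LatticeHamiltonian D d n} {g h : ℝ}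
    (hH : H.HasGrowthConstant g h) (x : Fin n) :
    ∑ i : Fin H.terms.length, (if x ∈ (H.terms[i]).supp then (H.terms[i]).opNorm else 0) ≤ g * h := by
  refine le_trans (le_of_eq ?_) (hH x)
  rw [List.sum_map_filter_eq]
  exact Fin.sum_univ_fun_getElem H.terms fun T => if x ∈ T.supp then T.opNorm else 0

/-- Supports are nonempty, so charging each norm to all sites of its support counts it at least
once; the growth constant bounds the charge at each of the `n` sites. -/
theorem HasGrowthConstant.norm_toMatrix_le {H : LatticeHamiltonian D d n} {g h : ℝ}
    (hH : H.HasGrowthConstant g h) : ‖H.toMatrix‖ ≤ n * (g * h) := by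
  rw [toMatrix_eq_sum_fin]
  calc ‖∑ i : Fin H.terms.length, (H.terms[i]).onLattice‖
      ≤ ∑ i : Fin H.terms.length, (H.terms[i]).opNorm :=
        norm_sum_le_of_le _ fun i _ => LocalTerm.norm_onLattice_le _
    _ ≤ ∑ i : Fin H.terms.length, ∑ x : Fin n,
          if x ∈ (H.terms[i]).supp then (H.terms[i]).opNorm else 0 :=
        Finset.sum_le_sum fun i _ => by
          obtain ⟨x, hx⟩ := H.nonempty _ (List.getElem_mem i.2)
          refine le_trans (le_of_eq ?_) (Finset.single_le_sum (f := fun x =>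
            if x ∈ (H.terms[i]).supp then (H.terms[i]).opNorm else 0) (fun y _ => ?_)
            (Finset.mem_univ x))
          · exact (if_pos hx).symm
          · split_ifs
            · exact LocalTerm.opNorm_nonneg _
            · exact le_rfl
    _ = ∑ x : Fin n, ∑ i : Fin H.terms.length,
          if x ∈ (H.terms[i]).supp then (H.terms[i]).opNorm else 0 := Finset.sum_comm
    _ ≤ ∑ x : Fin n, g * h := Finset.sum_le_sum fun x _ => hH.sum_le x
    _ = n * (g * h) := by simp

/-- The normalized partition function of a part of the interaction. -/
noncomputable def partialZ (z : ℂ) (A : Finset (Fin H.terms.length)) : ℂ :=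
  (NormedSpace.exp (∑ i ∈ A, -z • (H.terms[i]).onLattice)).trace / (d : ℂ) ^ n

theorem partialZ_empty (hd : 0 < d) (z : ℂ) : H.partialZ z ∅ = 1 := by
  have : (d : ℂ) ^ n ≠ 0 := pow_ne_zero _ (Nat.cast_ne_zero.2 hd.ne')
  rw [partialZ, Finset.sum_empty, NormedSpace.exp_zero, trace_one]
  simp [this]

/-- With `p` the union of the supports of `A`, the terms of `A` act on one tensor factor and those
of `B` on the other. The two exponents commute and the trace multiplies; the normalization by `d ^
n` removes the dimensions of the idle factors. -/
theorem partialZ_union (hd : 0 < d) (z : ℂ) (A B : Finset (Fin H.terms.length))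
    (hAB : ∀ i ∈ A, ∀ j ∈ B, Disjoint (H.terms[i]).supp (H.terms[j]).supp) :
    H.partialZ z (A ∪ B) = H.partialZ z A * H.partialZ z B := by
  classical
  have hdn : (d : ℂ) ^ n ≠ 0 := pow_ne_zero _ (Nat.cast_ne_zero.2 hd.ne')
  have hdisj : Disjoint A B := by
    rw [Finset.disjoint_left]
    intro i hi hi'
    have h1 := hAB i hi i hi'
    rw [disjoint_self] at h1
    exact (H.nonempty _ (List.getElem_mem i.2)).ne_empty h1
  let p : Fin n → Prop := fun v => ∃ i ∈ A, v ∈ (H.terms[i]).supp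
  let e := Equiv.piEquivPiSubtypeProd p fun _ => Fin d
  have hA : ∃ M, leftEmb e M = ∑ i ∈ A, -z • (H.terms[i]).onLattice := by
    refine ⟨∑ i ∈ A.attach, -z • ((H.terms[i.1]).exists_leftEmb_eq p
      fun v hv => ⟨i.1, i.2, hv⟩).choose, ?_⟩
    rw [map_sum, ← Finset.sum_attach A]
    refine Finset.sum_congr rfl fun i _ => ?_
    rw [map_smul]
    congr 1
    exact ((H.terms[i.1]).exists_leftEmb_eq p fun v hv => ⟨i.1, i.2, hv⟩).choose_spec
  have hB' : ∀ j ∈ B, ∀ v ∈ (H.terms[j]).supp, ¬ p v := by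
    rintro j hj v hv ⟨i, hi, hv'⟩
    exact Finset.disjoint_left.1 (hAB i hi j hj) hv' hv
  have hB : ∃ M, rightEmb e M = ∑ i ∈ B, -z • (H.terms[i]).onLattice := by
    refine ⟨∑ i ∈ B.attach, -z • ((H.terms[i.1]).exists_rightEmb_eq p
      (hB' i.1 i.2)).choose, ?_⟩
    rw [map_sum, ← Finset.sum_attach B]
    refine Finset.sum_congr rfl fun i _ => ?_
    rw [map_smul]
    congr 1
    exact ((H.terms[i.1]).exists_rightEmb_eq p (hB' i.1 i.2)).choose_spec
  obtain ⟨M, hM⟩ := hA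
  obtain ⟨N, hN⟩ := hB
  have h := trace_exp_leftEmb_add_rightEmb e M N
  rw [partialZ, partialZ, partialZ, Finset.sum_union hdisj, ← hM, ← hN, div_mul_div_comm, ← h]
  rw [Fintype.card_fun, Fintype.card_fin, Fintype.card_fin, Nat.cast_pow]
  field_simp

theorem norm_altSum_partialZ_le (hd : 0 < d) (z : ℂ) (B : Finset (Fin H.terms.length)) :
    ‖altSum (H.partialZ z) ∅ B‖ ≤ ∏ i ∈ B, (Real.exp (‖z‖ * (H.terms[i]).opNorm) - 1) := by
  have : Nonempty (Fin n → Fin d) := ⟨fun _ => ⟨0, hd⟩⟩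
  have hdn : (d : ℂ) ^ n ≠ 0 := pow_ne_zero _ (Nat.cast_ne_zero.2 hd.ne')
  have h1 : altSum (H.partialZ z) ∅ B = (altSum (fun C : Finset (Fin H.terms.length) => NormedSpace.exp
      (∑ i ∈ C, -z • (H.terms[i]).onLattice)) ∅ B).trace / (d : ℂ) ^ n := by
    rw [altSum, altSum, trace_sum, Finset.sum_div]
    refine Finset.sum_congr rfl fun C _ => ?_
    rw [trace_smul, partialZ, smul_div_assoc]
  rw [h1, norm_div, norm_pow, Complex.norm_natCast,
    div_le_iff₀ (pow_pos (Nat.cast_pos.2 hd) n), mul_comm]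
  refine (norm_trace_le _).trans ?_
  rw [Fintype.card_fun, Fintype.card_fin, Fintype.card_fin, Nat.cast_pow]
  refine mul_le_mul_of_nonneg_left ((norm_altSum_exp_le _ B).trans ?_) (by positivity)
  refine Finset.prod_le_prod (fun i _ => ?_) fun i _ => ?_
  · have := Real.one_le_exp (norm_nonneg (-z • (H.terms[i]).onLattice))
    linarith
  · rw [norm_smul, norm_neg]
    have := Real.exp_le_exp.2 (mul_le_mul_of_nonneg_left (H.terms[i]).norm_onLattice_le
      (norm_nonneg z))
    linarith

/-- With `y = exp q` the second inequality reduces to `1 ≤ (2 - y) * y ^ 3`, and `(2 - y) * y ^ 3 -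
1 = (y - 1) * (1 + y + y ^ 2 - y ^ 3)`. Both factors are nonnegative for `1 ≤ y < 3 / 2`, and `y < 3
/ 2` because `y ^ 4 ≤ e < (3 / 2) ^ 4`. -/
theorem exp_le_of_le_quarter {q : ℝ} (h0 : 0 ≤ q) (hq : q ≤ 1 / 4) :
    Real.exp q < 2 ∧ Real.exp q ≤ (2 - Real.exp q) * Real.exp (4 * q) := by
  have h1 : 1 ≤ Real.exp q := Real.one_le_exp h0
  have h2 : Real.exp q < 3 / 2 := by
    by_contra! h
    have h3 : (3 / 2 : ℝ) ^ 4 ≤ Real.exp q ^ 4 := pow_le_pow_left₀ (by norm_num) h 4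
    rw [← Real.exp_nat_mul] at h3
    have h4 : Real.exp ((4 : ℕ) * q) ≤ Real.exp 1 := Real.exp_le_exp.2 (by push_cast; linarith)
    have := Real.exp_one_lt_d9
    push_cast at h3 h4
    norm_num at h3
    linarith
  refine ⟨by linarith, ?_⟩
  have h3 : Real.exp (4 * q) = Real.exp q ^ 4 := by
    rw [← Real.exp_nat_mul]; norm_num
  rw [h3]
  set y := Real.exp q
  have h4 : 0 ≤ (y - 1) * (1 + y + y ^ 2 - y ^ 3) := by
    refine mul_nonneg (by linarith) ?_
    have h5 : y ^ 2 * (2 - y) ≥ 0 := mul_nonneg (sq_nonneg y) (by linarith)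
    nlinarith
  nlinarith

/-- The partition function has no zeros for `|z| ≤ 1.1 * β₀`. -/
theorem partialZ_ne_zero {κ R : ℕ} {g h : ℝ} (hd : 0 < d) (hκ : 1 ≤ κ) (hg : 0 < g) (hh : 0 < h)
    (hR : H.IsGeomLocal κ R) (hH : H.HasGrowthConstant g h) {z : ℂ}
    (hz : ‖z‖ ≤ 11 / 10 * betaZero g h κ) (A : Finset (Fin H.terms.length)) :
    H.partialZ z A ≠ 0 := by
  have hκ' : (1 : ℝ) ≤ κ := by exact_mod_cast hκ
  have hκ0 : (0 : ℝ) < κ := by linarith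
  have he := Real.exp_pos 1
  have he2 := Real.exp_one_gt_d9
  -- The parameters are `q = 1 / (4 * κ)` and `t = 4 * q = 1 / κ`, so that `exp (t * (κ - 1))` stays
  -- below `exp 1` for all `κ`.
  obtain ⟨h1, h2⟩ := exp_le_of_le_quarter (q := 1 / (4 * κ)) (by positivity) (by
    rw [div_le_div_iff₀ (by positivity) (by norm_num)]; linarith)
  have ht : 4 * (1 / (4 * (κ : ℝ))) = 1 / κ := by field_simp
  rw [ht] at h2
  have hW : ‖z‖ * (g * h) ≤ 11 / (50 * Real.exp 1 * κ) :=
    calc ‖z‖ * (g * h) ≤ 11 / 10 * betaZero g h κ * (g * h) :=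
          mul_le_mul_of_nonneg_right hz (by positivity)
      _ = _ := by rw [betaZero]; field_simp; norm_num
  refine (altSumBound_and_ne_zero (supp := fun i : Fin H.terms.length => (H.terms[i]).supp)
    (u := fun i => Real.exp (‖z‖ * (H.terms[i]).opNorm) - 1) (κ := κ) (t := 1 / κ)
    (q := 1 / (4 * κ)) (by positivity) (fun i => ?_) (fun i => (hR _ (List.getElem_mem i.2)).1)
    (fun i => H.nonempty _ (List.getElem_mem i.2)) (H.partialZ_empty hd z) (H.partialZ_union hd z)
    (H.norm_altSum_partialZ_le hd z) h1 h2 (fun A x hA => ?_) A).1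
  · have := Real.one_le_exp (mul_nonneg (norm_nonneg z) (H.terms[i]).opNorm_nonneg)
    linarith
  · have hsum : ∑ i ∈ A, (H.terms[i]).opNorm ≤ g * h := by
      refine le_trans ?_ (hH.sum_le x)
      calc ∑ i ∈ A, (H.terms[i]).opNorm = ∑ i ∈ A, if x ∈ (H.terms[i]).supp then
            (H.terms[i]).opNorm else 0 := Finset.sum_congr rfl fun i hi => (if_pos (hA i hi)).symm
        _ ≤ _ := Finset.sum_le_univ_sum_of_nonneg fun i => by
          split_ifs
          · exact LocalTerm.opNorm_nonneg _
          · exact le_rfl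
    -- This is `exp w - 1 ≤ w * exp w`, from `1 - w ≤ exp (-w)`, with the last exponent replaced by
    -- the total strength at `x`.
    have hle : ∀ i ∈ A, Real.exp (‖z‖ * (H.terms[i]).opNorm) - 1 ≤
        ‖z‖ * (H.terms[i]).opNorm * Real.exp (‖z‖ * (g * h)) := fun i hi => by
      have h3 : (H.terms[i]).opNorm ≤ g * h := (Finset.single_le_sum (f := fun i =>
        (H.terms[i]).opNorm) (fun i _ => (H.terms[i]).opNorm_nonneg) hi).trans hsum
      set w := ‖z‖ * (H.terms[i]).opNorm
      have hw : 0 ≤ w := mul_nonneg (norm_nonneg z) (H.terms[i]).opNorm_nonneg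
      have h4 : Real.exp w ≤ Real.exp (‖z‖ * (g * h)) :=
        Real.exp_le_exp.2 (mul_le_mul_of_nonneg_left h3 (norm_nonneg z))
      have h5 := Real.add_one_le_exp (-w)
      have h6 : Real.exp (-w) * Real.exp w = 1 := by rw [← Real.exp_add]; simp
      have h7 := Real.exp_pos w
      nlinarith
    -- The second exponent is `1 - 1 / κ`, and its slack `1 / κ` absorbs the first one.
    have hexp : Real.exp (‖z‖ * (g * h)) * Real.exp (1 / κ * (κ - 1)) ≤ Real.exp 1 := by
      rw [← Real.exp_add, Real.exp_le_exp]
      have h3 : 11 / (50 * Real.exp 1 * κ) ≤ 1 / κ := by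
        rw [div_le_div_iff₀ (by positivity) hκ0]
        nlinarith
      have h4 : 1 / (κ : ℝ) * (κ - 1) = 1 - 1 / κ := by field_simp
      linarith
    calc ∑ i ∈ A, (Real.exp (‖z‖ * (H.terms[i]).opNorm) - 1) * Real.exp (1 / κ * (κ - 1))
        ≤ ∑ i ∈ A, ‖z‖ * (H.terms[i]).opNorm * Real.exp (‖z‖ * (g * h)) *
            Real.exp (1 / κ * (κ - 1)) := Finset.sum_le_sum fun i hi =>
          mul_le_mul_of_nonneg_right (hle i hi) (Real.exp_pos _).le
      _ = ‖z‖ * (∑ i ∈ A, (H.terms[i]).opNorm) *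
            (Real.exp (‖z‖ * (g * h)) * Real.exp (1 / κ * (κ - 1))) := by
          rw [Finset.mul_sum, Finset.sum_mul]
          exact Finset.sum_congr rfl fun i _ => by ring
      _ ≤ 11 / (50 * Real.exp 1 * κ) * Real.exp 1 := mul_le_mul
          ((mul_le_mul_of_nonneg_left hsum (norm_nonneg z)).trans hW) hexp (by positivity)
          (by positivity)
      -- `11 / 50 < 1 / 4`: the constant 5 in `betaZero` leaves room for a disk that is larger by
      -- the factor `11 / 10`.
      _ ≤ 1 / (4 * κ) := by
          rw [div_mul_eq_mul_div, div_le_div_iff₀ (by positivity) (by positivity)]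
          nlinarith

end LatticeHamiltonian

end ZeroFreeness

/-! ### The logarithm of a function without zeros -/

section Logarithm

open Metric

/-- The Taylor coefficients at the origin. -/
noncomputable def taylorCoeff (f : ℂ → ℂ) (j : ℕ) : ℂ := iteratedDeriv j f 0 / j.factorial

/-- Newton's recurrence for the coefficients of a logarithm. -/
theorem taylorCoeff_recurrence {f g : ℂ → ℂ} (hf : AnalyticAt ℂ f 0) (hg : AnalyticAt ℂ g 0)
    (h : deriv f =ᶠ[nhds 0] deriv g * f) (hf0 : f 0 = 1) (N : ℕ) :
    N * taylorCoeff f N = N * taylorCoeff g N +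
      ∑ i ∈ Finset.range N, i * taylorCoeff g i * taylorCoeff f (N - i) := by
  rcases N with _ | N
  · simp
  have hfac : ∀ m : ℕ, ((m.factorial : ℕ) : ℂ) ≠ 0 := fun m =>
    Nat.cast_ne_zero.2 m.factorial_ne_zero
  -- The `N`-th derivative of `f' = g' * f` by the product rule; after division by factorials it is
  -- a Cauchy product.
  have key : ((N + 1 : ℕ) : ℂ) * taylorCoeff f (N + 1) = ∑ i ∈ Finset.range (N + 1),
      ((i + 1 : ℕ) : ℂ) * taylorCoeff g (i + 1) * taylorCoeff f (N - i) := by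
    rw [taylorCoeff, iteratedDeriv_succ', h.iteratedDeriv_eq, iteratedDeriv_mul
      hg.deriv.contDiffAt hf.contDiffAt, mul_div_assoc', div_eq_iff (hfac _), Finset.mul_sum,
      Finset.sum_mul]
    refine Finset.sum_congr rfl fun i hi => ?_
    have hi' : i ≤ N := Nat.lt_succ_iff.1 (Finset.mem_range.1 hi)
    rw [taylorCoeff, taylorCoeff, iteratedDeriv_succ', Nat.factorial_succ, Nat.factorial_succ,
      Nat.cast_choose ℂ hi']
    have h1 := hfac i
    have h2 := hfac (N - i)
    have h3 : ((i + 1 : ℕ) : ℂ) ≠ 0 := Nat.cast_ne_zero.2 i.succ_ne_zero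
    push_cast at h3 ⊢
    field_simp
  have h0 : taylorCoeff f 0 = 1 := by simp [taylorCoeff, hf0]
  rw [key, Finset.sum_range_succ, Nat.sub_self, h0, mul_one, add_comm, Finset.sum_range_succ']
  simp only [Nat.cast_zero, zero_mul, add_zero, Nat.add_sub_add_right]

/-- Take the primitive `g` of `f' / f` with `g 0 = 0`. The product `f * exp (-g)` has derivative
zero, so it keeps its value 1 at the origin. -/
theorem exists_logarithm {f : ℂ → ℂ} {R : ℝ} (hR : 0 < R) (hf : DifferentiableOn ℂ f (ball 0 R))
    (hf0 : f 0 = 1) (hne : ∀ z ∈ ball (0 : ℂ) R, f z ≠ 0) :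
    ∃ g : ℂ → ℂ, g 0 = 0 ∧ (∀ z ∈ ball (0 : ℂ) R, HasDerivAt g (deriv f z / f z) z) ∧
      ∀ z ∈ ball (0 : ℂ) R, f z = Complex.exp (g z) := by
  have h0 : (0 : ℂ) ∈ ball (0 : ℂ) R := mem_ball_self hR
  obtain ⟨g, hg0, hg⟩ := ((hf.deriv isOpen_ball).div hf hne).isExactOn_ball.with_val_at 0 0
  refine ⟨g, hg0, hg, fun z hz => ?_⟩
  have hd : ∀ z ∈ ball (0 : ℂ) R, HasDerivAt (fun z => f z * Complex.exp (-g z)) 0 z := fun z hz => by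
    have h1 := (hf.differentiableAt (isOpen_ball.mem_nhds hz)).hasDerivAt.mul ((hg z hz).neg.cexp)
    refine h1.congr_deriv ?_
    have := hne z hz
    simp only [Pi.div_apply, Pi.neg_apply]
    field_simp
    ring
  have h2 := isOpen_ball.is_const_of_deriv_eq_zero (convex_ball (0 : ℂ) R).isPreconnected
    (fun z hz => (hd z hz).differentiableAt.differentiableWithinAt)
    (fun z hz => (hd z hz).deriv) hz h0
  simp only [hf0, hg0, neg_zero, Complex.exp_zero, mul_one] at h2
  rw [Complex.exp_neg] at h2
  have h3 := Complex.exp_ne_zero (g z)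
  field_simp at h2
  exact h2

/-- The coefficients of the logarithm of a function without zeros on a disk. -/
theorem exists_log_coeff {f : ℂ → ℂ} {R ρ M : ℝ} (hρ : 0 < ρ) (hρR : ρ < R) (hM : 0 < M)
    (hf : DifferentiableOn ℂ f (ball 0 R)) (hf0 : f 0 = 1) (hne : ∀ z ∈ ball (0 : ℂ) R, f z ≠ 0)
    (hfM : ∀ z ∈ ball (0 : ℂ) R, ‖f z‖ ≤ Real.exp M) :
    ∃ c : ℕ → ℂ, c 0 = 0 ∧ (∀ j, ‖c j‖ ≤ 2 * M * ρ / (R - ρ) / ρ ^ j) ∧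
      (∀ z ∈ ball (0 : ℂ) R, ∃ E, HasSum (fun j => c j * z ^ j) E ∧ f z = Complex.exp E) ∧
      ∀ N : ℕ, N * taylorCoeff f N =
        N * c N + ∑ i ∈ Finset.range N, i * c i * taylorCoeff f (N - i) := by
  have hR : 0 < R := hρ.trans hρR
  obtain ⟨g, hg0, hg, hfg⟩ := exists_logarithm hR hf hf0 hne
  have hgd : DifferentiableOn ℂ g (ball 0 R) := fun z hz =>
    (hg z hz).differentiableAt.differentiableWithinAt
  have h0 : ball (0 : ℂ) R ∈ nhds 0 := ball_mem_nhds _ hR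
  -- The growth of `f` bounds the real part of `g` from above, which is all that Borel-Carathéodory
  -- needs to bound `‖g‖` on the circle of radius `ρ`. Cauchy's estimate on that circle then bounds
  -- the coefficients.
  have hgM : Set.MapsTo g (ball 0 R) {z | z.re ≤ M} := fun z hz => by
    have h1 := hfM z hz
    rwa [hfg z hz, Complex.norm_exp, Real.exp_le_exp] at h1
  refine ⟨taylorCoeff g, by simp [taylorCoeff, hg0], fun j => ?_, fun z hz => ⟨g z, ?_, hfg z hz⟩,
    fun N => taylorCoeff_recurrence (hf.analyticAt h0) (hgd.analyticAt h0) ?_ hf0 N⟩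
  · have h1 := Complex.norm_iteratedDeriv_le_of_forall_mem_sphere_norm_le (f := g) (c := 0)
      (C := 2 * M * ρ / (R - ρ)) j hρ
      ((hgd.mono (closedBall_subset_ball hρR)).diffContOnCl_ball (subset_refl _)) (fun z hz => ?_)
    · rw [taylorCoeff, norm_div, Complex.norm_natCast, div_le_iff₀ (by positivity)]
      refine h1.trans (le_of_eq ?_)
      ring
    · have hz' : ‖z‖ = ρ := mem_sphere_zero_iff_norm.1 hz
      have h2 := Complex.borelCaratheodory_zero hM hgd hgM hR
        (mem_ball_zero_iff.2 (hz'.trans_lt hρR)) hg0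
      rwa [hz'] at h2
  · have h1 := Complex.hasSum_taylorSeries_on_ball hgd hz
    refine h1.congr_fun fun j => ?_
    rw [taylorCoeff, sub_zero, smul_eq_mul, smul_eq_mul]
    ring
  · filter_upwards [h0] with z hz
    rw [Pi.mul_apply, (hg z hz).deriv, div_mul_cancel₀ _ (hne z hz)]

/-- The tail of a geometrically bounded series. -/
theorem norm_sub_sum_le_of_geometric {b : ℕ → ℂ} {E : ℂ} {C r : ℝ} (hr0 : 0 ≤ r) (hr : r < 1)
    (hb0 : b 0 = 0) (hb : ∀ j, ‖b j‖ ≤ C * r ^ j) (hE : HasSum b E) (k : ℕ) :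
    ‖E - ∑ j ∈ Finset.range k, b (j + 1)‖ ≤ C * r ^ (k + 1) / (1 - r) := by
  have h1 : ∑ j ∈ Finset.range k, b (j + 1) = ∑ j ∈ Finset.range (k + 1), b j := by
    rw [Finset.sum_range_succ', hb0, add_zero]
  have h2 := (hasSum_nat_add_iff' (k + 1)).2 hE
  rw [h1, ← h2.tsum_eq]
  refine tsum_of_norm_bounded (g := fun j => C * r ^ (k + 1) * r ^ j)
    ((hasSum_geometric_of_lt_one hr0 hr).mul_left _) fun j => (hb _).trans (le_of_eq ?_)
  ring

/-- The tail of the exponential series. -/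
theorem exp_sub_sum_le {x : ℝ} (hx : 0 ≤ x) (M : ℕ) :
    Real.exp x - ∑ m ∈ Finset.range M, x ^ m / m.factorial ≤ Real.exp (2 * x) / 2 ^ M := by
  have hs : ∀ y : ℝ, HasSum (fun m : ℕ => y ^ m / m.factorial) (Real.exp y) := fun y => by
    have := NormedSpace.expSeries_div_hasSum_exp y
    rwa [← Real.exp_eq_exp_ℝ] at this
  have h1 := (hasSum_nat_add_iff' M).2 (hs x)
  have h2 := (hasSum_nat_add_iff' M).2 (hs (2 * x))
  have h3 : Real.exp (2 * x) - ∑ m ∈ Finset.range M, (2 * x) ^ m / m.factorial ≤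
      Real.exp (2 * x) := by
    have : 0 ≤ ∑ m ∈ Finset.range M, (2 * x) ^ m / m.factorial :=
      Finset.sum_nonneg fun m _ => by positivity
    linarith
  refine le_trans (hasSum_le (fun m => ?_) h1 (h2.div_const (2 ^ M)))
    (div_le_div_of_nonneg_right h3 (by positivity))
  rw [mul_pow, div_div, div_le_div_iff₀ (by positivity) (by positivity)]
  -- Every term of the tail at `2 * x` is at least `2 ^ M` times the corresponding term at `x`.
  have h4 : (2 : ℝ) ^ M ≤ 2 ^ (m + M) := pow_le_pow_right₀ (by norm_num) (by omega)
  have h5 : 0 ≤ x ^ (m + M) * ((m + M).factorial : ℝ) := by positivity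
  nlinarith

end Logarithm

/-! ### The partition function as a function of the temperature -/

namespace LatticeHamiltonian

open Matrix
open scoped Matrix.Norms.L2Operator

variable {D d n : ℕ} (H : LatticeHamiltonian D d n)

/-- The normalized partition function. -/
noncomputable def normalizedZ (z : ℂ) : ℂ := H.partitionFunction z / (d : ℂ) ^ n

theorem partitionFunction_eq (hd : 0 < d) (z : ℂ) :
    H.partitionFunction z = (d : ℂ) ^ n * H.normalizedZ z := by
  rw [normalizedZ, mul_div_cancel₀]
  exact pow_ne_zero _ (Nat.cast_ne_zero.2 hd.ne')

theorem normalizedZ_eq_partialZ (z : ℂ) : H.normalizedZ z = H.partialZ z Finset.univ := by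
  rw [normalizedZ, partitionFunction, partialZ, toMatrix_eq_sum_fin, Finset.smul_sum]

theorem normalizedZ_zero (hd : 0 < d) : H.normalizedZ 0 = 1 := by
  rw [← H.partialZ_empty hd 0, normalizedZ_eq_partialZ, partialZ, partialZ]
  simp

theorem hasDerivAt_trace_mul_exp (A B : Matrix (Fin n → Fin d) (Fin n → Fin d) ℂ) (z : ℂ) :
    HasDerivAt (fun z : ℂ => (A * NormedSpace.exp (z • B)).trace)
      (A * B * NormedSpace.exp (z • B)).trace z := by
  have h1 := hasDerivAt_exp_smul_const' (𝕂 := ℂ) B z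
  let L : Matrix (Fin n → Fin d) (Fin n → Fin d) ℂ →ₗ[ℂ] ℂ :=
    (traceLinearMap _ ℂ ℂ) ∘ₗ LinearMap.mulLeft ℂ A
  have h2 := L.toContinuousLinearMap.hasFDerivAt.comp_hasDerivAt z h1
  rw [mul_assoc]
  exact h2

theorem iteratedDeriv_normalizedZ (k : ℕ) : iteratedDeriv k H.normalizedZ =
    fun z => ((-H.toMatrix) ^ k * NormedSpace.exp (z • -H.toMatrix)).trace / (d : ℂ) ^ n := by
  induction k with
  | zero =>
    ext z
    rw [iteratedDeriv_zero, pow_zero, one_mul, normalizedZ, partitionFunction, neg_smul, smul_neg]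
  | succ k ih =>
    ext z
    rw [iteratedDeriv_succ, ih, pow_succ]
    exact ((hasDerivAt_trace_mul_exp _ _ z).div_const _).deriv

theorem taylorCoeff_normalizedZ (k : ℕ) : taylorCoeff H.normalizedZ k =
    ((-H.toMatrix) ^ k).trace / ((d : ℂ) ^ n * k.factorial) := by
  rw [taylorCoeff, iteratedDeriv_normalizedZ]
  beta_reduce
  rw [zero_smul, NormedSpace.exp_zero, mul_one, div_div]

theorem differentiable_normalizedZ : Differentiable ℂ H.normalizedZ := fun z => by
  have h := (hasDerivAt_trace_mul_exp 1 (-H.toMatrix) z).differentiableAt.div_const ((d : ℂ) ^ n)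
  refine h.congr_of_eventuallyEq (Filter.Eventually.of_forall fun w => ?_)
  beta_reduce
  rw [normalizedZ, partitionFunction, one_mul, neg_smul, smul_neg]

theorem norm_normalizedZ_le (hd : 0 < d) {B : ℝ} (hB : ‖H.toMatrix‖ ≤ B) (z : ℂ) :
    ‖H.normalizedZ z‖ ≤ Real.exp (‖z‖ * B) := by
  have : Nonempty (Fin n → Fin d) := ⟨fun _ => ⟨0, hd⟩⟩
  rw [normalizedZ, partitionFunction, norm_div, norm_pow, Complex.norm_natCast,
    div_le_iff₀ (pow_pos (Nat.cast_pos.2 hd) n), mul_comm]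
  refine (norm_trace_le _).trans ?_
  rw [Fintype.card_fun, Fintype.card_fin, Fintype.card_fin, Nat.cast_pow]
  refine mul_le_mul_of_nonneg_left ?_ (by positivity)
  rw [← (NormedSpace.exp_series_hasSum_exp' (𝕂 := ℂ) (-z • H.toMatrix)).tsum_eq]
  have hs := NormedSpace.expSeries_div_hasSum_exp (‖z‖ * B)
  rw [← Real.exp_eq_exp_ℝ] at hs
  refine tsum_of_norm_bounded hs fun m => ?_
  rw [norm_smul, norm_inv, Complex.norm_natCast, div_eq_inv_mul]
  refine mul_le_mul_of_nonneg_left ((norm_pow_le _ m).trans ?_) (by positivity)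
  refine pow_le_pow_left₀ (norm_nonneg _) ?_ m
  rw [norm_smul, norm_neg]
  exact mul_le_mul_of_nonneg_left hB (norm_nonneg z)

/-- The logarithm of the normalized partition function. -/
theorem exists_logZ_coeff {κ R : ℕ} {g h : ℝ} (hd : 0 < d) (hκ : 1 ≤ κ) (hg : 0 < g) (hh : 0 < h)
    (hn : 0 < n) (hR : H.IsGeomLocal κ R) (hH : H.HasGrowthConstant g h) :
    ∃ c : ℕ → ℂ, c 0 = 0 ∧
      (∀ z : ℂ, ‖z‖ ≤ betaZero g h κ → (∀ j, ‖c j * z ^ j‖ ≤ 4 * n * (20 / 21) ^ j) ∧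
        ∃ E, HasSum (fun j => c j * z ^ j) E ∧ H.normalizedZ z = Complex.exp E) ∧
      ∀ N : ℕ, N * taylorCoeff H.normalizedZ N =
        N * c N + ∑ i ∈ Finset.range N, i * c i * taylorCoeff H.normalizedZ (N - i) := by
  have hκ' : (1 : ℝ) ≤ κ := by exact_mod_cast hκ
  have hn' : (0 : ℝ) < n := by exact_mod_cast hn
  have hκ0 : (0 : ℝ) < κ := by linarith
  have hb : 0 < betaZero g h κ := by
    rw [betaZero]
    positivity
  set b := betaZero g h κ with hbdef
  set M := 11 / 10 * b * (n * (g * h)) with hMdef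
  -- The circle of radius `21 / 20 * b` lies between the disk of evaluation, of radius `b`, and the
  -- zero-free disk; its ratio to `b` gives the decay rate `20 / 21`. The constant is `42 * M`,
  -- where `M = 11 * n / (50 * e * κ)`, and this is at most `4 * n`.
  obtain ⟨c, h0, h1, h2, h3⟩ := exists_log_coeff (f := H.normalizedZ) (R := 11 / 10 * b)
    (ρ := 21 / 20 * b) (M := M) (by positivity) (by linarith) (by positivity)
    H.differentiable_normalizedZ.differentiableOn (H.normalizedZ_zero hd) (fun z hz => by
      rw [normalizedZ_eq_partialZ]
      exact H.partialZ_ne_zero hd hκ hg hh hR hH (mem_ball_zero_iff.1 hz).le _) (fun z hz => by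
      refine (H.norm_normalizedZ_le hd hH.norm_toMatrix_le z).trans (Real.exp_le_exp.2 ?_)
      exact mul_le_mul_of_nonneg_right (mem_ball_zero_iff.1 hz).le (by positivity))
  refine ⟨c, h0, fun z hz => ⟨fun j => ?_, h2 z (mem_ball_zero_iff.2 (by linarith))⟩, h3⟩
  have hM : 2 * M * (21 / 20 * b) / (11 / 10 * b - 21 / 20 * b) ≤ 4 * n := by
    have he2 := Real.exp_one_gt_d9
    have h4 : 2 * M * (21 / 20 * b) / (11 / 10 * b - 21 / 20 * b) = 42 * M := by
      field_simp
      norm_num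
      ring
    have h5 : M = 11 / (50 * Real.exp 1 * κ) * n := by
      rw [hMdef, hbdef, betaZero]
      have := Real.exp_pos 1
      field_simp
      norm_num
    rw [h4, h5, ← mul_assoc]
    refine mul_le_mul_of_nonneg_right ?_ hn'.le
    rw [mul_div_assoc', div_le_iff₀ (by positivity)]
    nlinarith
  have h6 : ‖z‖ / (21 / 20 * b) ≤ 20 / 21 := by
    rw [div_le_iff₀ (by positivity)]
    linarith
  calc ‖c j * z ^ j‖ = ‖c j‖ * ‖z‖ ^ j := by rw [norm_mul, norm_pow]
    _ ≤ 4 * n / (21 / 20 * b) ^ j * ‖z‖ ^ j := by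
      refine mul_le_mul_of_nonneg_right ((h1 j).trans ?_) (by positivity)
      exact div_le_div_of_nonneg_right hM (by positivity)
    _ = 4 * n * (‖z‖ / (21 / 20 * b)) ^ j := by rw [div_pow]; ring
    _ ≤ _ := mul_le_mul_of_nonneg_left (pow_le_pow_left₀ (by positivity) h6 j) (by positivity)

end LatticeHamiltonian

/-! ### Correctness of the algorithm -/

namespace Instance

open Matrix

variable {D d κ : ℕ} (I : Instance D d κ)

/-- The inverse temperature. -/
noncomputable def beta : ℂ := gaussToComplex I.β

theorem toComplex_zeta :
    GaussianInt.toComplex I.zeta = I.beta * ((I.β.1.den * I.β.2.den : ℕ) : ℂ) := by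
  have h1 : ((I.β.1.den : ℕ) : ℂ) ≠ 0 := Nat.cast_ne_zero.2 I.β.1.den_ne_zero
  have h2 : ((I.β.2.den : ℕ) : ℂ) ≠ 0 := Nat.cast_ne_zero.2 I.β.2.den_ne_zero
  rw [GaussianInt.toComplex_def, beta, gaussToComplex, zeta, Rat.cast_def I.β.1, Rat.cast_def I.β.2]
  push_cast
  field_simp

/-- The denominator is made homogeneous in the degree: each of the `N` factors of `base` clears the
entries of `H` and `β` and supplies `k !` and `d ^ n`. Only `N !` and a single `d ^ n` are actually
needed, so the surplus `d ^ (n * (N - 1)) * (k ! ^ N / N !)` is multiplied into the numerator. -/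
theorem toComplex_scaledMoment {k N : ℕ} (hN : 0 < N) (hNk : N ≤ k) :
    GaussianInt.toComplex (I.scaledMoment k N) =
      taylorCoeff I.H.normalizedZ N * I.beta ^ N * (I.base k : ℂ) ^ N := by
  have hdvd : N.factorial ∣ k.factorial ^ N :=
    (Nat.factorial_dvd_factorial hNk).trans (dvd_pow_self _ hN.ne')
  have hfac : ((N.factorial : ℕ) : ℂ) ≠ 0 := Nat.cast_ne_zero.2 N.factorial_ne_zero
  have hd : (d : ℂ) ≠ 0 := Nat.cast_ne_zero.2 I.d_pos.ne'
  have hdn : (d : ℂ) ^ (I.n * N) = (d : ℂ) ^ (I.n * (N - 1)) * (d : ℂ) ^ I.n := by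
    rw [← pow_add]
    congr 1
    obtain ⟨M, rfl⟩ := Nat.exists_eq_add_of_lt hN
    simp
    ring
  have hQ : (((I.Q : ℂ) • I.H.toMatrix) ^ N).trace = (I.Q : ℂ) ^ N * (I.H.toMatrix ^ N).trace := by
    rw [smul_pow, trace_smul, smul_eq_mul]
  have hneg : ((-I.H.toMatrix) ^ N).trace = (-1) ^ N * (I.H.toMatrix ^ N).trace := by
    rw [← neg_one_smul ℂ I.H.toMatrix, smul_pow, trace_smul, smul_eq_mul]
  rw [scaledMoment, if_pos hN, map_mul, map_mul, map_pow, map_neg, toComplex_zeta,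
    toComplex_moment, map_natCast, Nat.cast_mul (d ^ _), Nat.cast_div hdvd hfac,
    I.H.taylorCoeff_normalizedZ, hQ, hneg, base, neg_pow]
  push_cast
  rw [mul_pow (_ * _ : ℂ) ((d : ℂ) ^ I.n) N, ← pow_mul, hdn]
  field_simp
  ring

variable {I}

/-- Newton's recurrence is homogeneous, so `β ^ j * base ^ j` comes out of every summand. The value
of `scaledMoment` at 0 does not matter: inside the sum `j - i` is positive, and for `j = 0` it is
multiplied by 0. -/
theorem toComplex_logCoeff {c : ℕ → ℂ} (hc : ∀ N : ℕ, N * taylorCoeff I.H.normalizedZ N =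
    N * c N + ∑ i ∈ Finset.range N, i * c i * taylorCoeff I.H.normalizedZ (N - i)) {k j : ℕ}
    (hj : j ≤ k) : GaussianInt.toComplex (I.logCoeff k j) =
      j * c j * I.beta ^ j * (I.base k : ℂ) ^ j := by
  induction j using Nat.strong_induction_on with
  | _ j ih =>
    rcases Nat.eq_zero_or_pos j with rfl | hj0
    · rw [logCoeff_eq]
      simp
    have h1 : ∑ i ∈ Finset.range j, GaussianInt.toComplex (I.logCoeff k i) *
        GaussianInt.toComplex (I.scaledMoment k (j - i)) =
        (∑ i ∈ Finset.range j, i * c i * taylorCoeff I.H.normalizedZ (j - i)) * I.beta ^ j *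
          (I.base k : ℂ) ^ j := by
      rw [Finset.sum_mul, Finset.sum_mul]
      refine Finset.sum_congr rfl fun i hi => ?_
      rw [Finset.mem_range] at hi
      rw [ih i hi (by omega), I.toComplex_scaledMoment (by omega) (by omega)]
      obtain ⟨e, rfl⟩ := Nat.exists_eq_add_of_lt hi
      rw [show i + e + 1 - i = e + 1 by omega]
      ring
    rw [logCoeff_eq, map_sub, map_mul, map_natCast, map_sum]
    simp only [map_mul]
    rw [h1, I.toComplex_scaledMoment hj0 hj]
    linear_combination (I.beta ^ j * (I.base k : ℂ) ^ j) * hc j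

theorem toComplex_logNum {c : ℕ → ℂ} (hc : ∀ N : ℕ, N * taylorCoeff I.H.normalizedZ N =
    N * c N + ∑ i ∈ Finset.range N, i * c i * taylorCoeff I.H.normalizedZ (N - i)) (k : ℕ) :
    GaussianInt.toComplex (I.logNum k) =
      (I.logDen k : ℂ) * ∑ i ∈ Finset.range k, c (i + 1) * I.beta ^ (i + 1) := by
  rw [logNum, map_sum, Finset.mul_sum]
  refine Finset.sum_congr rfl fun i hi => ?_
  rw [Finset.mem_range] at hi
  have h1 : ((i + 1 : ℕ) : ℂ) ≠ 0 := Nat.cast_ne_zero.2 i.succ_ne_zero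
  rw [map_mul, map_natCast, toComplex_logCoeff hc hi, Nat.cast_mul, logDen,
    Nat.cast_div (Nat.dvd_factorial i.succ_pos hi) h1]
  push_cast at h1 ⊢
  have h2 : (I.base k : ℂ) ^ k = (I.base k : ℂ) ^ (i + 1) * (I.base k : ℂ) ^ (k - (i + 1)) := by
    rw [← pow_add]
    congr 1
    omega
  rw [h2]
  field_simp

variable (I)

theorem base_pos (k : ℕ) : 0 < I.base k :=
  Nat.mul_pos (Nat.mul_pos k.factorial_pos (Nat.mul_pos I.Q_pos
    (Nat.mul_pos (Rat.den_pos _) (Rat.den_pos _)))) (pow_pos I.d_pos _)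

theorem logDen_pos (k : ℕ) : 0 < I.logDen k := Nat.mul_pos (pow_pos (I.base_pos k) k) k.factorial_pos

theorem outDen_pos (k M : ℕ) : 0 < I.outDen k M :=
  Nat.mul_pos (pow_pos (I.logDen_pos k) M) M.factorial_pos

variable {I}

theorem toComplex_outNum_div {k : ℕ} {T : ℂ}
    (hT : GaussianInt.toComplex (I.logNum k) = (I.logDen k : ℂ) * T) (M : ℕ) :
    GaussianInt.toComplex (I.outNum k M) / (I.outDen k M : ℂ) =
      (d : ℂ) ^ I.n * ∑ N ∈ Finset.range M, T ^ N / N.factorial := by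
  have h0 : (I.outDen k M : ℂ) ≠ 0 := Nat.cast_ne_zero.2 (I.outDen_pos k M).ne'
  rw [div_eq_iff h0, outNum, map_mul, map_natCast, map_sum, mul_assoc, Finset.sum_mul, Nat.cast_pow]
  congr 1
  refine Finset.sum_congr rfl fun N hN => ?_
  rw [Finset.mem_range] at hN
  have h1 : ((N.factorial : ℕ) : ℂ) ≠ 0 := Nat.cast_ne_zero.2 N.factorial_ne_zero
  rw [map_mul, map_pow, map_natCast, hT, Nat.cast_mul, outDen,
    Nat.cast_div (Nat.factorial_dvd_factorial hN.le) h1]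
  push_cast
  have h2 : (I.logDen k : ℂ) ^ M = (I.logDen k : ℂ) ^ N * (I.logDen k : ℂ) ^ (M - N) := by
    rw [← pow_add]
    congr 1
    omega
  rw [h2, mul_pow]
  field_simp

variable (I)

/-- The accuracy in terms of the number of bits `L`. -/
theorem quo_lt : (I.n : ℝ) / (I.ε : ℝ) < 2 ^ I.L := by
  have h1 : I.n * I.ε.den / I.ε.num.toNat < 2 ^ I.L := Nat.lt_size_self _
  have hp := I.num_pos
  rw [Nat.div_lt_iff_lt_mul (by omega)] at h1
  have h2 : ((I.n * I.ε.den : ℕ) : ℝ) < ((2 ^ I.L * I.ε.num.toNat : ℕ) : ℝ) := Nat.cast_lt.2 h1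
  have h3 : ((I.ε.num.toNat : ℕ) : ℝ) = (I.ε.num : ℝ) := by
    exact_mod_cast Int.toNat_of_nonneg hp.le
  have h4 : (0 : ℝ) < I.ε.num := by exact_mod_cast hp
  have h5 : (0 : ℝ) < I.ε.den := by exact_mod_cast I.ε.den_pos
  push_cast at h2
  rw [h3] at h2
  rw [Rat.cast_def, div_div_eq_mul_div, div_lt_iff₀ h4]
  exact h2

theorem two_pow_le : (2 : ℝ) ^ (I.L - 1) ≤ (I.n : ℝ) / (I.ε : ℝ) := by
  have hL := I.one_lt_L
  have h1 : 2 ^ (I.L - 1) ≤ I.n * I.ε.den / I.ε.num.toNat := Nat.lt_size.1 (by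
    change I.L - 1 < I.L
    omega)
  have hp := I.num_pos
  rw [Nat.le_div_iff_mul_le (by omega)] at h1
  have h2 : ((2 ^ (I.L - 1) * I.ε.num.toNat : ℕ) : ℝ) ≤ ((I.n * I.ε.den : ℕ) : ℝ) :=
    Nat.cast_le.2 h1
  have h3 : ((I.ε.num.toNat : ℕ) : ℝ) = (I.ε.num : ℝ) := by
    exact_mod_cast Int.toNat_of_nonneg hp.le
  have h4 : (0 : ℝ) < I.ε.num := by exact_mod_cast hp
  have h5 : (0 : ℝ) < I.ε.den := by exact_mod_cast I.ε.den_pos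
  push_cast at h2
  rw [h3] at h2
  rw [Rat.cast_def, div_div_eq_mul_div, le_div_iff₀ h4]
  exact h2

/-- From `(L - 1) * log 2 ≤ log (n / ε)` and `log 2 ≤ log (n / ε)` one gets `L ≤ (2 / log 2) * log
(n / ε)`, and `2 / log 2 < 3`. -/
theorem X_le : (I.X : ℝ) ≤
    ((RAM.maxBits I.input : ℝ) * (I.n : ℝ) ^ Real.log ((I.n : ℝ) / (I.ε : ℝ))) ^ 3 := by
  have hn : (2 : ℝ) ≤ I.n := by exact_mod_cast I.two_le
  have hε : (0 : ℝ) < I.ε := by exact_mod_cast I.ε_pos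
  have hε1 : (I.ε : ℝ) < 1 := by exact_mod_cast I.ε_lt
  have hb : (2 : ℝ) ≤ RAM.maxBits I.input := by exact_mod_cast I.two_le_maxBits
  have hq : 2 ≤ (I.n : ℝ) / I.ε := by
    rw [le_div_iff₀ hε]
    nlinarith
  have h1 := Real.log_le_log (by norm_num) hq
  have h2 := Real.log_le_log (by positivity) I.two_pow_le
  rw [Real.log_pow, Nat.cast_sub I.one_lt_L.le, Nat.cast_one] at h2
  have h3 := Real.log_two_gt_d9
  have h4 : (I.L : ℝ) ≤ Real.log ((I.n : ℝ) / I.ε) * 3 := by nlinarith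
  rw [X, Nat.cast_mul, Nat.cast_pow, mul_pow]
  refine mul_le_mul (le_self_pow₀ (by linarith) (by norm_num)) ?_ (by positivity) (by positivity)
  rw [← Real.rpow_natCast (I.n : ℝ), ← Real.rpow_natCast (_ ^ _) 3, ← Real.rpow_mul (by linarith)]
  exact Real.rpow_le_rpow_of_exponent_le (by linarith) (by push_cast; exact h4)

end Instance

/-- The error of the truncated exponential of an approximate logarithm. -/
theorem norm_sum_sub_exp_le {E T : ℂ} {B η : ℝ} {M : ℕ} (hE : ‖E‖ ≤ B) (hT : ‖T‖ ≤ B)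
    (hη1 : η ≤ 1) (hET : ‖E - T‖ ≤ η / 4) (hM : 2 * Real.exp (3 * B) ≤ η * 2 ^ M) :
    ‖∑ N ∈ Finset.range M, T ^ N / N.factorial - Complex.exp E‖ ≤ η * ‖Complex.exp E‖ := by
  have h1 : ‖Complex.exp T - Complex.exp E‖ ≤ η / 2 * ‖Complex.exp E‖ := by
    have h2 : Complex.exp T - Complex.exp E = Complex.exp E * (Complex.exp (T - E) - 1) := by
      rw [mul_sub, mul_one, ← Complex.exp_add]
      ring_nf
    have h3 : ‖T - E‖ ≤ η / 4 := by rwa [norm_sub_rev]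
    have h4 := Complex.norm_exp_sub_one_le (x := T - E) (by linarith)
    rw [h2, norm_mul, mul_comm]
    exact mul_le_mul_of_nonneg_right (by linarith) (norm_nonneg _)
  have h5 : ‖∑ N ∈ Finset.range M, T ^ N / N.factorial - Complex.exp T‖ ≤
      η / 2 * ‖Complex.exp E‖ := by
    rw [norm_sub_rev]
    refine (Complex.norm_exp_sub_sum_le_exp_norm_sub_sum T M).trans
      ((exp_sub_sum_le (norm_nonneg T) M).trans ?_)
    -- The error is relative to `‖exp E‖`, which may be as small as `exp (-B)`. Hence `3 * B` in
    -- `hM`: twice `B` for the tail of the series and once for this.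
    have h6 : Real.exp (-B) ≤ ‖Complex.exp E‖ := by
      rw [Complex.norm_exp, Real.exp_le_exp]
      have := (abs_le.1 (Complex.abs_re_le_norm E)).1
      linarith
    have h7 : Real.exp (2 * ‖T‖) ≤ Real.exp (3 * B) * Real.exp (-B) := by
      rw [← Real.exp_add, Real.exp_le_exp]
      linarith
    have h8 := Real.exp_pos (-B)
    rw [div_le_iff₀ (by positivity)]
    have h9 : 0 ≤ η / 2 * 2 ^ M := by
      have := Real.exp_pos (3 * B)
      linarith
    calc Real.exp (2 * ‖T‖) ≤ Real.exp (3 * B) * Real.exp (-B) := h7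
      _ ≤ η / 2 * 2 ^ M * Real.exp (-B) := mul_le_mul_of_nonneg_right (by linarith) h8.le
      _ ≤ η / 2 * 2 ^ M * ‖Complex.exp E‖ := mul_le_mul_of_nonneg_left h6 h9
      _ = _ := by ring
  have h10 := norm_sub_le_norm_sub_add_norm_sub (∑ N ∈ Finset.range M, T ^ N / N.factorial)
    (Complex.exp T) (Complex.exp E)
  linarith

namespace Instance

variable {D d κ : ℕ} (I : Instance D d κ)

/-- The accuracy of the output of the algorithm. -/
theorem norm_outNum_div_sub_le {R : ℕ} {g h : ℝ} (hκ : 1 ≤ κ) (hg : 0 < g) (hh : 0 < h)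
    (hR : I.H.IsGeomLocal κ R) (hH : I.H.HasGrowthConstant g h)
    (hβ : ‖I.beta‖ ≤ betaZero g h κ) :
    ‖GaussianInt.toComplex (I.outNum (140 * I.L) (400 * (I.n + I.L))) /
      (I.outDen (140 * I.L) (400 * (I.n + I.L)) : ℂ) - I.H.partitionFunction I.beta‖ ≤
      (I.ε : ℝ) * ‖I.H.partitionFunction I.beta‖ := by
  have hn : (2 : ℝ) ≤ I.n := by exact_mod_cast I.two_le
  have hε : (0 : ℝ) < I.ε := by exact_mod_cast I.ε_pos
  have hε1 : (I.ε : ℝ) < 1 := by exact_mod_cast I.ε_lt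
  have hq := I.quo_lt
  rw [div_lt_iff₀ hε] at hq
  have hn0 := I.two_le
  obtain ⟨c, hc0, hc, hrec⟩ := I.H.exists_logZ_coeff I.d_pos hκ hg hh (by omega) hR hH
  obtain ⟨hb, E, hE, hZ⟩ := hc _ hβ
  have htail := norm_sub_sum_le_of_geometric (by norm_num) (by norm_num)
    (by simp [hc0]) hb hE
  set T := ∑ j ∈ Finset.range (140 * I.L), c (j + 1) * I.beta ^ (j + 1) with hTdef
  -- The tail estimate with nothing summed: `4 * n * (20 / 21) / (1 - 20 / 21) = 80 * n`.
  have h1 : ‖E‖ ≤ 80 * I.n := by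
    have := htail 0
    rw [Finset.sum_range_zero, sub_zero] at this
    refine this.trans (le_of_eq ?_)
    norm_num
    ring
  have hT : ‖T‖ ≤ 80 * I.n := by
    refine norm_sum_le_of_le _ (fun j _ => hb (j + 1)) |>.trans ?_
    have h2 : ∑ j ∈ Finset.range (140 * I.L), 4 * (I.n : ℝ) * (20 / 21) ^ (j + 1) =
        4 * I.n * (20 / 21) * ∑ j ∈ Finset.range (140 * I.L), ((20 : ℝ) / 21) ^ j := by
      rw [Finset.mul_sum]
      exact Finset.sum_congr rfl fun j _ => by ring
    have h3 : ∑ j ∈ Finset.range (140 * I.L), ((20 : ℝ) / 21) ^ j ≤ 21 :=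
      (Summable.sum_le_tsum _ (fun j _ => by positivity)
        (summable_geometric_of_lt_one (by norm_num) (by norm_num))).trans (le_of_eq (by
          rw [tsum_geometric_of_lt_one (by norm_num) (by norm_num)]; norm_num))
    rw [h2]
    nlinarith
  -- The tail is at most `80 * n * (20 / 21) ^ (140 * L)` and `n < 2 ^ L * ε`. As `(20 / 21) ^ 140 ≤
  -- 1 / 640`, the powers combine to `(1 / 320) ^ L`, which absorbs `320 = 4 * 80` because `L ≥ 1`.
  have hET : ‖E - T‖ ≤ I.ε / 4 := by
    refine (htail (140 * I.L)).trans ?_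
    have h2 : ((20 : ℝ) / 21) ^ (140 * I.L) * 320 * 2 ^ I.L ≤ 1 := by
      have h3 : ((20 : ℝ) / 21) ^ 140 ≤ 1 / 640 := by norm_num
      have h4 : (1 / 320 : ℝ) ^ I.L ≤ (1 / 320) ^ 1 :=
        pow_le_pow_of_le_one (by norm_num) (by norm_num) I.one_lt_L.le
      calc ((20 : ℝ) / 21) ^ (140 * I.L) * 320 * 2 ^ I.L
          ≤ (1 / 640) ^ I.L * 320 * 2 ^ I.L := by
            rw [pow_mul]
            gcongr
        _ = (1 / 320) ^ I.L * 320 := by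
            rw [mul_right_comm, ← mul_pow]
            norm_num
        _ ≤ _ := by
            rw [pow_one] at h4
            linarith
    have h5 : (0 : ℝ) < (20 / 21) ^ (140 * I.L) := by positivity
    have h6 : ((20 : ℝ) / 21) ^ (140 * I.L) * 320 * I.n ≤ I.ε := by
      calc ((20 : ℝ) / 21) ^ (140 * I.L) * 320 * I.n
          ≤ ((20 : ℝ) / 21) ^ (140 * I.L) * 320 * (2 ^ I.L * I.ε) :=
            mul_le_mul_of_nonneg_left hq.le (by positivity)
        _ = (((20 : ℝ) / 21) ^ (140 * I.L) * 320 * 2 ^ I.L) * I.ε := by ring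
        _ ≤ 1 * I.ε := mul_le_mul_of_nonneg_right h2 hε.le
        _ = I.ε := one_mul _
    rw [pow_succ]
    generalize ((20 : ℝ) / 21) ^ (140 * I.L) = v at h6
    norm_num
    linarith
  -- Since `e ^ 2 ≤ 8`, `exp (240 * n) ≤ 2 ^ (360 * n)`, and `1 / ε ≤ 2 ^ L`. The exponent `1 + 360
  -- * n + L` fits into `400 * (n + L)`.
  have hM : 2 * Real.exp (3 * (80 * I.n)) ≤ I.ε * 2 ^ (400 * (I.n + I.L)) := by
    have h2 : Real.exp 240 ≤ 2 ^ 360 := by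
      have h3 : Real.exp 240 = (Real.exp 1 ^ 2) ^ 120 := by
        rw [← pow_mul, ← Real.exp_nat_mul]; norm_num
      have h4 : Real.exp 1 ^ 2 ≤ 2 ^ 3 := by
        have := Real.exp_one_lt_d9
        have := Real.exp_pos 1
        nlinarith
      rw [h3, show (2 : ℝ) ^ 360 = (2 ^ 3) ^ 120 by rw [← pow_mul]]
      exact pow_le_pow_left₀ (by positivity) h4 120
    have h5 : Real.exp (3 * (80 * I.n)) ≤ 2 ^ (360 * I.n) := by
      rw [show 3 * (80 * (I.n : ℝ)) = I.n * 240 by ring, Real.exp_nat_mul, pow_mul]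
      exact pow_le_pow_left₀ (Real.exp_pos _).le h2 _
    have h6 : (1 : ℝ) ≤ I.ε * 2 ^ I.L := by linarith
    calc 2 * Real.exp (3 * (80 * I.n)) ≤ 2 * 2 ^ (360 * I.n) * (I.ε * 2 ^ I.L) := by
          have := Real.exp_pos (3 * (80 * (I.n : ℝ)))
          nlinarith
      _ = I.ε * 2 ^ (1 + 360 * I.n + I.L) := by ring
      _ ≤ I.ε * 2 ^ (400 * (I.n + I.L)) := by
          refine mul_le_mul_of_nonneg_left (pow_le_pow_right₀ (by norm_num) ?_) hε.le
          omega
  rw [toComplex_outNum_div (toComplex_logNum hrec _), I.H.partitionFunction_eq I.d_pos, ← mul_sub,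
    norm_mul, norm_mul, hZ, mul_left_comm]
  exact mul_le_mul_of_nonneg_left (norm_sum_sub_exp_le h1 hT hε1.le hET hM) (norm_nonneg _)

end Instance

theorem mainTheorem3 (D d κ R : ℕ) (g h : ℝ) (hd : 1 ≤ d) (hκ : 1 ≤ κ) (hg : 0 < g) (hh : 0 < h) :
    ∃ (P : RAM.Prog) (C : ℕ), ∀ (n : ℕ) (H : LatticeHamiltonian D d n) (β : ℚ × ℚ) (ε : ℚ),
      2 ≤ n → H.IsGeomLocal κ R → H.NormBound h → H.HasGrowthConstant g h →
      ‖gaussToComplex β‖ ≤ betaZero g h κ → 0 < ε → ε < 1 →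
      ∃ (ν : RAM.Mem) (t : ℕ),
        RAM.Runs P (RAM.initMem (encodeInput H β ε)) ν t ∧
        (t : ℝ) ≤ ((RAM.maxBits (encodeInput H β ε) : ℝ) *
          (n : ℝ) ^ Real.log ((n : ℝ) / (ε : ℝ))) ^ C ∧
        0 < ν 2 ∧
        ‖RAM.output ν - H.partitionFunction (gaussToComplex β)‖ ≤
          (ε : ℝ) * ‖H.partitionFunction (gaussToComplex β)‖ := by
  obtain ⟨p, c, hp⟩ := RAM.exists_prog D d κ 140 400
  -- The running time is at most `X ^ c`, and `X_le` bounds `X` by the third power of the base in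
  -- the claim.
  refine ⟨p, 3 * c, fun n H β ε hn hR _ hH hβ hε hε1 => ?_⟩
  let I : Instance D d κ := ⟨n, hd, H, β, ε, hn, fun T hT => by
    rw [← LatticeHamiltonian.size_eq_card]; exact (hR T hT).1, hε, hε1⟩
  obtain ⟨ν, t, hrun, ht, h0, h1, h2⟩ := hp I
  refine ⟨ν, t, hrun, ?_, ?_, ?_⟩
  · rw [pow_mul]
    calc (t : ℝ) ≤ (I.X : ℝ) ^ c := by exact_mod_cast ht
      _ ≤ _ := pow_le_pow_left₀ (Nat.cast_nonneg _) I.X_le c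
  · rw [h2]
    exact_mod_cast I.outDen_pos _ _
  · have h3 := I.norm_outNum_div_sub_le hκ hg hh hR hH hβ
    rw [GaussianInt.toComplex_def] at h3
    rw [RAM.output, h0, h1, h2]
    exact_mod_cast h3
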